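/- All algebras are unital associative over $\mathbb{C}$. Let $X(\mathfrak{o}_4)$ be the algebra with generators $t_{ij}^{(r)}$, $i,j\in\{-2,-1,1,2\}$, $r\ge 1$, and, for $t_{ij}(u)=\delta_{ij}+\sum_{r\ge1}t_{ij}^{(r)}u^{-r}$, the defining relations $$[t_{ij}(u),t_{kl}(v)]=\frac{t_{kj}(u)t_{il}(v)-t_{kj}(v)t_{il}(u)}{u-v}-\frac{1}{u-v-1}\Big(\delta_{k,-i}\sum_p t_{pj}(u)t_{-p,l}(v)-\delta_{l,-j}\sum_p t_{k,-p}(v)t_{ip}(u)\Big),$$ and let $Y(\mathfrak{o}_4)\subset X(\mathfrak{o}_4)$ be the subalgebra of the elements fixed by all automorphisms $t_{ij}(u)\mapsto f(u)t_{ij}(u)$, $f(u)\in 1+u^{-1}\mathbb{C}[[u^{-1}]]$. Let $Y(\mathfrak{gl}_2)$ be the algebra with generators $T_{ij}^{(r)}$, $i,j\in\{1,2\}$, $r\ge1$, and, for $T_{ij}(u)=\delta_{ij}+\sum_{r\ge1}T_{ij}^{(r)}u^{-r}$, the defining relations $$(u-v)[T_{ij}(u),T_{kl}(v)]=T_{kj}(u)T_{il}(v)-T_{kj}(v)T_{il}(u),$$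 and let $Y(\mathfrak{sl}_2)\subset Y(\mathfrak{gl}_2)$ be the subalgebra of the elements fixed by all automorphisms $T_{ij}(u)\mapsto g(u)T_{ij}(u)$, $g(u)\in1+u^{-1}\mathbb{C}[[u^{-1}]]$. Put $D(u)=T_{11}(u)T_{22}(u-1)-T_{21}(u)T_{12}(u-1)$, let $d(u)$ be the unique series with coefficients in $Y(\mathfrak{gl}_2)$ and constant term $1$ such that $d(u)d(u-1)=D(u)$, and put $\mathcal T_{ij}(u)=d(u)^{-1}T_{ij}(u)$. Then the following hold. (1) There is a homomorphism $\pi:Y(\mathfrak{gl}_2)\to Y(\mathfrak{sl}_2)$ with $T_{ij}(u)\mapsto\mathcal T_{ij}(u)$. (2) Identify $\mathbb{C}^4$ with $\mathbb{C}^2\otimes\mathbb{C}^2$ through the basis $v_{-2}=e_1\otimes e_1$, $v_{-1}=e_1\otimes e_2$, $v_1=e_2\otimes e_1$, $v_2=-e_2\otimes e_2$. There is an injective homomorphism $\psi:X(\mathfrak{o}_4)\to Y(\mathfrak{gl}_2)\otimes Y(\mathfrak{gl}_2)$ with $T(u)\mapsto T^\circ_1(u)\,T^{\circ\,\prime}_2(u)$.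 Here $T(u)=(t_{ij}(u))$, and $T^\circ(u)$, $T^{\circ\,\prime}(u)$ are the matrices of the series $T_{ij}(u)$ of the first and of the second copy of $Y(\mathfrak{gl}_2)$; the former acts in the first and the latter in the second tensor factor of $\mathbb{C}^2\otimes\mathbb{C}^2$. (3) The homomorphisms $\chi^{(1)}=(\pi\otimes\mathrm{id})\circ\psi:X(\mathfrak{o}_4)\to Y(\mathfrak{sl}_2)\otimes Y(\mathfrak{gl}_2)$ and $\chi^{(2)}=(\mathrm{id}\otimes\pi)\circ\psi:X(\mathfrak{o}_4)\to Y(\mathfrak{gl}_2)\otimes Y(\mathfrak{sl}_2)$ are isomorphisms. (4) The restriction of each of $\chi^{(1)}$ and $\chi^{(2)}$ to $Y(\mathfrak{o}_4)$ is an isomorphism $Y(\mathfrak{o}_4)\to Y(\mathfrak{sl}_2)\otimes Y(\mathfrak{sl}_2)$ onto the subalgebra $Y(\mathfrak{sl}_2)\otimes Y(\mathfrak{sl}_2)$ of $Y(\mathfrak{sl}_2)\otimes Y(\mathfrak{gl}_2)$, respectively of $Y(\mathfrak{gl}_2)\otimes Y(\mathfrak{sl}_2)$. -/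

import Mathlib

open scoped TensorProduct PowerSeries

set_option linter.unusedSectionVars false

noncomputable section

namespace LowRankYangian

/-!
Formal series in `u⁻¹` with coefficients in an algebra `A` are elements of `A⟦X⟧`, the variable
`X` standing for `u⁻¹`. Formal series in `u⁻¹` and `v⁻¹` are elements of `A⟦X⟧⟦X⟧`: the outer
variable stands for `u⁻¹` and the inner one for `v⁻¹`.
-/

section Series

variable {A : Type*} [Ring A] [Algebra ℂ A]

/-- `F(u)`, for a series `F`, as a series in `u⁻¹` and `v⁻¹`. -/
def inU (F : A⟦X⟧) : A⟦X⟧⟦X⟧ := PowerSeries.map PowerSeries.C F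

/-- `F(v)`, for a series `F`, as a series in `u⁻¹` and `v⁻¹`. -/
def inV (F : A⟦X⟧) : A⟦X⟧⟦X⟧ := PowerSeries.C F

/-- `u⁻¹` -/
def uInv (A : Type*) [Ring A] : A⟦X⟧⟦X⟧ := inU PowerSeries.X

/-- `v⁻¹` -/
def vInv (A : Type*) [Ring A] : A⟦X⟧⟦X⟧ := inV PowerSeries.X

/-- A complex constant as a series in `u⁻¹` and `v⁻¹`. -/
def const₂ (A : Type*) [Ring A] [Algebra ℂ A] (c : ℂ) : A⟦X⟧⟦X⟧ :=
  PowerSeries.C (PowerSeries.C (algebraMap ℂ A c))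

/-- `u⁻¹ v⁻¹ (u - v - c) = v⁻¹ - u⁻¹ - c u⁻¹ v⁻¹` -/
def linFactor (A : Type*) [Ring A] [Algebra ℂ A] (c : ℂ) : A⟦X⟧⟦X⟧ :=
  vInv A - uInv A - const₂ A c * (uInv A * vInv A)

/-- A series with complex coefficients regarded as a series with coefficients in `A`. -/
def scalarSeries (A : Type*) [Ring A] [Algebra ℂ A] (f : ℂ⟦X⟧) : A⟦X⟧ :=
  PowerSeries.map (algebraMap ℂ A) f

/-- The series `F(u - 1)`: the `n`-th coefficient is `∑ F_r · [u⁻ⁿ] (u - 1)⁻ʳ`, where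
`(u - 1)⁻¹ = u⁻¹ (1 + u⁻¹ + u⁻² + ⋯)`; the terms with `r > n` vanish. -/
def shiftOne (F : A⟦X⟧) : A⟦X⟧ :=
  PowerSeries.mk fun n => ∑ r ∈ Finset.range (n + 1),
    PowerSeries.coeff n ((PowerSeries.X * PowerSeries.mk (fun _ => (1 : ℂ))) ^ r) •
      PowerSeries.coeff r F

end Series

/-! ### The relations -/

section Relations

variable {A : Type*} [Ring A] [Algebra ℂ A] {N : ℕ}

/-- Left side of the relation
`(u - v) [T_{ij}(u), T_{kl}(v)] = T_{kj}(u) T_{il}(v) - T_{kj}(v) T_{il}(u)`,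
multiplied by `u⁻¹ v⁻¹`. -/
def glLHS (T : Fin N → Fin N → A⟦X⟧) (i j k l : Fin N) : A⟦X⟧⟦X⟧ :=
  linFactor A 0 * (inU (T i j) * inV (T k l) - inV (T k l) * inU (T i j))

/-- Right side of the same relation, multiplied by `u⁻¹ v⁻¹`. -/
def glRHS (T : Fin N → Fin N → A⟦X⟧) (i j k l : Fin N) : A⟦X⟧⟦X⟧ :=
  uInv A * vInv A * (inU (T k j) * inV (T i l) - inV (T k j) * inU (T i l))

/-- `κ = N / 2 - 1` in the orthogonal case -/
def kappa (N : ℕ) : ℂ := (N : ℂ) / 2 - 1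

/-- Left side of the relation
`[t_{ij}(u), t_{kl}(v)] = (u - v)⁻¹ (t_{kj}(u) t_{il}(v) - t_{kj}(v) t_{il}(u))`
`  - (u - v - κ)⁻¹ (δ_{k,-i} ∑ₚ t_{pj}(u) t_{-p,l}(v) - δ_{l,-j} ∑ₚ t_{k,-p}(v) t_{ip}(u))`,
multiplied by `u⁻² v⁻² (u - v) (u - v - κ)`. -/
def oLHS (t : Fin N → Fin N → A⟦X⟧) (i j k l : Fin N) : A⟦X⟧⟦X⟧ :=
  linFactor A 0 * linFactor A (kappa N) *
    (inU (t i j) * inV (t k l) - inV (t k l) * inU (t i j))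

/-- Right side of the same relation, multiplied by `u⁻² v⁻² (u - v) (u - v - κ)`. The indices
`-n, …, n` (with `0` skipped for even `N`) are listed increasingly by `Fin N`, so that the
negative of an index is `Fin.rev`. -/
def oRHS (t : Fin N → Fin N → A⟦X⟧) (i j k l : Fin N) : A⟦X⟧⟦X⟧ :=
  uInv A * vInv A * linFactor A (kappa N) *
      (inU (t k j) * inV (t i l) - inV (t k j) * inU (t i l)) -
    uInv A * vInv A * linFactor A 0 *
      ((if k = i.rev then ∑ p, inU (t p j) * inV (t p.rev l) else 0) -
        (if l = j.rev then ∑ p, inV (t k p.rev) * inU (t i p) else 0))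

end Relations

/-! ### The algebras -/

/-- The free algebra on the generators `t_{ij}^{(r)}`, `r ≥ 1`; the triple `(i, j, s)` stands
for `t_{ij}^{(s + 1)}`. -/
abbrev Free (N : ℕ) : Type := FreeAlgebra ℂ (Fin N × Fin N × ℕ)

/-- The series `δ_{ij} + t_{ij}^{(1)} u⁻¹ + t_{ij}^{(2)} u⁻² + ⋯` over the free algebra. -/
def freeSeries {N : ℕ} (i j : Fin N) : (Free N)⟦X⟧ :=
  PowerSeries.mk fun r =>
    match r with
    | 0 => if i = j then 1 else 0
    | s + 1 => FreeAlgebra.ι ℂ (i, j, s)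

/-- The defining relations of `Y(gl_N)`, coefficient by coefficient. -/
inductive GlRel (N : ℕ) : Free N → Free N → Prop
  | rel (i j k l : Fin N) (a b : ℕ) : GlRel N
      (PowerSeries.coeff b (PowerSeries.coeff a (glLHS freeSeries i j k l)))
      (PowerSeries.coeff b (PowerSeries.coeff a (glRHS freeSeries i j k l)))

/-- The defining relations of `X(o_N)`, coefficient by coefficient. -/
inductive ORel (N : ℕ) : Free N → Free N → Prop
  | rel (i j k l : Fin N) (a b : ℕ) : ORel N
      (PowerSeries.coeff b (PowerSeries.coeff a (oLHS freeSeries i j k l)))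
      (PowerSeries.coeff b (PowerSeries.coeff a (oRHS freeSeries i j k l)))

/-- The Yangian `Y(gl_N)`. -/
def YGl (N : ℕ) : Type := RingQuot (GlRel N)

instance (N : ℕ) : Ring (YGl N) := inferInstanceAs (Ring (RingQuot (GlRel N)))
instance (N : ℕ) : Algebra ℂ (YGl N) := inferInstanceAs (Algebra ℂ (RingQuot (GlRel N)))

/-- The extended Yangian `X(o_N)`. -/
def XO (N : ℕ) : Type := RingQuot (ORel N)

instance (N : ℕ) : Ring (XO N) := inferInstanceAs (Ring (RingQuot (ORel N)))
instance (N : ℕ) : Algebra ℂ (XO N) := inferInstanceAs (Algebra ℂ (RingQuot (ORel N)))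

/-- The quotient map onto `Y(gl_N)`. -/
def YGl.mk (N : ℕ) : Free N →ₐ[ℂ] YGl N := RingQuot.mkAlgHom ℂ (GlRel N)

/-- The quotient map onto `X(o_N)`. -/
def XO.mk (N : ℕ) : Free N →ₐ[ℂ] XO N := RingQuot.mkAlgHom ℂ (ORel N)

/-- The series `T_{ij}(u)` of `Y(gl_N)`. -/
def YGl.T {N : ℕ} (i j : Fin N) : (YGl N)⟦X⟧ :=
  PowerSeries.map (YGl.mk N).toRingHom (freeSeries i j)

/-- The series `t_{ij}(u)` of `X(o_N)`. -/
def XO.t {N : ℕ} (i j : Fin N) : (XO N)⟦X⟧ :=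
  PowerSeries.map (XO.mk N).toRingHom (freeSeries i j)

/-! ### The homomorphisms `T(u) ↦ f(u) T(u)` -/

section Lemmas

variable {A B : Type*} [Ring A] [Algebra ℂ A] [Ring B] [Algebra ℂ B] {N : ℕ}

lemma map_inU (φ : A →ₐ[ℂ] B) (F : A⟦X⟧) :
    PowerSeries.map (PowerSeries.map φ.toRingHom) (inU F) =
      inU (PowerSeries.map φ.toRingHom F) := by
  ext a b
  simp only [inU, PowerSeries.coeff_map, PowerSeries.coeff_C]
  split_ifs <;> simp

lemma map_inV (φ : A →ₐ[ℂ] B) (F : A⟦X⟧) :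
    PowerSeries.map (PowerSeries.map φ.toRingHom) (inV F) =
      inV (PowerSeries.map φ.toRingHom F) := by
  simp [inV]

lemma map_uInv (φ : A →ₐ[ℂ] B) :
    PowerSeries.map (PowerSeries.map φ.toRingHom) (uInv A) = uInv B := by
  rw [uInv, map_inU, PowerSeries.map_X]; rfl

lemma map_vInv (φ : A →ₐ[ℂ] B) :
    PowerSeries.map (PowerSeries.map φ.toRingHom) (vInv A) = vInv B := by
  rw [vInv, map_inV, PowerSeries.map_X]; rfl

lemma map_linFactor (φ : A →ₐ[ℂ] B) (c : ℂ) :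
    PowerSeries.map (PowerSeries.map φ.toRingHom) (linFactor A c) = linFactor B c := by
  have h : PowerSeries.map (PowerSeries.map φ.toRingHom) (const₂ A c) = const₂ B c := by
    simp [const₂]
  simp only [linFactor, map_sub, map_mul, map_uInv, map_vInv, h]

lemma map_glLHS (φ : A →ₐ[ℂ] B) (T : Fin N → Fin N → A⟦X⟧) (i j k l : Fin N) :
    PowerSeries.map (PowerSeries.map φ.toRingHom) (glLHS T i j k l) =
      glLHS (fun i j => PowerSeries.map φ.toRingHom (T i j)) i j k l := by
  simp only [glLHS, map_sub, map_mul, map_linFactor, map_inU, map_inV]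

lemma map_glRHS (φ : A →ₐ[ℂ] B) (T : Fin N → Fin N → A⟦X⟧) (i j k l : Fin N) :
    PowerSeries.map (PowerSeries.map φ.toRingHom) (glRHS T i j k l) =
      glRHS (fun i j => PowerSeries.map φ.toRingHom (T i j)) i j k l := by
  simp only [glRHS, map_sub, map_mul, map_uInv, map_vInv, map_inU, map_inV]

lemma map_oLHS (φ : A →ₐ[ℂ] B) (t : Fin N → Fin N → A⟦X⟧) (i j k l : Fin N) :
    PowerSeries.map (PowerSeries.map φ.toRingHom) (oLHS t i j k l) =
      oLHS (fun i j => PowerSeries.map φ.toRingHom (t i j)) i j k l := by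
  simp only [oLHS, map_sub, map_mul, map_linFactor, map_inU, map_inV]

lemma map_oRHS (φ : A →ₐ[ℂ] B) (t : Fin N → Fin N → A⟦X⟧) (i j k l : Fin N) :
    PowerSeries.map (PowerSeries.map φ.toRingHom) (oRHS t i j k l) =
      oRHS (fun i j => PowerSeries.map φ.toRingHom (t i j)) i j k l := by
  simp only [oRHS, map_sub, map_mul, map_uInv, map_vInv, map_linFactor,
    apply_ite (PowerSeries.map (PowerSeries.map φ.toRingHom)), map_sum, map_inU, map_inV, map_zero]

lemma inU_mul (F G : A⟦X⟧) : inU (F * G) = inU F * inU G := map_mul _ _ _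

lemma inV_mul (F G : A⟦X⟧) : inV (F * G) = inV F * inV G := map_mul _ _ _

lemma scalar_comm (f : ℂ⟦X⟧) (F : A⟦X⟧) : F * scalarSeries A f = scalarSeries A f * F := by
  ext n
  rw [PowerSeries.coeff_mul, PowerSeries.coeff_mul, ← Finset.Nat.sum_antidiagonal_swap]
  refine Finset.sum_congr rfl fun p _ => ?_
  simp only [scalarSeries, PowerSeries.coeff_map, Prod.fst_swap, Prod.snd_swap]
  exact (Algebra.commutes _ _).symm

lemma inU_comm (f : ℂ⟦X⟧) (G : A⟦X⟧⟦X⟧) :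
    G * inU (scalarSeries A f) = inU (scalarSeries A f) * G := by
  ext n : 1
  rw [PowerSeries.coeff_mul, PowerSeries.coeff_mul, ← Finset.Nat.sum_antidiagonal_swap]
  refine Finset.sum_congr rfl fun p _ => ?_
  have h : ∀ c : ℂ, (PowerSeries.C (algebraMap ℂ A c) : A⟦X⟧) =
      scalarSeries A (PowerSeries.C c) := fun c => by simp [scalarSeries]
  simp only [inU, scalarSeries, PowerSeries.coeff_map, Prod.fst_swap, Prod.snd_swap, h]
  exact scalar_comm _ _

lemma inV_comm (f : ℂ⟦X⟧) (G : A⟦X⟧⟦X⟧) :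
    G * inV (scalarSeries A f) = inV (scalarSeries A f) * G := by
  ext n : 1
  simp only [inV, PowerSeries.coeff_mul_C, PowerSeries.coeff_C_mul]
  exact scalar_comm _ _

/-- `f(u) f(v)` -/
lemma inU_mul_inV (f : ℂ⟦X⟧) (F G : A⟦X⟧) :
    inU (scalarSeries A f * F) * inV (scalarSeries A f * G) =
      inU (scalarSeries A f) * inV (scalarSeries A f) * (inU F * inV G) := by
  rw [inU_mul, inV_mul, mul_assoc, ← mul_assoc (inU F), inV_comm, mul_assoc, mul_assoc]

lemma inV_mul_inU (f : ℂ⟦X⟧) (F G : A⟦X⟧) :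
    inV (scalarSeries A f * F) * inU (scalarSeries A f * G) =
      inU (scalarSeries A f) * inV (scalarSeries A f) * (inV F * inU G) := by
  rw [inU_mul, inV_mul, mul_assoc, ← mul_assoc (inV F), inU_comm, ← mul_assoc, ← mul_assoc,
    ← mul_assoc, inU_comm]

lemma pull (f : ℂ⟦X⟧) (G H : A⟦X⟧⟦X⟧) :
    G * (inU (scalarSeries A f) * inV (scalarSeries A f) * H) =
      inU (scalarSeries A f) * inV (scalarSeries A f) * (G * H) := by
  rw [← mul_assoc, ← mul_assoc, inU_comm, mul_assoc _ G, inV_comm]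
  simp only [mul_assoc]

lemma glLHS_scale (f : ℂ⟦X⟧) (T : Fin N → Fin N → A⟦X⟧) (i j k l : Fin N) :
    glLHS (fun i j => scalarSeries A f * T i j) i j k l =
      inU (scalarSeries A f) * inV (scalarSeries A f) * glLHS T i j k l := by
  simp only [glLHS, inU_mul_inV, inV_mul_inU, ← mul_sub, pull]

lemma glRHS_scale (f : ℂ⟦X⟧) (T : Fin N → Fin N → A⟦X⟧) (i j k l : Fin N) :
    glRHS (fun i j => scalarSeries A f * T i j) i j k l =
      inU (scalarSeries A f) * inV (scalarSeries A f) * glRHS T i j k l := by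
  simp only [glRHS, inU_mul_inV, inV_mul_inU, ← mul_sub, pull]

lemma oLHS_scale (f : ℂ⟦X⟧) (t : Fin N → Fin N → A⟦X⟧) (i j k l : Fin N) :
    oLHS (fun i j => scalarSeries A f * t i j) i j k l =
      inU (scalarSeries A f) * inV (scalarSeries A f) * oLHS t i j k l := by
  simp only [oLHS, inU_mul_inV, inV_mul_inU, ← mul_sub, pull]

lemma oRHS_scale (f : ℂ⟦X⟧) (t : Fin N → Fin N → A⟦X⟧) (i j k l : Fin N) :
    oRHS (fun i j => scalarSeries A f * t i j) i j k l =
      inU (scalarSeries A f) * inV (scalarSeries A f) * oRHS t i j k l := by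
  have h : ∀ (p : Prop) [Decidable p] (Z G : A⟦X⟧⟦X⟧),
      (if p then Z * G else 0) = Z * (if p then G else 0) := fun p _ Z G => by
    split_ifs <;> simp
  simp only [oRHS, inU_mul_inV, inV_mul_inU, ← Finset.mul_sum, h, ← mul_sub, pull]

/-- A family of series with constant terms `δ_{ij}` is the image of the generating series under
the homomorphism from the free algebra which it defines. -/
lemma map_lift_freeSeries (S : Fin N → Fin N → A⟦X⟧)
    (hS : ∀ i j, PowerSeries.coeff 0 (S i j) = if i = j then 1 else 0) (i j : Fin N) :
    PowerSeries.map
      (FreeAlgebra.lift ℂ fun g : Fin N × Fin N × ℕ =>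
        PowerSeries.coeff (g.2.2 + 1) (S g.1 g.2.1)).toRingHom (freeSeries i j) = S i j := by
  ext r
  cases r with
  | zero =>
    rw [hS]
    simp only [freeSeries, PowerSeries.coeff_map, PowerSeries.coeff_mk]
    split_ifs <;> simp
  | succ s => simp [freeSeries]

end Lemmas

section Lift

variable {A : Type*} [Ring A] [Algebra ℂ A] {N : ℕ}

/-- The homomorphism from `Y(gl_N)` which sends `T_{ij}(u)` to `S i j`, for series `S i j`
satisfying the defining relations. -/
def YGl.lift (S : Fin N → Fin N → A⟦X⟧)
    (hS : ∀ i j, PowerSeries.coeff 0 (S i j) = if i = j then 1 else 0)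
    (hrel : ∀ i j k l, glLHS S i j k l = glRHS S i j k l) : YGl N →ₐ[ℂ] A :=
  RingQuot.liftAlgHom ℂ ⟨FreeAlgebra.lift ℂ fun g : Fin N × Fin N × ℕ =>
    PowerSeries.coeff (g.2.2 + 1) (S g.1 g.2.1), by
      rintro _ _ ⟨i, j, k, l, a, b⟩
      have hm := map_lift_freeSeries S hS
      set φ := FreeAlgebra.lift ℂ fun g : Fin N × Fin N × ℕ =>
        PowerSeries.coeff (g.2.2 + 1) (S g.1 g.2.1)
      have key := (map_glLHS φ freeSeries i j k l).trans <| by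
        simp only [hm]; exact (hrel i j k l).trans (by simp only [map_glRHS, hm] :
          _ = PowerSeries.map (PowerSeries.map φ.toRingHom) (glRHS freeSeries i j k l))
      have := congrArg (fun F => PowerSeries.coeff b (PowerSeries.coeff a F)) key
      simp only [PowerSeries.coeff_map] at this
      exact this⟩

lemma YGl.map_lift (S : Fin N → Fin N → A⟦X⟧)
    (hS : ∀ i j, PowerSeries.coeff 0 (S i j) = if i = j then 1 else 0)
    (hrel : ∀ i j k l, glLHS S i j k l = glRHS S i j k l) (i j : Fin N) :
    PowerSeries.map (YGl.lift S hS hrel).toRingHom (YGl.T i j) = S i j := by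
  rw [← map_lift_freeSeries S hS i j]
  ext r
  simp only [YGl.T, PowerSeries.coeff_map]
  exact RingQuot.liftAlgHom_mkAlgHom_apply ℂ _ _ _

/-- The homomorphism from `X(o_N)` which sends `t_{ij}(u)` to `S i j`, for series `S i j`
satisfying the defining relations. -/
def XO.lift (S : Fin N → Fin N → A⟦X⟧)
    (hS : ∀ i j, PowerSeries.coeff 0 (S i j) = if i = j then 1 else 0)
    (hrel : ∀ i j k l, oLHS S i j k l = oRHS S i j k l) : XO N →ₐ[ℂ] A :=
  RingQuot.liftAlgHom ℂ ⟨FreeAlgebra.lift ℂ fun g : Fin N × Fin N × ℕ =>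
    PowerSeries.coeff (g.2.2 + 1) (S g.1 g.2.1), by
      rintro _ _ ⟨i, j, k, l, a, b⟩
      have hm := map_lift_freeSeries S hS
      set φ := FreeAlgebra.lift ℂ fun g : Fin N × Fin N × ℕ =>
        PowerSeries.coeff (g.2.2 + 1) (S g.1 g.2.1)
      have key := (map_oLHS φ freeSeries i j k l).trans <| by
        simp only [hm]; exact (hrel i j k l).trans (by simp only [map_oRHS, hm] :
          _ = PowerSeries.map (PowerSeries.map φ.toRingHom) (oRHS freeSeries i j k l))
      have := congrArg (fun F => PowerSeries.coeff b (PowerSeries.coeff a F)) key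
      simp only [PowerSeries.coeff_map] at this
      exact this⟩

lemma XO.map_lift (S : Fin N → Fin N → A⟦X⟧)
    (hS : ∀ i j, PowerSeries.coeff 0 (S i j) = if i = j then 1 else 0)
    (hrel : ∀ i j k l, oLHS S i j k l = oRHS S i j k l) (i j : Fin N) :
    PowerSeries.map (XO.lift S hS hrel).toRingHom (XO.t i j) = S i j := by
  rw [← map_lift_freeSeries S hS i j]
  ext r
  simp only [XO.t, PowerSeries.coeff_map]
  exact RingQuot.liftAlgHom_mkAlgHom_apply ℂ _ _ _

lemma YGl.T_rel (i j k l : Fin N) :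
    glLHS (A := YGl N) YGl.T i j k l = glRHS YGl.T i j k l := by
  have h1 := map_glLHS (YGl.mk N) freeSeries i j k l
  have h2 := map_glRHS (YGl.mk N) freeSeries i j k l
  refine h1.symm.trans (Eq.trans ?_ h2)
  ext a b
  simp only [PowerSeries.coeff_map]
  exact RingQuot.mkAlgHom_rel ℂ (GlRel.rel i j k l a b)

lemma XO.t_rel (i j k l : Fin N) :
    oLHS (A := XO N) XO.t i j k l = oRHS XO.t i j k l := by
  have h1 := map_oLHS (XO.mk N) freeSeries i j k l
  have h2 := map_oRHS (XO.mk N) freeSeries i j k l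
  refine h1.symm.trans (Eq.trans ?_ h2)
  ext a b
  simp only [PowerSeries.coeff_map]
  exact RingQuot.mkAlgHom_rel ℂ (ORel.rel i j k l a b)

lemma YGl.coeff_zero_T (i j : Fin N) :
    PowerSeries.coeff 0 (YGl.T i j) = if i = j then 1 else 0 := by
  simp only [YGl.T, freeSeries, PowerSeries.coeff_map, PowerSeries.coeff_mk]
  split_ifs <;> simp

lemma XO.coeff_zero_t (i j : Fin N) :
    PowerSeries.coeff 0 (XO.t i j) = if i = j then 1 else 0 := by
  simp only [XO.t, freeSeries, PowerSeries.coeff_map, PowerSeries.coeff_mk]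
  split_ifs <;> simp

lemma coeff_zero_scale (f : ℂ⟦X⟧) (hf : PowerSeries.constantCoeff f = 1) (F : A⟦X⟧) :
    PowerSeries.coeff 0 (scalarSeries A f * F) = PowerSeries.coeff 0 F := by
  have h : PowerSeries.coeff 0 (scalarSeries A f) = 1 := by
    rw [scalarSeries, PowerSeries.coeff_map, PowerSeries.coeff_zero_eq_constantCoeff_apply, hf,
      map_one]
  rw [PowerSeries.coeff_mul]
  simp [h]

end Lift

/-- The endomorphism `T(u) ↦ g(u) T(u)` of `Y(gl_N)`, for `g(u) = 1 + g₁ u⁻¹ + ⋯` (it is an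
automorphism, with inverse given by `g(u)⁻¹`). -/
def YGl.scale (N : ℕ) (g : ℂ⟦X⟧) (hg : PowerSeries.constantCoeff g = 1) : YGl N →ₐ[ℂ] YGl N :=
  YGl.lift (fun i j => scalarSeries (YGl N) g * YGl.T i j)
    (fun i j => by rw [coeff_zero_scale g hg, YGl.coeff_zero_T])
    (fun i j k l => by rw [glLHS_scale, glRHS_scale, YGl.T_rel])

/-- The endomorphism `T(u) ↦ f(u) T(u)` of `X(o_N)`, for `f(u) = 1 + f₁ u⁻¹ + ⋯` (it is an
automorphism, with inverse given by `f(u)⁻¹`). -/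
def XO.scale (N : ℕ) (f : ℂ⟦X⟧) (hf : PowerSeries.constantCoeff f = 1) : XO N →ₐ[ℂ] XO N :=
  XO.lift (fun i j => scalarSeries (XO N) f * XO.t i j)
    (fun i j => by rw [coeff_zero_scale f hf, XO.coeff_zero_t])
    (fun i j k l => by rw [oLHS_scale, oRHS_scale, XO.t_rel])

/-- The Yangian `Y(sl_N)`: the subalgebra of `Y(gl_N)` of the elements stable under all
automorphisms `T(u) ↦ g(u) T(u)`. -/
def YSl (N : ℕ) : Subalgebra ℂ (YGl N) :=
  ⨅ g : {g : ℂ⟦X⟧ // PowerSeries.constantCoeff g = 1},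
    AlgHom.equalizer (YGl.scale N g.1 g.2) (AlgHom.id ℂ (YGl N))

/-- The Yangian `Y(o_N)`: the subalgebra of `X(o_N)` of the elements stable under all
automorphisms `T(u) ↦ f(u) T(u)`. -/
def YO (N : ℕ) : Subalgebra ℂ (XO N) :=
  ⨅ f : {f : ℂ⟦X⟧ // PowerSeries.constantCoeff f = 1},
    AlgHom.equalizer (XO.scale N f.1 f.2) (AlgHom.id ℂ (XO N))

/-! ### The projection `Y(gl_2) → Y(sl_2)` and the map `X(o_4) → Y(gl_2) ⊗ Y(gl_2)` -/

/-- The quantum determinant `D(u) = T₁₁(u) T₂₂(u - 1) - T₂₁(u) T₁₂(u - 1)` of `Y(gl_2)`; the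
indices `1, 2` are `0, 1 : Fin 2`. -/
def qdet : (YGl 2)⟦X⟧ :=
  YGl.T 0 0 * shiftOne (YGl.T 1 1) - YGl.T 1 0 * shiftOne (YGl.T 0 1)

/-- The coefficients of the series `d(u) = 1 + d₁ u⁻¹ + ⋯` with `d(u) d(u - 1) = D(u)`, up to
degree `n`, for a series `D` with constant term `1`. As `d_m` enters the `m`-th coefficient of
`d(u) d(u - 1)` only through the summand `2 d_m`, the coefficients are found one by one. -/
def shiftRootUpTo {A : Type*} [Ring A] [Algebra ℂ A] (D : A⟦X⟧) : ℕ → A⟦X⟧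
  | 0 => 1
  | n + 1 => shiftRootUpTo D n + PowerSeries.monomial (n + 1)
      ((1 / 2 : ℂ) • PowerSeries.coeff (n + 1)
        (D - shiftRootUpTo D n * shiftOne (shiftRootUpTo D n)))

/-- The series `d(u) = 1 + d₁ u⁻¹ + ⋯` with `d(u) d(u - 1) = D(u)`. -/
def shiftRoot {A : Type*} [Ring A] [Algebra ℂ A] (D : A⟦X⟧) : A⟦X⟧ :=
  PowerSeries.mk fun n => PowerSeries.coeff n (shiftRootUpTo D n)

section ShiftRoot

variable {A : Type*} [Ring A] [Algebra ℂ A]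

lemma coeff_shiftOne (n : ℕ) (F : A⟦X⟧) :
    PowerSeries.coeff n (shiftOne F) =
      (∑ r ∈ Finset.range n,
        PowerSeries.coeff n ((PowerSeries.X * PowerSeries.mk (fun _ => (1 : ℂ))) ^ r) •
          PowerSeries.coeff r F) + PowerSeries.coeff n F := by
  have h : PowerSeries.coeff n ((PowerSeries.X * PowerSeries.mk (fun _ => (1 : ℂ))) ^ n) = 1 := by
    rw [mul_pow, PowerSeries.coeff_X_pow_mul', if_pos le_rfl, Nat.sub_self,
      PowerSeries.coeff_zero_eq_constantCoeff_apply, map_pow,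
      ← PowerSeries.coeff_zero_eq_constantCoeff_apply, PowerSeries.coeff_mk, one_pow]
  rw [shiftOne, PowerSeries.coeff_mk, Finset.sum_range_succ, h, one_smul]

lemma coeff_shiftOne_congr {F G : A⟦X⟧} {n : ℕ}
    (h : ∀ m ≤ n, PowerSeries.coeff m F = PowerSeries.coeff m G) :
    PowerSeries.coeff n (shiftOne F) = PowerSeries.coeff n (shiftOne G) := by
  rw [coeff_shiftOne, coeff_shiftOne, h n le_rfl]
  congr 1
  exact Finset.sum_congr rfl fun r hr => by rw [h r (Finset.mem_range.1 hr).le]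

lemma coeff_mul_shiftOne_congr {F G : A⟦X⟧} {n : ℕ}
    (h : ∀ m ≤ n, PowerSeries.coeff m F = PowerSeries.coeff m G) :
    PowerSeries.coeff n (F * shiftOne F) = PowerSeries.coeff n (G * shiftOne G) := by
  rw [PowerSeries.coeff_mul, PowerSeries.coeff_mul]
  refine Finset.sum_congr rfl fun p hp => ?_
  have hp' := Finset.HasAntidiagonal.mem_antidiagonal.1 hp
  rw [h p.1 (by omega), coeff_shiftOne_congr fun m hm => h m (by omega)]

lemma coeff_mul_shiftOne_sub {F G : A⟦X⟧} {n : ℕ}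
    (h : ∀ m ≤ n, PowerSeries.coeff m F = PowerSeries.coeff m G)
    (h0 : PowerSeries.coeff 0 G = 1) :
    PowerSeries.coeff (n + 1) (F * shiftOne F) - PowerSeries.coeff (n + 1) (G * shiftOne G) =
      (2 : ℂ) • (PowerSeries.coeff (n + 1) F - PowerSeries.coeff (n + 1) G) := by
  have hF0 : PowerSeries.coeff 0 F = 1 := (h 0 (Nat.zero_le n)).trans h0
  have s0 : ∀ H : A⟦X⟧, PowerSeries.coeff 0 (shiftOne H) = PowerSeries.coeff 0 H := fun H => by
    rw [coeff_shiftOne, Finset.sum_range_zero, zero_add]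
  have e : ∀ H : A⟦X⟧, PowerSeries.coeff 0 H = 1 →
      PowerSeries.coeff (n + 1) (H * shiftOne H) =
        ((∑ k ∈ Finset.range n, PowerSeries.coeff (k + 1) H *
          PowerSeries.coeff (n + 1 - (k + 1)) (shiftOne H)) +
          PowerSeries.coeff (n + 1) (shiftOne H)) + PowerSeries.coeff (n + 1) H := fun H hH => by
    rw [PowerSeries.coeff_mul, Finset.Nat.sum_antidiagonal_eq_sum_range_succ_mk,
      Finset.sum_range_succ, Finset.sum_range_succ']
    simp only [Nat.sub_self, Nat.sub_zero, s0, hH, mul_one, one_mul]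
  have hs : (∑ k ∈ Finset.range n, PowerSeries.coeff (k + 1) F *
      PowerSeries.coeff (n + 1 - (k + 1)) (shiftOne F)) =
      ∑ k ∈ Finset.range n, PowerSeries.coeff (k + 1) G *
        PowerSeries.coeff (n + 1 - (k + 1)) (shiftOne G) :=
    Finset.sum_congr rfl fun k hk => by
      have hk' := Finset.mem_range.1 hk
      rw [h (k + 1) (by omega), coeff_shiftOne_congr fun m hm => h m (by omega)]
  have hr : (∑ r ∈ Finset.range (n + 1),
        PowerSeries.coeff (n + 1) ((PowerSeries.X * PowerSeries.mk (fun _ => (1 : ℂ))) ^ r) •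
          PowerSeries.coeff r F) = ∑ r ∈ Finset.range (n + 1),
        PowerSeries.coeff (n + 1) ((PowerSeries.X * PowerSeries.mk (fun _ => (1 : ℂ))) ^ r) •
          PowerSeries.coeff r G :=
    Finset.sum_congr rfl fun r hr => by
      rw [h r (Nat.lt_succ_iff.1 (Finset.mem_range.1 hr))]
  rw [e F hF0, e G h0, hs, coeff_shiftOne (n + 1) F, coeff_shiftOne (n + 1) G, hr, two_smul]
  abel

lemma coeff_shiftRootUpTo (D : A⟦X⟧) {m n : ℕ} (h : m ≤ n) :
    PowerSeries.coeff m (shiftRootUpTo D n) = PowerSeries.coeff m (shiftRoot D) := by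
  rw [shiftRoot, PowerSeries.coeff_mk]
  induction n, h using Nat.le_induction with
  | base => rfl
  | succ n hn ih =>
    rw [shiftRootUpTo, map_add, PowerSeries.coeff_monomial, if_neg (by omega), add_zero, ih]

lemma coeff_zero_shiftRoot (D : A⟦X⟧) : PowerSeries.coeff 0 (shiftRoot D) = 1 := by
  rw [← coeff_shiftRootUpTo D le_rfl, shiftRootUpTo, PowerSeries.coeff_one, if_pos rfl]

/-- The defining property of the series `d(u)`. -/
lemma shiftRoot_mul_shiftOne (D : A⟦X⟧) (hD : PowerSeries.coeff 0 D = 1) :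
    shiftRoot D * shiftOne (shiftRoot D) = D := by
  ext n
  cases n with
  | zero =>
    have s0 : PowerSeries.coeff 0 (shiftOne (shiftRoot D)) = 1 := by
      rw [coeff_shiftOne, Finset.sum_range_zero, zero_add, coeff_zero_shiftRoot]
    rw [PowerSeries.coeff_mul, Finset.Nat.antidiagonal_zero, Finset.sum_singleton,
      coeff_zero_shiftRoot, s0, hD, one_mul]
  | succ n =>
    have h := coeff_mul_shiftOne_sub (F := shiftRoot D) (G := shiftRootUpTo D n) (n := n)
      (fun m hm => (coeff_shiftRootUpTo D hm).symm)
      ((coeff_shiftRootUpTo D (Nat.zero_le n)).trans (coeff_zero_shiftRoot D))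
    have h2 : PowerSeries.coeff (n + 1) (shiftRoot D) -
        PowerSeries.coeff (n + 1) (shiftRootUpTo D n) =
        (1 / 2 : ℂ) • PowerSeries.coeff (n + 1)
          (D - shiftRootUpTo D n * shiftOne (shiftRootUpTo D n)) := by
      rw [← coeff_shiftRootUpTo D (le_refl (n + 1)), shiftRootUpTo, map_add,
        PowerSeries.coeff_monomial, if_pos rfl, add_sub_cancel_left]
    rw [h2, smul_smul, map_sub] at h
    norm_num at h
    exact h

/-- The series `d(u)` is the only one with its defining property. -/
lemma shiftRoot_unique (D d : A⟦X⟧) (h0 : PowerSeries.coeff 0 d = 1)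
    (h : d * shiftOne d = D) : d = shiftRoot D := by
  have hD : PowerSeries.coeff 0 D = 1 := by
    rw [← h, PowerSeries.coeff_mul, Finset.Nat.antidiagonal_zero, Finset.sum_singleton,
      coeff_shiftOne, Finset.sum_range_zero, zero_add, h0, one_mul]
  have key : ∀ n, ∀ m ≤ n, PowerSeries.coeff m d = PowerSeries.coeff m (shiftRoot D) := by
    intro n
    induction n with
    | zero =>
      intro m hm
      obtain rfl : m = 0 := by omega
      rw [h0, coeff_zero_shiftRoot]
    | succ n ih =>
      intro m hm
      rcases Nat.lt_or_ge m (n + 1) with h1 | h1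
      · exact ih m (by omega)
      · obtain rfl : m = n + 1 := by omega
        have e := coeff_mul_shiftOne_sub ih (coeff_zero_shiftRoot D)
        rw [h, shiftRoot_mul_shiftOne D hD, sub_self] at e
        have := (smul_eq_zero_iff_right (two_ne_zero : (2 : ℂ) ≠ 0)).1 e.symm
        exact sub_eq_zero.1 this
  ext n
  exact key n n le_rfl

end ShiftRoot

lemma coeff_zero_qdet : PowerSeries.coeff 0 qdet = 1 := by
  have s0 : ∀ H : (YGl 2)⟦X⟧, PowerSeries.coeff 0 (shiftOne H) = PowerSeries.coeff 0 H :=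
    fun H => by rw [coeff_shiftOne, Finset.sum_range_zero, zero_add]
  rw [qdet, map_sub, PowerSeries.coeff_mul, PowerSeries.coeff_mul,
    Finset.Nat.antidiagonal_zero, Finset.sum_singleton, Finset.sum_singleton, s0, s0]
  simp only [YGl.coeff_zero_T]
  simp

/-- The series `𝒯_{ij}(u) = d(u)⁻¹ T_{ij}(u)` over `Y(gl_2)`, where `d(u) d(u - 1) = D(u)`. -/
def calT (i j : Fin 2) : (YGl 2)⟦X⟧ :=
  PowerSeries.invOfUnit (shiftRoot qdet) 1 * YGl.T i j

/-- `IsProjSl π` says that `π : Y(gl_2) → Y(sl_2)` is the natural projection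
`T_{ij}(u) ↦ 𝒯_{ij}(u)`. -/
def IsProjSl (π : YGl 2 →ₐ[ℂ] YSl 2) : Prop :=
  ∀ i j, PowerSeries.map ((YSl 2).val.comp π).toRingHom (YGl.T i j) = calT i j

/-- The index of the basis vector `± e_a ⊗ e_b` of `ℂ² ⊗ ℂ² = ℂ⁴`, where
`v_{-2} = e₁ ⊗ e₁`, `v_{-1} = e₁ ⊗ e₂`, `v₁ = e₂ ⊗ e₁`, `v₂ = - e₂ ⊗ e₂`. The indices
`-2, -1, 1, 2` are `0, 1, 2, 3 : Fin 4`. -/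
def idx (a b : Fin 2) : Fin 4 := finProdFinEquiv (a, b)

/-- The sign in `v = ± e_a ⊗ e_b`. -/
def sgn (a b : Fin 2) : ℂ := if a = 1 ∧ b = 1 then -1 else 1

/-- `IsPsi ψ` says that `ψ` is the map `X(o_4) → Y(gl_2) ⊗ Y(gl_2)` given by
`T(u) ↦ T°₁(u) T°′₂(u)`, the matrix on the right side acting on `ℂ² ⊗ ℂ² = ℂ⁴`: its entry in
the row of `v = sgn a b • e_a ⊗ e_b` and the column of `v' = sgn c d • e_c ⊗ e_d` is
`sgn a b · sgn c d · T_{ac}(u) T′_{bd}(u)`. -/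
def IsPsi (ψ : XO 4 →ₐ[ℂ] YGl 2 ⊗[ℂ] YGl 2) : Prop :=
  ∀ a b c d, PowerSeries.map ψ.toRingHom (XO.t (idx a b) (idx c d)) =
    (sgn a b * sgn c d) •
      (PowerSeries.map (Algebra.TensorProduct.includeLeft :
          YGl 2 →ₐ[ℂ] YGl 2 ⊗[ℂ] YGl 2).toRingHom (YGl.T a c) *
        PowerSeries.map (Algebra.TensorProduct.includeRight :
          YGl 2 →ₐ[ℂ] YGl 2 ⊗[ℂ] YGl 2).toRingHom (YGl.T b d))

/-- The composition `χ⁽¹⁾` of `ψ` with the projection `π` in the first factor. -/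
def chi₁ (π : YGl 2 →ₐ[ℂ] YSl 2) (ψ : XO 4 →ₐ[ℂ] YGl 2 ⊗[ℂ] YGl 2) :
    XO 4 →ₐ[ℂ] YSl 2 ⊗[ℂ] YGl 2 :=
  (Algebra.TensorProduct.map π (AlgHom.id ℂ (YGl 2))).comp ψ

/-- The composition `χ⁽²⁾` of `ψ` with the projection `π` in the second factor. -/
def chi₂ (π : YGl 2 →ₐ[ℂ] YSl 2) (ψ : XO 4 →ₐ[ℂ] YGl 2 ⊗[ℂ] YGl 2) :
    XO 4 →ₐ[ℂ] YGl 2 ⊗[ℂ] YSl 2 :=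
  (Algebra.TensorProduct.map (AlgHom.id ℂ (YGl 2)) π).comp ψ

/-- The inclusion `Y(sl_2) ⊗ Y(sl_2) → Y(sl_2) ⊗ Y(gl_2)`. -/
def incl₁ : YSl 2 ⊗[ℂ] YSl 2 →ₐ[ℂ] YSl 2 ⊗[ℂ] YGl 2 :=
  Algebra.TensorProduct.map (AlgHom.id ℂ (YSl 2)) (YSl 2).val

/-- The inclusion `Y(sl_2) ⊗ Y(sl_2) → Y(gl_2) ⊗ Y(sl_2)`. -/
def incl₂ : YSl 2 ⊗[ℂ] YSl 2 →ₐ[ℂ] YGl 2 ⊗[ℂ] YSl 2 :=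
  Algebra.TensorProduct.map (YSl 2).val (AlgHom.id ℂ (YSl 2))

end LowRankYangian

end

/-! The R-matrix of `o_4` is essentially the product of two R-matrices of `gl_2`. If T and T'
satisfy the `gl_2` relations and have commuting coefficients, the product of their relations is
therefore the `o_4` relation for the Kronecker product (`orthogonal_of_gl`, `IsGl.isO_kron`), and
this gives ψ.

The other direction is an explicit factorization of the matrix t(u) of X(o_4), done without PBW
theorems. The block on e_a ⊗ e_1 and the block on e_1 ⊗ e_b satisfy `gl_2` relations, because no two
of their indices are opposite. The first factor F is the first block divided by its d(u), so its
quantum determinant is 1. The second factor S is F_00⁻¹ times the second block; in particular S_00 =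
d(u).

The main point is that F and S commute (`IsO.coeffComm_fstFactor_sndFactor`). F is determined by a
Gauss coordinate t_00⁻¹ t_02 (or t_20 t_00⁻¹) together with one first-order generator. The elements
t_01^(1) and t_10^(1) commute with these data because the relations at v = u - 1 give t_03 = -t_01
t_00⁻¹ t_02 and its transpose. Since d(u) is central for the first block, and the rest of S is
obtained from d(u) by brackets with t_01^(1) and t_10^(1), all of S commutes with F.

The factors define ρ : Y(gl_2) ⊗ Y(gl_2) → X(o_4). An orthogonal matrix is determined by its two
blocks (`IsO.ext_of_blocks`), hence ρψ = id and ψ is injective. Factoring a Kronecker product whose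
first matrix has quantum determinant 1 recovers both matrices, so (π ⊗ id)ψρ = π ⊗ id; also ρ(π ⊗
id) = ρ. Thus ρ restricted to Y(sl_2) ⊗ Y(gl_2) inverts χ⁽¹⁾, and the exchange of tensor factors
handles χ⁽²⁾.

For fixed points, χ⁽¹⁾ turns a scaling of t(u) into the scaling of the second tensor factor. It
remains to know that π is the identity on Y(sl_2). The definition only provides invariance under
scalar series, while π multiplies by the central series d(u)⁻¹; `projGl_eq_self` bridges this with a
scaling series of indeterminate coefficients. -/

noncomputable section

namespace LowRankYangian

/-! ### The substitution u ↦ u - 1 as a ring homomorphism -/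

section Shift

variable {A B : Type*} [Ring A] [Algebra ℂ A] [Ring B] [Algebra ℂ B]

/-- The series `(u - 1)⁻¹`. -/
def geomY : ℂ⟦X⟧ := PowerSeries.X * PowerSeries.mk (fun _ => (1 : ℂ))

lemma coeff_geomY_pow_eq_zero {n r : ℕ} (h : n < r) : PowerSeries.coeff n (geomY ^ r) = 0 := by
  rw [geomY, mul_pow, PowerSeries.coeff_X_pow_mul', if_neg (by omega)]

lemma coeff_shiftOne_of_le {n N : ℕ} (h : n ≤ N) (F : A⟦X⟧) :
    PowerSeries.coeff n (shiftOne F) =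
      ∑ r ∈ Finset.range (N + 1), PowerSeries.coeff n (geomY ^ r) • PowerSeries.coeff r F := by
  rw [shiftOne, PowerSeries.coeff_mk]
  refine Finset.sum_subset (Finset.range_mono (by omega)) fun r _ hr => ?_
  rw [Finset.mem_range, not_lt] at hr
  have := coeff_geomY_pow_eq_zero (n := n) (r := r) (by omega)
  rw [geomY] at this
  rw [this, zero_smul]

lemma shiftOne_mul (F G : A⟦X⟧) : shiftOne (F * G) = shiftOne F * shiftOne G := by
  ext n
  have h1 : PowerSeries.coeff n (shiftOne F * shiftOne G) =
      ∑ i ∈ Finset.range (n + 1), ∑ j ∈ Finset.range (n + 1),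
        PowerSeries.coeff n (geomY ^ (i + j)) •
          (PowerSeries.coeff i F * PowerSeries.coeff j G) := by
    rw [PowerSeries.coeff_mul]
    have : ∀ p ∈ Finset.HasAntidiagonal.antidiagonal n,
        PowerSeries.coeff p.1 (shiftOne F) * PowerSeries.coeff p.2 (shiftOne G) =
        ∑ i ∈ Finset.range (n + 1), ∑ j ∈ Finset.range (n + 1),
          (PowerSeries.coeff p.1 (geomY ^ i) * PowerSeries.coeff p.2 (geomY ^ j)) •
            (PowerSeries.coeff i F * PowerSeries.coeff j G) := by
      intro p hp
      have hp' := Finset.HasAntidiagonal.mem_antidiagonal.1 hp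
      rw [coeff_shiftOne_of_le (N := n) (by omega), coeff_shiftOne_of_le (N := n) (by omega),
        Finset.sum_mul_sum]
      simp only [smul_mul_smul_comm]
    rw [Finset.sum_congr rfl this, Finset.sum_comm]
    refine Finset.sum_congr rfl fun i _ => ?_
    rw [Finset.sum_comm]
    refine Finset.sum_congr rfl fun j _ => ?_
    rw [← Finset.sum_smul, pow_add, PowerSeries.coeff_mul]
  rw [h1, coeff_shiftOne_of_le le_rfl]
  simp only [PowerSeries.coeff_mul, Finset.smul_sum]
  rw [← Finset.sum_product', Finset.sum_sigma']
  -- The product gives a sum over the square i, j ≤ n, the shifted product one over i + j ≤ n; the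
  -- surplus terms vanish because (u - 1)⁻ʳ starts in degree r.
  refine Eq.trans ?_ (Finset.sum_filter_add_sum_filter_not
    (Finset.range (n + 1) ×ˢ Finset.range (n + 1)) (fun p => p.1 + p.2 ≤ n) _)
  have h0 : ∀ p ∈ Finset.filter (fun p : ℕ × ℕ => ¬ p.1 + p.2 ≤ n)
      (Finset.range (n + 1) ×ˢ Finset.range (n + 1)), PowerSeries.coeff n (geomY ^ (p.1 + p.2)) •
        (PowerSeries.coeff p.1 F * PowerSeries.coeff p.2 G) = 0 := by
    rintro ⟨i, j⟩ h
    simp only [Finset.mem_filter, Finset.mem_product, Finset.mem_range, not_le] at h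
    rw [coeff_geomY_pow_eq_zero h.2, zero_smul]
  rw [Finset.sum_eq_zero h0, add_zero]
  · refine Finset.sum_bij' (fun x _ => x.2) (fun x _ => ⟨x.1 + x.2, x⟩) ?_ ?_ ?_ ?_ ?_
    · rintro ⟨r, i, j⟩ h
      simp only [Finset.mem_sigma, Finset.mem_range, Finset.HasAntidiagonal.mem_antidiagonal,
        Finset.mem_filter, Finset.mem_product] at h ⊢
      omega
    · rintro ⟨i, j⟩ h
      simp only [Finset.mem_sigma, Finset.mem_range, Finset.HasAntidiagonal.mem_antidiagonal,
        Finset.mem_filter, Finset.mem_product] at h ⊢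
      exact ⟨by omega, trivial⟩
    · rintro ⟨r, i, j⟩ h
      simp only [Finset.mem_sigma, Finset.mem_range, Finset.HasAntidiagonal.mem_antidiagonal] at h ⊢
      obtain ⟨_, rfl⟩ := h
      rfl
    · rintro ⟨i, j⟩ h
      rfl
    · rintro ⟨r, i, j⟩ h
      simp only [Finset.mem_sigma, Finset.mem_range, Finset.HasAntidiagonal.mem_antidiagonal] at h ⊢
      obtain ⟨_, rfl⟩ := h
      rfl

lemma shiftOne_add (F G : A⟦X⟧) : shiftOne (F + G) = shiftOne F + shiftOne G := by
  ext n
  simp only [shiftOne, PowerSeries.coeff_mk, map_add, smul_add, Finset.sum_add_distrib]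

lemma shiftOne_C (a : A) : shiftOne (PowerSeries.C a) = PowerSeries.C a := by
  ext n
  rw [coeff_shiftOne_of_le le_rfl, Finset.sum_range_succ']
  simp only [PowerSeries.coeff_C, pow_zero, PowerSeries.coeff_one]
  split_ifs <;> simp_all

variable (A) in
/-- The substitution `u ↦ u - 1` as a ring homomorphism. -/
def shiftHom : A⟦X⟧ →+* A⟦X⟧ where
  toFun := shiftOne
  map_one' := by
    have := shiftOne_C (1 : A)
    rwa [map_one] at this
  map_zero' := by
    have := shiftOne_C (0 : A)
    rwa [map_zero] at this
  map_mul' := shiftOne_mul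
  map_add' := shiftOne_add

lemma shiftHom_apply (F : A⟦X⟧) : shiftHom A F = shiftOne F := rfl

lemma shiftHom_C (a : A) : shiftHom A (PowerSeries.C a) = PowerSeries.C a := shiftOne_C a

lemma coeff_zero_shiftHom (F : A⟦X⟧) :
    PowerSeries.coeff 0 (shiftHom A F) = PowerSeries.coeff 0 F := by
  rw [shiftHom_apply, coeff_shiftOne, Finset.sum_range_zero, zero_add]

lemma coeff_one_shiftHom (F : A⟦X⟧) :
    PowerSeries.coeff 1 (shiftHom A F) = PowerSeries.coeff 1 F := by
  rw [shiftHom_apply, coeff_shiftOne, Finset.sum_range_one, pow_zero, PowerSeries.coeff_one,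
    if_neg one_ne_zero, zero_smul, zero_add]

lemma map_shiftOne (φ : A →ₐ[ℂ] B) (F : A⟦X⟧) :
    PowerSeries.map φ.toRingHom (shiftOne F) = shiftOne (PowerSeries.map φ.toRingHom F) := by
  ext n
  simp [shiftOne]

/-- `(u - 1)⁻¹ - u⁻¹ = u⁻¹ (u - 1)⁻¹` -/
lemma shiftHom_X : shiftHom A PowerSeries.X - PowerSeries.X =
    PowerSeries.X * shiftHom A PowerSeries.X := by
  have h : shiftHom A PowerSeries.X = PowerSeries.X * PowerSeries.mk (fun _ => (1 : A)) := by
    ext n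
    rw [shiftHom_apply, coeff_shiftOne_of_le (N := n + 1) (by omega), Finset.sum_eq_single 1]
    · rw [PowerSeries.coeff_one_X, pow_one, geomY]
      cases n <;> simp [PowerSeries.coeff_succ_X_mul]
    · intro r _ hr
      rw [PowerSeries.coeff_X, if_neg hr, smul_zero]
    · intro h
      exact absurd (Finset.mem_range.2 (by omega)) h
  rw [h]
  ext n
  rcases n with _ | _ | n
  · simp
  · simp [PowerSeries.coeff_succ_X_mul, PowerSeries.coeff_X]
  · simp [PowerSeries.coeff_succ_X_mul, PowerSeries.coeff_X]

end Shift

/-! ### Specialization of two-variable series at v = u and v = u - 1 -/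

section Diagonal

variable {A : Type*} [Ring A] [Algebra ℂ A]

/-- The specialization of a series in `u⁻¹` and `v⁻¹` at `v = u`. -/
def diag (G : A⟦X⟧⟦X⟧) : A⟦X⟧ :=
  PowerSeries.mk fun n => ∑ p ∈ Finset.HasAntidiagonal.antidiagonal n, PowerSeries.coeff p.2 (PowerSeries.coeff p.1 G)

lemma diag_mul (G H : A⟦X⟧⟦X⟧) : diag (G * H) = diag G * diag H := by
  ext n
  simp only [diag, PowerSeries.coeff_mk, PowerSeries.coeff_mul, map_sum, Finset.sum_mul_sum]
  simp only [← Finset.sum_product', Finset.sum_sigma']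
  refine Finset.sum_bij' (fun x _ => ⟨(x.2.1.1 + x.2.2.1, x.2.1.2 + x.2.2.2),
      ((x.2.1.1, x.2.2.1), (x.2.1.2, x.2.2.2))⟩)
    (fun x _ => ⟨(x.2.1.1 + x.2.2.1, x.2.1.2 + x.2.2.2),
      ((x.2.1.1, x.2.2.1), (x.2.1.2, x.2.2.2))⟩) ?_ ?_ ?_ ?_ ?_
  · rintro ⟨⟨a, b⟩, ⟨a1, a2⟩, ⟨b1, b2⟩⟩ h
    simp only [Finset.mem_sigma, Finset.mem_product, Finset.HasAntidiagonal.mem_antidiagonal] at h ⊢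
    exact ⟨by omega, trivial, trivial⟩
  · rintro ⟨⟨a, b⟩, ⟨a1, a2⟩, ⟨b1, b2⟩⟩ h
    simp only [Finset.mem_sigma, Finset.mem_product, Finset.HasAntidiagonal.mem_antidiagonal] at h ⊢
    exact ⟨by omega, trivial, trivial⟩
  · rintro ⟨⟨a, b⟩, ⟨a1, a2⟩, ⟨b1, b2⟩⟩ h
    simp only [Finset.mem_sigma, Finset.mem_product, Finset.HasAntidiagonal.mem_antidiagonal] at h ⊢
    obtain ⟨_, rfl, rfl⟩ := h
    rfl
  · rintro ⟨⟨a, b⟩, ⟨a1, a2⟩, ⟨b1, b2⟩⟩ h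
    simp only [Finset.mem_sigma, Finset.mem_product, Finset.HasAntidiagonal.mem_antidiagonal] at h ⊢
    obtain ⟨_, rfl, rfl⟩ := h
    rfl
  · rintro ⟨⟨a, b⟩, ⟨a1, a2⟩, ⟨b1, b2⟩⟩ h
    rfl

lemma diag_inU (F : A⟦X⟧) : diag (inU F) = F := by
  ext n
  rw [diag, PowerSeries.coeff_mk, Finset.sum_eq_single (n, 0)]
  · simp [inU]
  · rintro ⟨a, b⟩ h hne
    rw [Finset.HasAntidiagonal.mem_antidiagonal] at h
    have : b ≠ 0 := by rintro rfl; exact hne (by simp_all)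
    simp [inU, PowerSeries.coeff_C, this]
  · intro h; simp at h

lemma diag_inV (F : A⟦X⟧) : diag (inV F) = F := by
  ext n
  rw [diag, PowerSeries.coeff_mk, Finset.sum_eq_single (0, n)]
  · simp [inV]
  · rintro ⟨a, b⟩ h hne
    rw [Finset.HasAntidiagonal.mem_antidiagonal] at h
    have : a ≠ 0 := by rintro rfl; exact hne (by simp_all)
    simp [inV, PowerSeries.coeff_C, this]
  · intro h; simp at h

variable (A) in
/-- The specialization at `v = u` as a ring homomorphism. -/
def diagHom : A⟦X⟧⟦X⟧ →+* A⟦X⟧ where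
  toFun := diag
  map_one' := by
    have := diag_inV (1 : A⟦X⟧)
    rwa [inV, map_one] at this
  map_zero' := by ext n; simp [diag]
  map_mul' := diag_mul
  map_add' G H := by ext n; simp [diag, Finset.sum_add_distrib]

variable (A) in
/-- The substitution `v ↦ v - 1`. -/
def shiftV : A⟦X⟧⟦X⟧ →+* A⟦X⟧⟦X⟧ := PowerSeries.map (shiftHom A)

lemma shiftV_inU (F : A⟦X⟧) : shiftV A (inU F) = inU F := by
  ext1 n
  simp [shiftV, inU, shiftHom_C]

lemma shiftV_inV (F : A⟦X⟧) : shiftV A (inV F) = inV (shiftHom A F) := by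
  simp [shiftV, inV]

variable (A) in
/-- The specialization at `v = u - 1`. -/
def specHom : A⟦X⟧⟦X⟧ →+* A⟦X⟧ := (diagHom A).comp (shiftV A)

lemma specHom_inU (F : A⟦X⟧) : specHom A (inU F) = F := by
  rw [specHom, RingHom.comp_apply, shiftV_inU]; exact diag_inU F

lemma specHom_inV (F : A⟦X⟧) : specHom A (inV F) = shiftHom A F := by
  rw [specHom, RingHom.comp_apply, shiftV_inV]; exact diag_inV _

lemma const₂_eq_inU (c : ℂ) : const₂ A c = inU (PowerSeries.C (algebraMap ℂ A c)) := by
  simp [const₂, inU]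

/-- At v = u - 1 the factor u - v - c becomes the number 1 - c. It is 1 for c = 0 and 0 for c = κ =
1, so this specialization isolates the terms of the `o_4` relations with pole at u - v = κ. -/
lemma specHom_linFactor (c : ℂ) : specHom A (linFactor A c) =
    PowerSeries.C (algebraMap ℂ A (1 - c)) *
      (PowerSeries.X * shiftHom A PowerSeries.X) := by
  rw [linFactor, const₂_eq_inU, uInv, vInv]
  simp only [map_sub, map_mul, specHom_inU, specHom_inV, shiftHom_X, map_one]
  noncomm_ring

end Diagonal

/-! ### Inverses, shift roots and coefficientwise commutation -/

section Commuting

variable {A B : Type*} [Ring A] [Algebra ℂ A] [Ring B] [Algebra ℂ B]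

lemma commute_C_iff {y : A} {F : A⟦X⟧} :
    Commute (PowerSeries.C y) F ↔ ∀ n, Commute y (PowerSeries.coeff n F) := by
  simp only [Commute, SemiconjBy, PowerSeries.ext_iff, PowerSeries.coeff_C_mul,
    PowerSeries.coeff_mul_C]

lemma commute_C_shiftHom {y : A} {F : A⟦X⟧} (h : Commute (PowerSeries.C y) F) :
    Commute (PowerSeries.C y) (shiftHom A F) := by
  simpa only [shiftHom_C] using h.map (shiftHom A)

/-- The inverse of a series with constant term `1`. -/
def sInv (F : A⟦X⟧) : A⟦X⟧ := PowerSeries.invOfUnit F 1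

lemma mul_sInv {F : A⟦X⟧} (h : PowerSeries.coeff 0 F = 1) : F * sInv F = 1 :=
  PowerSeries.mul_invOfUnit F 1 (by simpa using h)

lemma sInv_mul {F : A⟦X⟧} (h : PowerSeries.coeff 0 F = 1) : sInv F * F = 1 :=
  PowerSeries.invOfUnit_mul F 1 (by simpa using h)

lemma coeff_zero_sInv (F : A⟦X⟧) : PowerSeries.coeff 0 (sInv F) = 1 := by
  rw [PowerSeries.coeff_zero_eq_constantCoeff_apply, sInv, PowerSeries.constantCoeff_invOfUnit]
  simp

lemma sInv_eq_of_mul_eq_one {F G : A⟦X⟧} (h : PowerSeries.coeff 0 F = 1) (e : F * G = 1) :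
    sInv F = G := by
  rw [← mul_one (sInv F), ← e, ← mul_assoc, sInv_mul h, one_mul]

lemma commute_sInv {y F : A⟦X⟧} (hF : PowerSeries.coeff 0 F = 1) (h : Commute y F) :
    Commute y (sInv F) := by
  have e : sInv F * (y * F) * sInv F = sInv F * (F * y) * sInv F := by rw [h.eq]
  rw [← mul_assoc, mul_assoc _ F, mul_sInv hF, ← mul_assoc (sInv F) F, sInv_mul hF, mul_one,
    one_mul] at e
  exact e.symm

lemma map_sInv (φ : A →ₐ[ℂ] B) {F : A⟦X⟧} (hF : PowerSeries.coeff 0 F = 1) :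
    PowerSeries.map φ.toRingHom (sInv F) = sInv (PowerSeries.map φ.toRingHom F) := by
  refine (sInv_eq_of_mul_eq_one ?_ ?_).symm
  · rw [PowerSeries.coeff_map, hF, map_one]
  · rw [← map_mul, mul_sInv hF, map_one]

lemma map_shiftRoot (φ : A →ₐ[ℂ] B) {F : A⟦X⟧} (hF : PowerSeries.coeff 0 F = 1) :
    PowerSeries.map φ.toRingHom (shiftRoot F) = shiftRoot (PowerSeries.map φ.toRingHom F) := by
  apply shiftRoot_unique
  · rw [PowerSeries.coeff_map, coeff_zero_shiftRoot, map_one]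
  · rw [← map_shiftOne, ← map_mul, shiftRoot_mul_shiftOne F hF]

/-- Each coefficient of the root is computed recursively from F by ring operations, scalars and
shifts, all of which preserve the centralizer of y. -/
lemma commute_C_shiftRoot {y : A} {F : A⟦X⟧} (h : Commute (PowerSeries.C y) F) :
    Commute (PowerSeries.C y) (shiftRoot F) := by
  have key : ∀ n, Commute (PowerSeries.C y) (shiftRootUpTo F n) := by
    intro n
    induction n with
    | zero => exact Commute.one_right _
    | succ n ih =>
      have h1 := commute_C_iff.1 (h.sub_right (ih.mul_right (commute_C_shiftHom ih))) (n + 1)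
      refine ih.add_right (commute_C_iff.2 fun m => ?_)
      rw [PowerSeries.coeff_monomial]
      split_ifs
      · exact h1.smul_right _
      · exact Commute.zero_right _
  rw [commute_C_iff]
  intro n
  rw [shiftRoot, PowerSeries.coeff_mk]
  exact commute_C_iff.1 (key n) n

/-- Every coefficient of `F` commutes with every coefficient of `G`. -/
def CoeffComm (F G : A⟦X⟧) : Prop :=
  ∀ m n, Commute (PowerSeries.coeff m F) (PowerSeries.coeff n G)

lemma coeffComm_iff {F G : A⟦X⟧} :
    CoeffComm F G ↔ ∀ m, Commute (PowerSeries.C (PowerSeries.coeff m F)) G := by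
  simp only [commute_C_iff, CoeffComm]

namespace CoeffComm

variable {F G H : A⟦X⟧}

lemma symm (h : CoeffComm F G) : CoeffComm G F := fun m n => (h n m).symm

lemma commute_C (h : CoeffComm F G) (m : ℕ) :
    Commute (PowerSeries.C (PowerSeries.coeff m F)) G := coeffComm_iff.1 h m

lemma commute (h : CoeffComm F G) : Commute F G := by
  ext n
  rw [PowerSeries.coeff_mul, PowerSeries.coeff_mul, ← Finset.Nat.sum_antidiagonal_swap]
  exact Finset.sum_congr rfl fun p _ => h _ _

lemma mul_right (h : CoeffComm F G) (h' : CoeffComm F H) : CoeffComm F (G * H) :=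
  coeffComm_iff.2 fun m => (h.commute_C m).mul_right (h'.commute_C m)

lemma sub_right (h : CoeffComm F G) (h' : CoeffComm F H) : CoeffComm F (G - H) :=
  coeffComm_iff.2 fun m => (h.commute_C m).sub_right (h'.commute_C m)

lemma sInv_right (h : CoeffComm F G) (hG : PowerSeries.coeff 0 G = 1) : CoeffComm F (sInv G) :=
  coeffComm_iff.2 fun m => commute_sInv hG (h.commute_C m)

lemma shiftHom_right (h : CoeffComm F G) : CoeffComm F (shiftHom A G) :=
  coeffComm_iff.2 fun m => commute_C_shiftHom (h.commute_C m)

lemma shiftRoot_right (h : CoeffComm F G) : CoeffComm F (shiftRoot G) :=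
  coeffComm_iff.2 fun m => commute_C_shiftRoot (h.commute_C m)

lemma commute_inU_inV (h : CoeffComm F G) : Commute (inU F) (inV G) := by
  rw [inV, inU]
  refine ((commute_C_iff (y := G)).2 fun n => ?_).symm
  rw [PowerSeries.coeff_map]
  exact (h.commute_C n).symm

end CoeffComm

end Commuting

/-! ### Cancellation and low-order coefficients in two variables -/

section TwoVariables

variable {A : Type*} [Ring A] [Algebra ℂ A]

lemma commute_uInv (G : A⟦X⟧⟦X⟧) : Commute (uInv A) G := by
  rw [uInv, inU, PowerSeries.map_X]
  exact PowerSeries.X_mul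

lemma commute_vInv (G : A⟦X⟧⟦X⟧) : Commute (vInv A) G := by
  rw [vInv, inV, commute_C_iff]
  exact fun n => PowerSeries.X_mul

lemma commute_const₂ (c : ℂ) (G : A⟦X⟧⟦X⟧) : Commute (const₂ A c) G := by
  rw [const₂, commute_C_iff]
  intro n
  rw [commute_C_iff]
  exact fun m => Algebra.commutes _ _

lemma commute_linFactor (c : ℂ) (G : A⟦X⟧⟦X⟧) : Commute (linFactor A c) G :=
  ((commute_vInv G).sub_left (commute_uInv G)).sub_left
    ((commute_const₂ c G).mul_left ((commute_uInv G).mul_left (commute_vInv G)))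

/-- The lowest nonzero coefficient of G would be annihilated by the constant coefficient of P. No
invertibility is needed. -/
lemma mul_eq_zero_of_constantCoeff {R : Type*} [Ring R] {P G : R⟦X⟧}
    (hP : ∀ r : R, PowerSeries.coeff 0 P * r = 0 → r = 0) (h : P * G = 0) : G = 0 := by
  have key : ∀ n, ∀ m ≤ n, PowerSeries.coeff m G = 0 := by
    intro n
    induction n using Nat.strong_induction_on with
    | _ n ih =>
      intro m hm
      rcases hm.lt_or_eq with h1 | rfl
      · exact ih m h1 m le_rfl
      · apply hP
        have := congrArg (PowerSeries.coeff m) h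
        rw [PowerSeries.coeff_mul, Finset.sum_eq_single (0, m), map_zero] at this
        · exact this
        · rintro ⟨a, b⟩ hab hne
          rw [Finset.HasAntidiagonal.mem_antidiagonal] at hab
          have ha : a ≠ 0 := by
            rintro rfl
            exact hne (by simp only [Prod.mk.injEq, true_and]; omega)
          rw [ih b (by dsimp only at hab; omega) b le_rfl, mul_zero]
        · intro h'
          exact absurd (Finset.HasAntidiagonal.mem_antidiagonal.2 (by simp)) h'
  ext n
  exact key n n le_rfl

lemma X_mul_eq_zero {R : Type*} [Ring R] {G : R⟦X⟧} (h : PowerSeries.X * G = 0) : G = 0 := by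
  ext n
  have := congrArg (PowerSeries.coeff (n + 1)) h
  rwa [PowerSeries.coeff_succ_X_mul, map_zero] at this

lemma linFactor_mul_cancel {c : ℂ} {G H : A⟦X⟧⟦X⟧}
    (h : linFactor A c * G = linFactor A c * H) : G = H := by
  rw [← sub_eq_zero, ← mul_sub] at h
  rw [← sub_eq_zero]
  refine mul_eq_zero_of_constantCoeff (fun r hr => ?_) h
  -- The factor is not a unit, but its coefficient at u⁰ is v⁻¹, which is left regular.
  have e : PowerSeries.coeff 0 (linFactor A c) = PowerSeries.X := by
    simp [linFactor, vInv, uInv, inV, inU]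
  rw [e] at hr
  exact X_mul_eq_zero hr

lemma X_mul_shiftHom_X_mul_cancel {F G : A⟦X⟧}
    (h : PowerSeries.X * shiftHom A PowerSeries.X * F =
      PowerSeries.X * shiftHom A PowerSeries.X * G) : F = G := by
  rw [← sub_eq_zero, ← mul_sub] at h
  rw [← sub_eq_zero]
  -- Writing (u - 1)⁻¹ = u⁻¹ (1 + (u - 1)⁻¹) leaves, besides u⁻², a factor with constant term 1.
  have e : shiftHom A PowerSeries.X = PowerSeries.X * (1 + shiftHom A PowerSeries.X) := by
    rw [mul_add, mul_one, ← shiftHom_X, add_sub_cancel]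
  rw [mul_assoc] at h
  have h1 := X_mul_eq_zero h
  rw [e, mul_assoc] at h1
  refine mul_eq_zero_of_constantCoeff (fun r hr => ?_) (X_mul_eq_zero h1)
  rw [map_add, coeff_zero_shiftHom] at hr
  simpa using hr

/-- The coefficient of `v⁰`. -/
def vCoeffZero (A : Type*) [Ring A] : A⟦X⟧⟦X⟧ →+* A⟦X⟧ :=
  PowerSeries.map (PowerSeries.constantCoeff)

/-- The coefficient of `v⁻¹`. -/
def vCoeffOne (A : Type*) [Ring A] : A⟦X⟧⟦X⟧ →+ A⟦X⟧ where
  toFun G := PowerSeries.mk fun n => PowerSeries.coeff 1 (PowerSeries.coeff n G)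
  map_zero' := by ext; simp
  map_add' G H := by ext; simp

lemma vCoeffOne_mul (G H : A⟦X⟧⟦X⟧) : vCoeffOne A (G * H) =
    vCoeffZero A G * vCoeffOne A H + vCoeffOne A G * vCoeffZero A H := by
  ext n
  simp only [vCoeffOne, vCoeffZero, AddMonoidHom.coe_mk, ZeroHom.coe_mk, PowerSeries.coeff_mk,
    PowerSeries.coeff_mul, map_sum, map_add, PowerSeries.coeff_map, ← Finset.sum_add_distrib]
  refine Finset.sum_congr rfl fun p _ => ?_
  simp [Finset.Nat.antidiagonal_succ]

lemma vCoeffZero_inU (F : A⟦X⟧) : vCoeffZero A (inU F) = F := by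
  ext n; simp [vCoeffZero, inU]

lemma vCoeffOne_inU (F : A⟦X⟧) : vCoeffOne A (inU F) = 0 := by
  ext n; simp [vCoeffOne, inU]

lemma vCoeffZero_inV (F : A⟦X⟧) :
    vCoeffZero A (inV F) = PowerSeries.C (PowerSeries.coeff 0 F) := by
  simp [vCoeffZero, inV]

lemma vCoeffOne_inV (F : A⟦X⟧) :
    vCoeffOne A (inV F) = PowerSeries.C (PowerSeries.coeff 1 F) := by
  ext n
  simp only [vCoeffOne, inV, AddMonoidHom.coe_mk, ZeroHom.coe_mk, PowerSeries.coeff_mk,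
    PowerSeries.coeff_C]
  split_ifs <;> simp

lemma vCoeffZero_linFactor (c : ℂ) : vCoeffZero A (linFactor A c) = -PowerSeries.X := by
  simp only [linFactor, map_sub, map_mul, uInv, vInv, vCoeffZero_inU, vCoeffZero_inV]
  simp

end TwoVariables

lemma X_mul_cancel {R : Type*} [Ring R] {F G : R⟦X⟧}
    (h : PowerSeries.X * F = PowerSeries.X * G) : F = G :=
  sub_eq_zero.1 (X_mul_eq_zero (by rw [mul_sub, h, sub_self]))

/-! ### Matrices satisfying the relations of Y(gl_N) -/

section GlFamilies

variable {A B : Type*} [Ring A] [Algebra ℂ A] [Ring B] [Algebra ℂ B] {N : ℕ}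

/-- The matrices of series which satisfy the defining relations of `Y(gl_N)`. -/
structure IsGl (T : Fin N → Fin N → A⟦X⟧) : Prop where
  coeff_zero : ∀ i j, PowerSeries.coeff 0 (T i j) = if i = j then 1 else 0
  rel : ∀ i j k l, glLHS T i j k l = glRHS T i j k l

lemma YGl.isGl_T : IsGl (YGl.T (N := N)) := ⟨YGl.coeff_zero_T, YGl.T_rel⟩

lemma coeff_zero_mul_of_eq_one {z F : A⟦X⟧} (h : PowerSeries.coeff 0 z = 1) :
    PowerSeries.coeff 0 (z * F) = PowerSeries.coeff 0 F := by
  rw [PowerSeries.coeff_mul]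
  simp [h]

lemma inU_mul_inV_scale {z F G : A⟦X⟧} (h : CoeffComm z F) :
    inU (z * F) * inV (z * G) = inU z * inV z * (inU F * inV G) := by
  rw [inU_mul, inV_mul, mul_assoc, ← mul_assoc (inU F), h.symm.commute_inU_inV.eq]
  simp only [mul_assoc]

lemma inV_mul_inU_scale {z F G : A⟦X⟧} (hz : CoeffComm z z) (h : CoeffComm z F) :
    inV (z * F) * inU (z * G) = inU z * inV z * (inV F * inU G) := by
  rw [inU_mul, inV_mul, mul_assoc, ← mul_assoc (inV F), ← h.commute_inU_inV.eq,
    ← mul_assoc, ← mul_assoc, ← hz.commute_inU_inV.eq]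
  simp only [mul_assoc]

lemma CoeffComm.of_commute_inU_inV {F G : A⟦X⟧} (h : Commute (inU F) (inV G)) :
    CoeffComm F G := by
  rw [coeffComm_iff]
  intro m
  have := congrArg (PowerSeries.coeff m) h.eq
  simpa [inU, inV, Commute, SemiconjBy] using this

/-- Since the constant term of G commutes with F, the expansion of [F(u), G(v)] in v⁻¹ starts with
the bracket of F with the first coefficient of G. This extracts brackets with first-order generators
from the relations. -/
lemma vCoeffOne_commutator {F G : A⟦X⟧} {c : A} (hc : PowerSeries.coeff 0 G = c)
    (h : Commute (PowerSeries.C c) F) :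
    vCoeffZero A (inU F * inV G - inV G * inU F) = 0 ∧
    vCoeffOne A (inU F * inV G - inV G * inU F) =
      F * PowerSeries.C (PowerSeries.coeff 1 G) - PowerSeries.C (PowerSeries.coeff 1 G) * F := by
  constructor
  · simp only [map_sub, map_mul, vCoeffZero_inU, vCoeffZero_inV, hc, h.eq, sub_self]
  · simp only [map_sub, vCoeffOne_mul, vCoeffZero_inU, vCoeffZero_inV, vCoeffOne_inU,
      vCoeffOne_inV, zero_mul, add_zero, mul_zero, zero_add]

lemma commute_C_ite (p : Prop) [Decidable p] (F : A⟦X⟧) :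
    Commute (PowerSeries.C (if p then (1 : A) else 0)) F := by
  split_ifs
  · rw [map_one]; exact Commute.one_left _
  · rw [map_zero]; exact Commute.zero_left _

lemma vCoeffZero_uInv_mul_vInv : vCoeffZero A (uInv A * vInv A) = 0 := by
  rw [map_mul, vInv, vCoeffZero_inV]; simp

lemma vCoeffOne_uInv_mul_vInv : vCoeffOne A (uInv A * vInv A) = PowerSeries.X := by
  rw [vCoeffOne_mul, uInv, vInv, vCoeffOne_inU, vCoeffOne_inV, vCoeffZero_inU]
  simp

namespace IsGl

variable {T : Fin N → Fin N → A⟦X⟧}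

/-- The factor z(u) z(v) comes out of both sides. Allowing z to have non-scalar coefficients is
needed for d(u)⁻¹, for F_00⁻¹ and for the series with indeterminate coefficients. -/
lemma scale (hT : IsGl T) {z : A⟦X⟧} (h0 : PowerSeries.coeff 0 z = 1) (hz : CoeffComm z z)
    (h : ∀ i j, CoeffComm z (T i j)) : IsGl fun i j => z * T i j where
  coeff_zero i j := by rw [coeff_zero_mul_of_eq_one h0, hT.coeff_zero]
  rel i j k l := by
    have hc : ∀ G H : A⟦X⟧⟦X⟧, Commute G H → ∀ W, G * (H * W) = H * (G * W) :=
      fun G H e W => by rw [← mul_assoc, e.eq, mul_assoc]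
    simp only [glLHS, glRHS, inU_mul_inV_scale (h _ _), inV_mul_inU_scale hz (h _ _), ← mul_sub]
    rw [hc _ _ (commute_linFactor _ _),
      hc _ _ ((commute_uInv _).mul_left (commute_vInv _))]
    exact congrArg _ (hT.rel i j k l)

lemma map (hT : IsGl T) (φ : A →ₐ[ℂ] B) : IsGl fun i j => PowerSeries.map φ.toRingHom (T i j) where
  coeff_zero i j := by
    rw [PowerSeries.coeff_map, hT.coeff_zero]
    split_ifs <;> simp
  rel i j k l := by rw [← map_glLHS, ← map_glRHS, hT.rel]

/-- The bracket with `T_{kl}^{(1)}`. -/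
lemma bracket (hT : IsGl T) (i j k l : Fin N) :
    T i j * PowerSeries.C (PowerSeries.coeff 1 (T k l)) -
        PowerSeries.C (PowerSeries.coeff 1 (T k l)) * T i j =
      (if k = j then T i l else 0) - (if i = l then T k j else 0) := by
  have h := congrArg (vCoeffOne A) (hT.rel i j k l)
  obtain ⟨e0, e1⟩ := vCoeffOne_commutator (F := T i j) (hT.coeff_zero k l) (commute_C_ite _ _)
  rw [glLHS, glRHS, vCoeffOne_mul, vCoeffOne_mul, e0, e1, vCoeffZero_linFactor,
    vCoeffZero_uInv_mul_vInv, vCoeffOne_uInv_mul_vInv, mul_zero, add_zero, zero_mul, zero_add,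
    neg_mul, ← mul_neg] at h
  rw [neg_eq_iff_eq_neg.1 (X_mul_cancel h), map_sub, map_mul, map_mul]
  simp only [vCoeffZero_inU, vCoeffZero_inV, hT.coeff_zero]
  split_ifs <;> simp

/-- The relations at `v = u - 1`. -/
lemma spec (hT : IsGl T) (i j k l : Fin N) :
    T i j * shiftHom A (T k l) - shiftHom A (T k l) * T i j =
      T k j * shiftHom A (T i l) - shiftHom A (T k j) * T i l := by
  have h := congrArg (specHom A) (hT.rel i j k l)
  rw [glLHS, glRHS] at h
  simp only [map_mul, map_sub, specHom_linFactor, specHom_inU, specHom_inV, uInv, vInv, sub_zero,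
    map_one, one_mul] at h
  exact X_mul_shiftHom_X_mul_cancel h

lemma linFactor_zero_sub : linFactor A 0 - uInv A * vInv A = linFactor A 1 := by
  simp [linFactor, const₂]

/-- For equal entries both sides of the relation contain the same commutator, so u - v - 1
annihilates it and can be cancelled. -/
lemma coeffComm_self (hT : IsGl T) (i j : Fin N) : CoeffComm (T i j) (T i j) := by
  apply CoeffComm.of_commute_inU_inV
  have h := hT.rel i j i j
  rw [glLHS, glRHS, ← sub_eq_zero, ← sub_mul, linFactor_zero_sub] at h
  exact sub_eq_zero.1 (linFactor_mul_cancel (h.trans (mul_zero _).symm))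

end IsGl

end GlFamilies

/-! ### The algebraic identity behind the centrality of the quantum determinant -/

section Center

variable {R : Type*} [Ring R] {K : Type*} [CommRing K] [Algebra K R]

/-- Here a, b, c are T_00, T_01, T_10 at u; α, γ are T_00, T_10 at v; a letter with w is taken at v
- 1. L0 and y stand for v⁻¹ - u⁻¹ and u⁻¹v⁻¹, and L1 and y' for the same with v - 1 in place of v.
The identity is the commutation of T_00(u) with D(v), cleared of denominators. -/
lemma commutator_quantum_minor (L0 L1 y y' : K) (a b c α γ βw δw αw γw : R)
    (e : L1 * y = (L0 + y) * y')
    (hα : a * α = α * a)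
    (h1 : L1 • (a * δw - δw * a) = y' • (c * βw - γw * b))
    (h2 : L1 • (a * βw - βw * a) = y' • (a * βw - αw * b))
    (h3 : L0 • (a * γ - γ * a) = y • (c * α - γ * a))
    (h4 : L0 • (c * α - α * c) = y • (a * γ - α * c))
    (h5 : α * c - c * α = a * γ - γ * a)
    (h6 : α * γw = γ * αw) :
    L0 • L1 • (a * (α * δw - γ * βw) - (α * δw - γ * βw) * a) = 0 := by
  linear_combination (norm := (simp only [add_mul, mul_sub, sub_mul, mul_assoc, smul_mul_assoc,
      mul_smul_comm, smul_sub]; module))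
    L0 • (α * h1) - L1 • h3 * βw - L0 • (γ * h2) + (L0 * L1) • (hα * δw) -
      e • ((c * α - γ * a) * βw) - y' • h4 * βw - L0 • y' • (h6 * b) + y' • y • (h5 * βw)

end Center

/-! ### The quantum determinant of a 2 × 2 matrix is central -/

section GlTwo

variable {A B : Type*} [Ring A] [Algebra ℂ A] [Ring B] [Algebra ℂ B]

/-- The quantum determinant of a `2 × 2` matrix of series. -/
def qdetOf (T : Fin 2 → Fin 2 → A⟦X⟧) : A⟦X⟧ :=
  T 0 0 * shiftHom A (T 1 1) - T 1 0 * shiftHom A (T 0 1)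

lemma isRegular_shiftV_linFactor {G : A⟦X⟧⟦X⟧} (h : shiftV A (linFactor A 0) * G = 0) :
    G = 0 := by
  refine mul_eq_zero_of_constantCoeff (fun r hr => ?_) h
  have e : PowerSeries.coeff 0 (shiftV A (linFactor A 0)) = shiftHom A PowerSeries.X := by
    simp [linFactor, vInv, uInv, inV, inU, shiftV]
  rw [e] at hr
  apply X_mul_shiftHom_X_mul_cancel
  rw [mul_assoc, hr, mul_zero, mul_zero]

lemma commute_shiftV_vInv (G : A⟦X⟧⟦X⟧) : Commute (shiftV A (vInv A)) G := by
  rw [vInv, shiftV_inV, inV, commute_C_iff]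
  intro n
  have e : shiftHom A PowerSeries.X = scalarSeries A (shiftOne PowerSeries.X) := by
    have h := map_shiftOne (Algebra.ofId ℂ A) PowerSeries.X
    rw [PowerSeries.map_X] at h
    exact h.symm
  rw [e]
  exact (scalar_comm _ _).symm

namespace IsGl

variable {T : Fin 2 → Fin 2 → A⟦X⟧}

/-- `T_{ij}(u) T_{kj}(u - 1) = T_{kj}(u) T_{ij}(u - 1)` -/
lemma spec_column (hT : IsGl T) (i j k : Fin 2) :
    T i j * shiftHom A (T k j) = T k j * shiftHom A (T i j) := by
  exact sub_left_injective (hT.spec i j k j)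

lemma coeffComm_zero_zero_qdet (hT : IsGl T) : CoeffComm (T 0 0) (qdetOf T) := by
  apply CoeffComm.of_commute_inU_inV
  -- The elements u⁻¹, v⁻¹ and (v - 1)⁻¹ are taken in the center, so that they act as scalars from a
  -- commutative ring.
  let u : Subring.center A⟦X⟧⟦X⟧ :=
    ⟨uInv A, Subring.mem_center_iff.2 fun G => (commute_uInv G).eq.symm⟩
  let v : Subring.center A⟦X⟧⟦X⟧ :=
    ⟨vInv A, Subring.mem_center_iff.2 fun G => (commute_vInv G).eq.symm⟩
  let w : Subring.center A⟦X⟧⟦X⟧ :=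
    ⟨shiftV A (vInv A), Subring.mem_center_iff.2 fun G => (commute_shiftV_vInv G).eq.symm⟩
  have hw : w - v = v * w := Subtype.ext <| by
    change shiftV A (vInv A) - vInv A = vInv A * shiftV A (vInv A)
    rw [vInv, shiftV_inV, inV, inV, ← map_sub, shiftHom_X, map_mul]
  have hl : linFactor A 0 = vInv A - uInv A := by simp [linFactor, const₂]
  have hu : shiftV A (uInv A) = uInv A := shiftV_inU _
  have r (i j k l : Fin 2) : (v - u) • (inU (T i j) * inV (T k l) - inV (T k l) * inU (T i j)) =
      (u * v) • (inU (T k j) * inV (T i l) - inV (T k j) * inU (T i l)) := by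
    have := hT.rel i j k l
    rw [glLHS, glRHS, hl] at this
    exact this
  have r' (i j k l : Fin 2) : (w - u) • (inU (T i j) * inV (shiftHom A (T k l)) -
      inV (shiftHom A (T k l)) * inU (T i j)) =
      (u * w) • (inU (T k j) * inV (shiftHom A (T i l)) -
        inV (shiftHom A (T k j)) * inU (T i l)) := by
    have := congrArg (shiftV A) (hT.rel i j k l)
    rw [glLHS, glRHS, hl] at this
    simp only [map_mul, map_sub, hu, shiftV_inU, shiftV_inV] at this
    exact this
  have h5 : inV (T 0 0) * inU (T 1 0) - inU (T 1 0) * inV (T 0 0) =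
      inU (T 0 0) * inV (T 1 0) - inV (T 1 0) * inU (T 0 0) := by
    have e1 := r 0 0 1 0
    have e2 := r 1 0 0 0
    rw [← sub_eq_zero]
    refine linFactor_mul_cancel (c := 1) ?_
    rw [mul_zero, ← linFactor_zero_sub, hl]
    change ((v - u) - u * v) • (_ : A⟦X⟧⟦X⟧) = 0
    linear_combination (norm := (simp only [smul_sub]; module)) -e1 - e2
  have key := commutator_quantum_minor (v - u) (w - u) (u * v) (u * w) (inU (T 0 0)) (inU (T 0 1))
    (inU (T 1 0)) (inV (T 0 0)) (inV (T 1 0)) (inV (shiftHom A (T 0 1)))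
    (inV (shiftHom A (T 1 1))) (inV (shiftHom A (T 0 0))) (inV (shiftHom A (T 1 0)))
    (by linear_combination u ^ 2 * hw) (hT.coeffComm_self 0 0).commute_inU_inV.eq
    (r' 0 0 1 1) (r' 0 0 0 1) (r 0 0 1 0) (r 1 0 0 0) h5 ?_
  · change (vInv A - uInv A) * ((shiftV A (vInv A) - uInv A) * _) = 0 at key
    have hl' : shiftV A (linFactor A 0) = shiftV A (vInv A) - uInv A := by rw [hl, map_sub, hu]
    rw [← hl, ← hl'] at key
    have key3 := isRegular_shiftV_linFactor (linFactor_mul_cancel (key.trans (mul_zero _).symm))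
    rw [sub_eq_zero] at key3
    rw [Commute, SemiconjBy, qdetOf]
    simp only [inV, map_sub, map_mul] at key3 ⊢
    exact key3
  · rw [← inV_mul, ← inV_mul, hT.spec_column]

lemma bracket_shiftHom (hT : IsGl T) (i j k l : Fin 2) :
    shiftHom A (T i j) * PowerSeries.C (PowerSeries.coeff 1 (T k l)) -
        PowerSeries.C (PowerSeries.coeff 1 (T k l)) * shiftHom A (T i j) =
      shiftHom A ((if k = j then T i l else 0) - (if i = l then T k j else 0)) := by
  rw [← hT.bracket, map_sub, map_mul, map_mul, shiftHom_C]

/-- The bracket acts as a derivation; after cancellation only T_00(u) T_10(u-1) - T_10(u) T_00(u-1)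
is left, which is zero. -/
lemma commute_qdet_C_one_zero (hT : IsGl T) :
    Commute (qdetOf T) (PowerSeries.C (PowerSeries.coeff 1 (T 1 0))) := by
  have h1 := hT.bracket 0 0 1 0
  have h2 := hT.bracket 1 0 1 0
  have h3 := hT.bracket_shiftHom 1 1 1 0
  have h4 := hT.bracket_shiftHom 0 1 1 0
  have h5 := hT.spec_column 0 0 1
  simp at h1 h2 h3 h4
  rw [Commute, SemiconjBy, qdetOf]
  linear_combination (norm := noncomm_ring) h1 * shiftHom A (T 1 1) + T 0 0 * h3 -
    h2 * shiftHom A (T 0 1) - T 1 0 * h4 + h5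

lemma commute_qdet_C_zero_one (hT : IsGl T) :
    Commute (qdetOf T) (PowerSeries.C (PowerSeries.coeff 1 (T 0 1))) := by
  have h1 := hT.bracket 0 0 0 1
  have h2 := hT.bracket 1 0 0 1
  have h3 := hT.bracket_shiftHom 1 1 0 1
  have h4 := hT.bracket_shiftHom 0 1 0 1
  have h5 := hT.spec_column 0 1 1
  simp at h1 h2 h3 h4
  rw [Commute, SemiconjBy, qdetOf]
  linear_combination (norm := noncomm_ring) h1 * shiftHom A (T 1 1) + T 0 0 * h3 -
    h2 * shiftHom A (T 0 1) - T 1 0 * h4 + h5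

/-- The coefficients of the quantum determinant are central. -/
lemma coeffComm_qdet (hT : IsGl T) (i j : Fin 2) : CoeffComm (qdetOf T) (T i j) := by
  rw [coeffComm_iff]
  intro m
  have c0 := hT.coeffComm_zero_zero_qdet.symm.commute_C m
  have cc : ∀ y : A, Commute (qdetOf T) (PowerSeries.C y) →
      Commute (PowerSeries.C (PowerSeries.coeff m (qdetOf T))) (PowerSeries.C y) := fun y h =>
    (((commute_C_iff.1 h.symm) m).symm).map PowerSeries.C
  have c1 := cc _ hT.commute_qdet_C_one_zero
  have c2 := cc _ hT.commute_qdet_C_zero_one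
  -- T_00 and the two generators T_10^(1), T_01^(1) suffice: brackets with these produce T_10 and
  -- T_01 from T_00, and then T_11 from T_01.
  have h1 := hT.bracket 0 0 1 0
  have h2 := hT.bracket 0 0 0 1
  have h3 := hT.bracket 0 1 1 0
  simp only [one_ne_zero, zero_ne_one, if_true, if_false, sub_zero] at h1 h2 h3
  have c3 : Commute (PowerSeries.C (PowerSeries.coeff m (qdetOf T))) (T 1 0) := by
    have := ((c0.mul_right c1).sub_right (c1.mul_right c0))
    rw [h1] at this
    simpa using this
  have c4 : Commute (PowerSeries.C (PowerSeries.coeff m (qdetOf T))) (T 0 1) := by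
    have := (((c0.mul_right c2).sub_right (c2.mul_right c0)))
    rw [h2] at this
    simpa using this
  have c5 : Commute (PowerSeries.C (PowerSeries.coeff m (qdetOf T))) (T 1 1) := by
    have := c0.sub_right (((c4.mul_right c1).sub_right (c1.mul_right c4)))
    rw [h3] at this
    simpa using this
  fin_cases i <;> fin_cases j <;> assumption

end IsGl

end GlTwo

/-! ### The normalized matrix d(u)⁻¹ T(u) and its Gauss coordinates -/

section Normalized

variable {A B : Type*} [Ring A] [Algebra ℂ A] [Ring B] [Algebra ℂ B]

lemma shiftHom_sInv {F : A⟦X⟧} (hF : PowerSeries.coeff 0 F = 1) :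
    shiftHom A (sInv F) = sInv (shiftHom A F) := by
  refine (sInv_eq_of_mul_eq_one ?_ ?_).symm
  · rw [coeff_zero_shiftHom, hF]
  · rw [← map_mul, mul_sInv hF, map_one]

/-- The series `d(u)` with `d(u) d(u - 1) = D(u)`. -/
def rootQdet (T : Fin 2 → Fin 2 → A⟦X⟧) : A⟦X⟧ := shiftRoot (qdetOf T)

/-- The matrix `d(u)⁻¹ T(u)`. -/
def normalized (T : Fin 2 → Fin 2 → A⟦X⟧) (i j : Fin 2) : A⟦X⟧ := sInv (rootQdet T) * T i j

lemma coeff_zero_rootQdet (T : Fin 2 → Fin 2 → A⟦X⟧) : PowerSeries.coeff 0 (rootQdet T) = 1 :=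
  coeff_zero_shiftRoot _

namespace IsGl

variable {T : Fin 2 → Fin 2 → A⟦X⟧}

lemma coeff_zero_qdet (hT : IsGl T) : PowerSeries.coeff 0 (qdetOf T) = 1 := by
  rw [qdetOf, map_sub, PowerSeries.coeff_mul, PowerSeries.coeff_mul,
    Finset.Nat.antidiagonal_zero, Finset.sum_singleton, Finset.sum_singleton, coeff_zero_shiftHom,
    coeff_zero_shiftHom]
  simp only [hT.coeff_zero]
  simp

lemma rootQdet_mul (hT : IsGl T) :
    rootQdet T * shiftHom A (rootQdet T) = qdetOf T :=
  shiftRoot_mul_shiftOne _ hT.coeff_zero_qdet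

/-- A series whose coefficients commute with those of `T` does so with the quantum
determinant. -/
lemma _root_.LowRankYangian.CoeffComm.rootQdet_right {F : A⟦X⟧} (h : ∀ i j, CoeffComm F (T i j)) :
    CoeffComm F (rootQdet T) :=
  (((h 0 0).mul_right (h 1 1).shiftHom_right).sub_right
    ((h 1 0).mul_right (h 0 1).shiftHom_right)).shiftRoot_right

lemma coeffComm_rootQdet (hT : IsGl T) (i j : Fin 2) : CoeffComm (rootQdet T) (T i j) :=
  (hT.coeffComm_qdet i j).symm.shiftRoot_right.symm

lemma coeffComm_rootQdet_self (hT : IsGl T) : CoeffComm (rootQdet T) (rootQdet T) :=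
  CoeffComm.rootQdet_right hT.coeffComm_rootQdet

lemma coeffComm_sInv_rootQdet (hT : IsGl T) (i j : Fin 2) :
    CoeffComm (sInv (rootQdet T)) (T i j) :=
  ((hT.coeffComm_rootQdet i j).symm.sInv_right (coeff_zero_rootQdet T)).symm

lemma coeffComm_sInv_rootQdet_self (hT : IsGl T) :
    CoeffComm (sInv (rootQdet T)) (sInv (rootQdet T)) :=
  (hT.coeffComm_rootQdet_self.sInv_right (coeff_zero_rootQdet T)).symm.sInv_right
    (coeff_zero_rootQdet T)

lemma normalized (hT : IsGl T) : IsGl (normalized T) :=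
  hT.scale (coeff_zero_sInv _) hT.coeffComm_sInv_rootQdet_self hT.coeffComm_sInv_rootQdet

/-- The quantum determinant of `z(u) T(u)`. -/
lemma qdetOf_scale {z : A⟦X⟧} (h : ∀ i j, CoeffComm z (T i j)) :
    qdetOf (fun i j => z * T i j) = z * shiftHom A z * qdetOf T := by
  have e (i j : Fin 2) (F : A⟦X⟧) :
      z * T i j * (shiftHom A z * F) = z * shiftHom A z * (T i j * F) := by
    rw [mul_assoc, ← mul_assoc (T i j), ((h i j).symm.shiftHom_right).commute.eq]
    simp only [mul_assoc]
  rw [qdetOf, map_mul, map_mul, e, e, ← mul_sub, qdetOf]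

lemma qdetOf_normalized (hT : IsGl T) : qdetOf (LowRankYangian.normalized T) = 1 := by
  have h0 := coeff_zero_rootQdet T
  have hc : Commute (rootQdet T) (shiftHom A (rootQdet T)) :=
    hT.coeffComm_rootQdet_self.shiftHom_right.commute
  have := qdetOf_scale (T := T) hT.coeffComm_sInv_rootQdet
  rw [shiftHom_sInv h0] at this
  refine this.trans ?_
  rw [← hT.rootQdet_mul, hc.eq, mul_assoc, ← mul_assoc (sInv (shiftHom A _)), sInv_mul, one_mul,
    sInv_mul h0]
  rw [coeff_zero_shiftHom, h0]

lemma coeff_zero_diag (hT : IsGl T) (i : Fin 2) : PowerSeries.coeff 0 (T i i) = 1 := by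
  rw [hT.coeff_zero, if_pos rfl]

lemma rootQdet_mul_normalized (i j : Fin 2) :
    rootQdet T * LowRankYangian.normalized T i j = T i j := by
  rw [LowRankYangian.normalized, ← mul_assoc, mul_sInv (coeff_zero_rootQdet T), one_mul]

lemma coeffComm_sInv_rootQdet_shift (hT : IsGl T) (i j : Fin 2) :
    CoeffComm (shiftHom A (sInv (rootQdet T))) (T i j) :=
  (hT.coeffComm_sInv_rootQdet i j).symm.shiftHom_right.symm

lemma sInv_rootQdet_mul (hT : IsGl T) :
    sInv (rootQdet T) * shiftHom A (sInv (rootQdet T)) * qdetOf T = 1 := by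
  rw [← qdetOf_scale hT.coeffComm_sInv_rootQdet]
  exact hT.qdetOf_normalized

lemma normalized_mul_shiftHom (hT : IsGl T) :
    LowRankYangian.normalized T 0 0 * shiftHom A (LowRankYangian.normalized T 0 0) =
      sInv (rootQdet T) * shiftHom A (sInv (rootQdet T)) * (T 0 0 * shiftHom A (T 0 0)) := by
  rw [LowRankYangian.normalized, map_mul, mul_assoc, ← mul_assoc (T 0 0),
    (hT.coeffComm_sInv_rootQdet_shift 0 0).symm.commute.eq]
  simp only [mul_assoc]

/-- If N = d⁻¹ T_00, then N(u) N(u-1) is D(u)⁻¹ T_00(u) T_00(u-1) = h(u-1)⁻¹, and shift roots are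
unique. So N depends on h alone, where h is the ratio of the two diagonal Gauss coordinates. -/
lemma normalized_zero_zero_eq (hT : IsGl T) {h : A⟦X⟧} (h0 : PowerSeries.coeff 0 h = 1)
    (e : T 0 0 * shiftHom A (T 0 0) * shiftHom A h = qdetOf T) :
    LowRankYangian.normalized T 0 0 = shiftRoot (sInv (shiftHom A h)) := by
  apply shiftRoot_unique
  · exact hT.normalized.coeff_zero_diag 0
  · rw [← shiftHom_apply]
    have h1 : PowerSeries.coeff 0 (shiftHom A h) = 1 := by rw [coeff_zero_shiftHom, h0]
    rw [hT.normalized_mul_shiftHom, ← mul_one (_ * (_ * _)), ← mul_sInv h1, ← mul_assoc,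
      mul_assoc _ _ (shiftHom A h), e, hT.sInv_rootQdet_mul, one_mul]

/-- T_00 h is the second diagonal Gauss coordinate, and this is the factorization of D(u) as T_00(u)
times that coordinate at u - 1. -/
lemma qdet_eq_row (hT : IsGl T) {e h : A⟦X⟧} (he : T 0 0 * e = T 0 1)
    (hh : T 0 0 * h = T 1 1 - T 1 0 * e) :
    T 0 0 * shiftHom A (T 0 0) * shiftHom A h = qdetOf T := by
  have h5 := hT.spec_column 0 0 1
  rw [mul_assoc, ← map_mul, hh, map_sub, map_mul, mul_sub, ← mul_assoc, h5, mul_assoc, ← map_mul,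
    he, qdetOf]

lemma qdet_eq_column (hT : IsGl T) {f h : A⟦X⟧} (hf : f * T 0 0 = T 1 0)
    (hh : h * T 0 0 = T 1 1 - f * T 0 1) :
    T 0 0 * shiftHom A (T 0 0) * shiftHom A h = qdetOf T := by
  have h5 := hT.spec_column 0 0 1
  have ha : Commute (T 0 0) (shiftHom A (T 0 0)) :=
    (hT.coeffComm_self 0 0).shiftHom_right.commute
  have hf' : T 0 0 * shiftHom A f = T 1 0 := by
    have e : T 0 0 * shiftHom A f * shiftHom A (T 0 0) = T 1 0 * shiftHom A (T 0 0) := by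
      rw [mul_assoc, ← map_mul, hf, h5]
    have h1 : PowerSeries.coeff 0 (shiftHom A (T 0 0)) = 1 := by
      rw [coeff_zero_shiftHom, hT.coeff_zero_diag]
    have := congrArg (· * sInv (shiftHom A (T 0 0))) e
    simpa only [mul_assoc, mul_sInv h1, mul_one] using this
  have hD : T 0 0 * shiftHom A h * shiftHom A (T 0 0) = qdetOf T := by
    rw [mul_assoc, ← map_mul, hh, map_sub, map_mul, mul_sub, ← mul_assoc, hf', qdetOf]
  -- In this version h(u-1) stands to the left of T_00(u-1). Centrality of D moves first T_00(u),
  -- then the product T_00(u-1) T_00(u), to the other side.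
  have hD2 : T 0 0 * (shiftHom A h * shiftHom A (T 0 0) * T 0 0) = T 0 0 * qdetOf T := by
    rw [← (hT.coeffComm_qdet 0 0).commute.eq, ← hD]
    simp only [mul_assoc]
  have h0 := hT.coeff_zero_diag 0
  have hD3 : shiftHom A h * shiftHom A (T 0 0) * T 0 0 = qdetOf T := by
    have := congrArg (sInv (T 0 0) * ·) hD2
    simpa only [← mul_assoc, sInv_mul h0, one_mul] using this
  set m := shiftHom A (T 0 0) * T 0 0 with hm
  have hm0 : PowerSeries.coeff 0 m = 1 := by
    rw [hm, coeff_zero_mul_of_eq_one (by rw [coeff_zero_shiftHom, h0]), h0]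
  have hDm : Commute (qdetOf T) m :=
    ((hT.coeffComm_qdet 0 0).shiftHom_right.mul_right (hT.coeffComm_qdet 0 0)).commute
  rw [ha.eq, ← hm]
  rw [mul_assoc, ← hm] at hD3
  have e : m * shiftHom A h * m = qdetOf T * m := by rw [mul_assoc, hD3, hDm.eq]
  have := congrArg (· * sInv m) e
  simpa only [mul_assoc, mul_sInv hm0, mul_one] using this

/-- The normalized matrix is built from e = T_00⁻¹ T_01 and g = T_10^(1) alone: the ratio h equals 1
- [e, g], which gives N_00; then N_01 = N_00 e, and brackets with g give N_10 and N_11. -/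
lemma commute_normalized_of_row (hT : IsGl T) {y : A}
    (h1 : Commute (PowerSeries.C y) (sInv (T 0 0) * T 0 1))
    (h2 : Commute (PowerSeries.C y) (PowerSeries.C (PowerSeries.coeff 1 (T 1 0)))) (i j : Fin 2) :
    Commute (PowerSeries.C y) (LowRankYangian.normalized T i j) := by
  have b1 := hT.bracket 0 0 1 0
  have b2 := hT.bracket 0 1 1 0
  set e := sInv (T 0 0) * T 0 1 with he
  set g : A⟦X⟧ := PowerSeries.C (PowerSeries.coeff 1 (T 1 0)) with hg
  simp only [one_ne_zero, if_true, if_false, zero_sub] at b1 b2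
  have he' : T 0 0 * e = T 0 1 := by
    rw [he, ← mul_assoc, mul_sInv (hT.coeff_zero_diag 0), one_mul]
  have hh : T 0 0 * (1 - (e * g - g * e)) = T 1 1 - T 1 0 * e := by
    linear_combination (norm := noncomm_ring) -(he' * g) + b1 * e - b2 + g * he'
  have hh0 : PowerSeries.coeff 0 (1 - (e * g - g * e)) = 1 := by
    rw [← coeff_zero_mul_of_eq_one (hT.coeff_zero_diag 0), hh, map_sub, PowerSeries.coeff_mul,
      Finset.Nat.antidiagonal_zero, Finset.sum_singleton]
    simp only [hT.coeff_zero]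
    simp
  have c00 : Commute (PowerSeries.C y) (LowRankYangian.normalized T 0 0) := by
    rw [hT.normalized_zero_zero_eq hh0 (hT.qdet_eq_row he' hh)]
    exact commute_C_shiftRoot (commute_sInv (by rw [coeff_zero_shiftHom, hh0])
      (commute_C_shiftHom ((Commute.one_right _).sub_right
        ((h1.mul_right h2).sub_right (h2.mul_right h1)))))
  have c01 : Commute (PowerSeries.C y) (LowRankYangian.normalized T 0 1) := by
    have : LowRankYangian.normalized T 0 1 = LowRankYangian.normalized T 0 0 * e := by
      rw [LowRankYangian.normalized, LowRankYangian.normalized, mul_assoc, he']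
    rw [this]
    exact c00.mul_right h1
  have hdg : sInv (rootQdet T) * g = g * sInv (rootQdet T) := by
    rw [hg]
    exact ((hT.coeffComm_sInv_rootQdet 1 0).symm.commute_C 1).symm.eq
  have e10 : LowRankYangian.normalized T 1 0 =
      g * LowRankYangian.normalized T 0 0 - LowRankYangian.normalized T 0 0 * g := by
    simp only [LowRankYangian.normalized]
    linear_combination (norm := noncomm_ring) sInv (rootQdet T) * b1 + hdg * T 0 0
  have e11 : LowRankYangian.normalized T 1 1 = LowRankYangian.normalized T 0 0 -
      (LowRankYangian.normalized T 0 1 * g - g * LowRankYangian.normalized T 0 1) := by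
    simp only [LowRankYangian.normalized]
    linear_combination (norm := noncomm_ring) sInv (rootQdet T) * b2 + hdg * T 0 1
  have c10 : Commute (PowerSeries.C y) (LowRankYangian.normalized T 1 0) := by
    rw [e10]
    exact (h2.mul_right c00).sub_right (c00.mul_right h2)
  have c11 : Commute (PowerSeries.C y) (LowRankYangian.normalized T 1 1) := by
    rw [e11]
    exact c00.sub_right ((c01.mul_right h2).sub_right (h2.mul_right c01))
  fin_cases i <;> fin_cases j <;> assumption

/-- The transposed argument: f = T_10 T_00⁻¹ and g = T_01^(1) determine the normalized matrix, with
h = 1 + [f, g]. -/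
lemma commute_normalized_of_column (hT : IsGl T) {y : A}
    (h1 : Commute (PowerSeries.C y) (T 1 0 * sInv (T 0 0)))
    (h2 : Commute (PowerSeries.C y) (PowerSeries.C (PowerSeries.coeff 1 (T 0 1)))) (i j : Fin 2) :
    Commute (PowerSeries.C y) (LowRankYangian.normalized T i j) := by
  have b1 := hT.bracket 0 0 0 1
  have b2 := hT.bracket 1 0 0 1
  set f := T 1 0 * sInv (T 0 0) with hf
  set g : A⟦X⟧ := PowerSeries.C (PowerSeries.coeff 1 (T 0 1)) with hg
  simp only [zero_ne_one, if_true, if_false, sub_zero] at b1 b2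
  have hf' : f * T 0 0 = T 1 0 := by
    rw [hf, mul_assoc, sInv_mul (hT.coeff_zero_diag 0), mul_one]
  have hh : (1 + (f * g - g * f)) * T 0 0 = T 1 1 - f * T 0 1 := by
    linear_combination (norm := noncomm_ring) hf' * g - f * b1 + b2 - g * hf'
  have hh0 : PowerSeries.coeff 0 (1 + (f * g - g * f)) = 1 := by
    have e0 : PowerSeries.coeff 0 ((1 + (f * g - g * f)) * T 0 0) =
        PowerSeries.coeff 0 (1 + (f * g - g * f)) := by
      rw [PowerSeries.coeff_mul]
      simp [hT.coeff_zero]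
    rw [← e0, hh, map_sub, PowerSeries.coeff_mul,
      Finset.Nat.antidiagonal_zero, Finset.sum_singleton]
    simp only [hT.coeff_zero]
    simp
  have c00 : Commute (PowerSeries.C y) (LowRankYangian.normalized T 0 0) := by
    rw [hT.normalized_zero_zero_eq hh0 (hT.qdet_eq_column hf' hh)]
    exact commute_C_shiftRoot (commute_sInv (by rw [coeff_zero_shiftHom, hh0])
      (commute_C_shiftHom ((Commute.one_right _).add_right
        ((h1.mul_right h2).sub_right (h2.mul_right h1)))))
  have c10 : Commute (PowerSeries.C y) (LowRankYangian.normalized T 1 0) := by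
    have : LowRankYangian.normalized T 1 0 = f * LowRankYangian.normalized T 0 0 := by
      have hd : Commute f (sInv (rootQdet T)) :=
        (((hT.coeffComm_sInv_rootQdet 1 0).mul_right
          ((hT.coeffComm_sInv_rootQdet 0 0).sInv_right (hT.coeff_zero_diag 0))).commute).symm
      rw [LowRankYangian.normalized, LowRankYangian.normalized, ← mul_assoc, hd.eq, mul_assoc, hf']
    rw [this]
    exact h1.mul_right c00
  have hdg : sInv (rootQdet T) * g = g * sInv (rootQdet T) := by
    rw [hg]
    exact ((hT.coeffComm_sInv_rootQdet 0 1).symm.commute_C 1).symm.eq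
  have e01 : LowRankYangian.normalized T 0 1 =
      LowRankYangian.normalized T 0 0 * g - g * LowRankYangian.normalized T 0 0 := by
    simp only [LowRankYangian.normalized]
    linear_combination (norm := noncomm_ring) -(sInv (rootQdet T) * b1) - hdg * T 0 0
  have e11 : LowRankYangian.normalized T 1 1 = LowRankYangian.normalized T 0 0 +
      (LowRankYangian.normalized T 1 0 * g - g * LowRankYangian.normalized T 1 0) := by
    simp only [LowRankYangian.normalized]
    linear_combination (norm := noncomm_ring) -(sInv (rootQdet T) * b2) - hdg * T 1 0
  have c01 : Commute (PowerSeries.C y) (LowRankYangian.normalized T 0 1) := by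
    rw [e01]
    exact (c00.mul_right h2).sub_right (h2.mul_right c00)
  have c11 : Commute (PowerSeries.C y) (LowRankYangian.normalized T 1 1) := by
    rw [e11]
    exact c00.add_right ((c10.mul_right h2).sub_right (h2.mul_right c10))
  fin_cases i <;> fin_cases j <;> assumption

end IsGl

end Normalized

/-! ### Matrices satisfying the relations of X(o_4) -/

section OFamilies

variable {A B : Type*} [Ring A] [Algebra ℂ A] [Ring B] [Algebra ℂ B]

lemma coeff_mul_of_coeff_lt {F G : A⟦X⟧} {n : ℕ} (h : ∀ m < n, PowerSeries.coeff m F = 0) :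
    PowerSeries.coeff n (F * G) = PowerSeries.coeff n F * PowerSeries.coeff 0 G := by
  rw [PowerSeries.coeff_mul, Finset.sum_eq_single (n, 0)]
  · rintro ⟨a, b⟩ hab hne
    rw [Finset.HasAntidiagonal.mem_antidiagonal] at hab
    rw [h a, zero_mul]
    by_contra hc
    refine hne ?_
    dsimp only at hab
    simp only [Prod.mk.injEq]
    omega
  · intro h'
    exact absurd (Finset.HasAntidiagonal.mem_antidiagonal.2 (by simp)) h'

lemma coeff_mul_of_coeff_lt' {F G : A⟦X⟧} {n : ℕ} (h : ∀ m < n, PowerSeries.coeff m G = 0) :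
    PowerSeries.coeff n (F * G) = PowerSeries.coeff 0 F * PowerSeries.coeff n G := by
  rw [PowerSeries.coeff_mul, Finset.sum_eq_single (0, n)]
  · rintro ⟨a, b⟩ hab hne
    rw [Finset.HasAntidiagonal.mem_antidiagonal] at hab
    rw [h b, mul_zero]
    by_contra hc
    refine hne ?_
    dsimp only at hab
    simp only [Prod.mk.injEq]
    omega
  · intro h'
    exact absurd (Finset.HasAntidiagonal.mem_antidiagonal.2 (by simp)) h'

lemma coeff_shiftHom_of_coeff_lt {F : A⟦X⟧} {n : ℕ} (h : ∀ m < n, PowerSeries.coeff m F = 0) :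
    PowerSeries.coeff n (shiftHom A F) = PowerSeries.coeff n F := by
  rw [shiftHom_apply, coeff_shiftOne, Finset.sum_eq_zero, zero_add]
  intro r hr
  rw [h r (Finset.mem_range.1 hr), smul_zero]

lemma eq_zero_of_coeff_step {D : A⟦X⟧}
    (h : ∀ n, (∀ m < n, PowerSeries.coeff m D = 0) → PowerSeries.coeff n D = 0) : D = 0 := by
  ext n
  rw [map_zero]
  induction n using Nat.strong_induction_on with
  | _ n ih => exact h n ih

lemma eq_zero_of_two_mul {a : A} (h : a + a = 0) : a = 0 := by
  rw [← two_smul ℂ] at h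
  exact (smul_eq_zero_iff_right (two_ne_zero : (2 : ℂ) ≠ 0)).1 h

/-- The shift u ↦ u - 1 preserves the leading coefficient, so the leading coefficient of the left
side is twice that of D. -/
lemma eq_zero_of_shiftHom_mul_add {D F G : A⟦X⟧} (hF : PowerSeries.coeff 0 F = 1)
    (hG : PowerSeries.coeff 0 G = 1) (h : shiftHom A D * F + G * D = 0) : D = 0 := by
  refine eq_zero_of_coeff_step fun n hn => ?_
  have hs : ∀ m < n, PowerSeries.coeff m (shiftHom A D) = 0 := fun m hm => by
    rw [coeff_shiftHom_of_coeff_lt fun k hk => hn k (hk.trans hm), hn m hm]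
  have := congrArg (PowerSeries.coeff n) h
  rw [map_add, coeff_mul_of_coeff_lt hs, coeff_mul_of_coeff_lt' hn, hF, hG, mul_one, one_mul,
    coeff_shiftHom_of_coeff_lt hn, map_zero] at this
  exact eq_zero_of_two_mul this

lemma eq_zero_of_mul_shiftHom_add {D F G : A⟦X⟧} (hF : PowerSeries.coeff 0 F = 1)
    (hG : PowerSeries.coeff 0 G = 1) (h : F * shiftHom A D + D * G = 0) : D = 0 := by
  refine eq_zero_of_coeff_step fun n hn => ?_
  have hs : ∀ m < n, PowerSeries.coeff m (shiftHom A D) = 0 := fun m hm => by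
    rw [coeff_shiftHom_of_coeff_lt fun k hk => hn k (hk.trans hm), hn m hm]
  have := congrArg (PowerSeries.coeff n) h
  rw [map_add, coeff_mul_of_coeff_lt' hs, coeff_mul_of_coeff_lt hn, hF, hG, mul_one, one_mul,
    coeff_shiftHom_of_coeff_lt hn, map_zero] at this
  exact eq_zero_of_two_mul this

/-- The matrices of series which satisfy the defining relations of `X(o_4)`. -/
structure IsO (t : Fin 4 → Fin 4 → A⟦X⟧) : Prop where
  coeff_zero : ∀ i j, PowerSeries.coeff 0 (t i j) = if i = j then 1 else 0
  rel : ∀ i j k l, oLHS t i j k l = oRHS t i j k l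

lemma XO.isO_t : IsO (XO.t (N := 4)) := ⟨XO.coeff_zero_t, XO.t_rel⟩

lemma kappa_four : kappa 4 = 1 := by norm_num [kappa]

lemma sum_mul_C_ite (F : Fin 4 → A⟦X⟧) (l : Fin 4) :
    ∑ p : Fin 4, F p * PowerSeries.C (if p.rev = l then (1 : A) else 0) = F l.rev := by
  rw [Finset.sum_eq_single l.rev]
  · simp
  · intro p _ hp
    rw [if_neg, map_zero, mul_zero]
    rintro rfl
    simp at hp
  · simp

lemma sum_C_ite_mul (F : Fin 4 → A⟦X⟧) (k : Fin 4) :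
    ∑ p : Fin 4, PowerSeries.C (if k = p.rev then (1 : A) else 0) * F p = F k.rev := by
  rw [Finset.sum_eq_single k.rev]
  · simp
  · intro p _ hp
    rw [if_neg, map_zero, zero_mul]
    rintro rfl
    simp at hp
  · simp

namespace IsO

variable {t : Fin 4 → Fin 4 → A⟦X⟧}

lemma coeff_zero_diag (ht : IsO t) (i : Fin 4) : PowerSeries.coeff 0 (t i i) = 1 := by
  rw [ht.coeff_zero, if_pos rfl]

/-- The bracket with `t_{kl}^{(1)}`. -/
lemma bracket (ht : IsO t) (i j k l : Fin 4) :
    t i j * PowerSeries.C (PowerSeries.coeff 1 (t k l)) -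
        PowerSeries.C (PowerSeries.coeff 1 (t k l)) * t i j =
      ((if k = j then t i l else 0) - (if i = l then t k j else 0)) +
      ((if k = i.rev then t l.rev j else 0) - (if l = j.rev then t i k.rev else 0)) := by
  have h := congrArg (vCoeffOne A) (ht.rel i j k l)
  obtain ⟨e0, e1⟩ := vCoeffOne_commutator (F := t i j) (ht.coeff_zero k l) (commute_C_ite _ _)
  -- At order v⁰ both linear factors are -u⁻¹ whatever κ is, so u⁻² cancels and the two kinds of
  -- terms enter with weights of the same size.
  rw [oLHS, oRHS, map_sub, vCoeffOne_mul, e0, e1, mul_zero, add_zero, map_mul,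
    vCoeffZero_linFactor, vCoeffZero_linFactor, mul_assoc (uInv A * vInv A),
    mul_assoc (uInv A * vInv A), vCoeffOne_mul (uInv A * vInv A), vCoeffOne_mul (uInv A * vInv A),
    vCoeffZero_uInv_mul_vInv, vCoeffOne_uInv_mul_vInv, zero_mul, zero_mul, zero_add, zero_add,
    map_mul, map_mul, vCoeffZero_linFactor, vCoeffZero_linFactor, neg_mul_neg, mul_assoc,
    ← mul_sub, neg_mul, neg_mul, sub_neg_eq_add, neg_add_eq_sub, ← mul_sub] at h
  rw [X_mul_cancel (X_mul_cancel h)]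
  simp only [map_sub, map_mul, vCoeffZero_inU, vCoeffZero_inV, ht.coeff_zero,
    apply_ite (vCoeffZero A), map_zero, map_sum, sum_mul_C_ite, sum_C_ite_mul]
  have e2 : ∀ (p : Prop) [Decidable p] (F : A⟦X⟧),
      F * PowerSeries.C (if p then (1 : A) else 0) = if p then F else 0 := by
    intro p _ F; split_ifs <;> simp
  have e3 : ∀ (p : Prop) [Decidable p] (F : A⟦X⟧),
      PowerSeries.C (if p then (1 : A) else 0) * F = if p then F else 0 := by
    intro p _ F; split_ifs <;> simp
  rw [e2, e3]
  abel

/-- The relations at `v = u - 1`. -/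
lemma spec (ht : IsO t) (i j k l : Fin 4) :
    (if k = i.rev then ∑ p, t p j * shiftHom A (t p.rev l) else 0) =
      if l = j.rev then ∑ p, shiftHom A (t k p.rev) * t i p else 0 := by
  -- As κ = 1, the factor u - v - κ is zero here, and only the terms with the pole at u - v = κ
  -- survive.
  have h := congrArg (specHom A) (ht.rel i j k l)
  rw [oLHS, oRHS] at h
  simp only [map_mul, map_sub, specHom_linFactor, specHom_inU, specHom_inV, uInv, vInv, sub_zero,
    map_one, one_mul, kappa_four, sub_self, map_zero, zero_mul, mul_zero, zero_sub, map_sum,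
    apply_ite (specHom A)] at h
  rw [eq_comm, neg_eq_zero, mul_assoc] at h
  have h1 := X_mul_shiftHom_X_mul_cancel (h.trans (mul_zero _).symm)
  exact sub_eq_zero.1 (X_mul_shiftHom_X_mul_cancel (h1.trans (mul_zero _).symm))

lemma rel_of_ne (ht : IsO t) {i j k l : Fin 4} (hik : k ≠ i.rev) (hjl : l ≠ j.rev) :
    glLHS t i j k l = glRHS t i j k l := by
  have h := ht.rel i j k l
  rw [oLHS, oRHS, if_neg hik, if_neg hjl, sub_self, mul_zero, sub_zero,
    (commute_linFactor 0 (linFactor A _)).eq, ← (commute_linFactor _ (uInv A * vInv A)).eq,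
    mul_assoc, mul_assoc] at h
  exact linFactor_mul_cancel h

/-- When no two chosen indices are opposite, the Kronecker deltas in the `o_4` relation vanish and u
- v - κ can be cancelled. -/
lemma isGl_comp (ht : IsO t) (f : Fin 2 → Fin 4) (hf : Function.Injective f)
    (h : ∀ i k, f k ≠ (f i).rev) : IsGl fun i j => t (f i) (f j) where
  coeff_zero i j := by simp only [ht.coeff_zero, hf.eq_iff]
  rel i j k l := ht.rel_of_ne (h i k) (h j l)

lemma isGl_fst (ht : IsO t) : IsGl fun a c => t (idx a 0) (idx c 0) :=
  ht.isGl_comp (fun a => idx a 0) (by decide) (by decide)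

lemma isGl_snd (ht : IsO t) : IsGl fun b d => t (idx 0 b) (idx 0 d) :=
  ht.isGl_comp (fun b => idx 0 b) (by decide) (by decide)

/-- The relations for (i, j; i, -j) and (i, -j; i, j) contain the same sum over p. Their difference
loses it, u - v - κ cancels, and v = u - 1 leaves twice the claim. -/
lemma row_swap (ht : IsO t) (i j : Fin 4) :
    shiftHom A (t i j) * t i j.rev = shiftHom A (t i j.rev) * t i j := by
  have hi : i ≠ i.rev := by revert i; decide
  have h1 := ht.rel i j i j.rev
  have h2 := ht.rel i j.rev i j
  rw [oLHS, oRHS, if_neg hi, if_pos rfl] at h1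
  rw [oLHS, oRHS, if_neg hi, if_pos (by simp)] at h2
  have h3 : linFactor A (kappa 4) * (linFactor A 0 * ((inU (t i j) * inV (t i j.rev) -
      inV (t i j.rev) * inU (t i j)) - (inU (t i j.rev) * inV (t i j) -
      inV (t i j) * inU (t i j.rev)))) = linFactor A (kappa 4) * (uInv A * vInv A *
      ((inU (t i j) * inV (t i j.rev) - inV (t i j) * inU (t i j.rev)) -
      (inU (t i j.rev) * inV (t i j) - inV (t i j.rev) * inU (t i j)))) := by
    rw [← mul_assoc, ← mul_assoc, (commute_linFactor (kappa 4) (linFactor A 0)).eq,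
      (commute_linFactor (kappa 4) (uInv A * vInv A)).eq]
    linear_combination (norm := noncomm_ring) h1 - h2
  have h4 := congrArg (specHom A) (linFactor_mul_cancel h3)
  simp only [map_mul, map_sub, specHom_linFactor, specHom_inU, specHom_inV, uInv, vInv, sub_zero,
    map_one, one_mul] at h4
  have h5 := X_mul_shiftHom_X_mul_cancel h4
  refine sub_eq_zero.1 (eq_zero_of_two_mul ?_)
  linear_combination (norm := noncomm_ring) h5

lemma column_swap (ht : IsO t) (i j : Fin 4) :
    t i j * shiftHom A (t i.rev j) = t i.rev j * shiftHom A (t i j) := by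
  have hj : j ≠ j.rev := by revert j; decide
  have h1 := ht.rel i j i.rev j
  have h2 := ht.rel i.rev j i j
  rw [oLHS, oRHS, if_neg hj, if_pos rfl] at h1
  rw [oLHS, oRHS, if_neg hj, if_pos (by simp)] at h2
  have h3 : linFactor A (kappa 4) * (linFactor A 0 * ((inU (t i j) * inV (t i.rev j) -
      inV (t i.rev j) * inU (t i j)) - (inU (t i.rev j) * inV (t i j) -
      inV (t i j) * inU (t i.rev j)))) = linFactor A (kappa 4) * (uInv A * vInv A *
      ((inU (t i.rev j) * inV (t i j) - inV (t i.rev j) * inU (t i j)) -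
      (inU (t i j) * inV (t i.rev j) - inV (t i j) * inU (t i.rev j)))) := by
    rw [← mul_assoc, ← mul_assoc, (commute_linFactor (kappa 4) (linFactor A 0)).eq,
      (commute_linFactor (kappa 4) (uInv A * vInv A)).eq]
    linear_combination (norm := noncomm_ring) h1 - h2
  have h4 := congrArg (specHom A) (linFactor_mul_cancel h3)
  simp only [map_mul, map_sub, specHom_linFactor, specHom_inU, specHom_inV, uInv, vInv, sub_zero,
    map_one, one_mul] at h4
  have h5 := X_mul_shiftHom_X_mul_cancel h4
  refine sub_eq_zero.1 (eq_zero_of_two_mul ?_)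
  linear_combination (norm := noncomm_ring) h5

lemma spec_row (ht : IsO t) (j : Fin 4) (hj : j ≠ 3) :
    shiftHom A (t 0 j) * t 0 0 = shiftHom A (t 0 0) * t 0 j := by
  have h := congrArg (specHom A) (ht.rel_of_ne (i := 0) (j := 0) (k := 0) (l := j)
    (by decide) hj)
  simp only [glLHS, glRHS, map_mul, map_sub, specHom_linFactor, specHom_inU, specHom_inV, uInv,
    vInv, sub_zero, map_one, one_mul] at h
  exact sub_right_injective (X_mul_shiftHom_X_mul_cancel h)

lemma spec_column (ht : IsO t) (i : Fin 4) (hi : i ≠ 3) :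
    t 0 0 * shiftHom A (t i 0) = t i 0 * shiftHom A (t 0 0) := by
  have h := congrArg (specHom A) (ht.rel_of_ne (i := 0) (j := 0) (k := i) (l := 0)
    hi (by decide))
  simp only [glLHS, glRHS, map_mul, map_sub, specHom_linFactor, specHom_inU, specHom_inV, uInv,
    vInv, sub_zero, map_one, one_mul] at h
  exact sub_left_injective (X_mul_shiftHom_X_mul_cancel h)

/-- The relation at v = u - 1 makes the first row isotropic: t_03(u-1) t_00(u) + t_00(u-1) t_03(u) =
-2 t_01(u-1) t_02(u). The right side of the lemma solves the same equation, whose solution is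
unique. -/
lemma entry_zero_three (ht : IsO t) : t 0 3 = -(t 0 1 * sInv (t 0 0) * t 0 2) := by
  have hp := ht.coeff_zero_diag 0
  have hP : PowerSeries.coeff 0 (shiftHom A (t 0 0)) = 1 := by rw [coeff_zero_shiftHom, hp]
  have h0 := ht.spec 0 0 0 3
  rw [if_neg (by decide), if_pos (by decide), Fin.sum_univ_four] at h0
  change 0 = shiftHom A (t 0 3) * t 0 0 + shiftHom A (t 0 2) * t 0 1 +
    shiftHom A (t 0 1) * t 0 2 + shiftHom A (t 0 0) * t 0 3 at h0
  have h1 : shiftHom A (t 0 1) * t 0 2 = shiftHom A (t 0 2) * t 0 1 := ht.row_swap 0 1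
  have h2 := ht.spec_row 1 (by decide)
  have h3 := ht.spec_row 2 (by decide)
  have h4 := mul_sInv hp
  have h5 := sInv_mul hP
  rw [← shiftHom_sInv hp] at h5
  refine eq_neg_of_add_eq_zero_left (eq_zero_of_shiftHom_mul_add hp hP ?_)
  simp only [map_add, map_mul]
  linear_combination (norm := noncomm_ring) -h0 + h1 -
    h2 * (sInv (t 0 0) * t 0 2) + shiftHom A (t 0 1) * h4 * t 0 2 +
    shiftHom A (t 0 1) * shiftHom A (sInv (t 0 0)) * h3 + shiftHom A (t 0 1) * h5 * t 0 2

lemma entry_three_zero (ht : IsO t) : t 3 0 = -(t 2 0 * sInv (t 0 0) * t 1 0) := by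
  have hp := ht.coeff_zero_diag 0
  have hP : PowerSeries.coeff 0 (shiftHom A (t 0 0)) = 1 := by rw [coeff_zero_shiftHom, hp]
  have h0 := ht.spec 0 0 3 0
  rw [if_neg (by decide : (0 : Fin 4) ≠ Fin.rev 0), if_pos (by decide), Fin.sum_univ_four] at h0
  change t 0 0 * shiftHom A (t 3 0) + t 1 0 * shiftHom A (t 2 0) +
    t 2 0 * shiftHom A (t 1 0) + t 3 0 * shiftHom A (t 0 0) = 0 at h0
  have h1 : t 1 0 * shiftHom A (t 2 0) = t 2 0 * shiftHom A (t 1 0) := ht.column_swap 1 0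
  have h2 := ht.spec_column 1 (by decide)
  have h3 := ht.spec_column 2 (by decide)
  have h4 := sInv_mul hp
  have h5 := mul_sInv hP
  rw [← shiftHom_sInv hp] at h5
  refine eq_neg_of_add_eq_zero_left (eq_zero_of_mul_shiftHom_add hp hP ?_)
  simp only [map_add, map_mul]
  linear_combination (norm := noncomm_ring) h0 - h1 -
    (t 2 0 * sInv (t 0 0)) * h2 + t 2 0 * h4 * shiftHom A (t 1 0) +
    h3 * (shiftHom A (sInv (t 0 0)) * shiftHom A (t 1 0)) + t 2 0 * h5 * shiftHom A (t 1 0)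

end IsO

end OFamilies

/-! ### Generation by the coefficients of the matrix entries -/

section Generation

variable {A : Type*} [Ring A] [Algebra ℂ A] {N : ℕ}

lemma YGl.mem_of_coeff_mem (S : Subalgebra ℂ (YGl N))
    (h : ∀ i j n, PowerSeries.coeff n (YGl.T (N := N) i j) ∈ S) (x : YGl N) : x ∈ S := by
  obtain ⟨x, rfl⟩ := RingQuot.mkAlgHom_surjective ℂ (GlRel N) x
  induction x using FreeAlgebra.induction with
  | grade0 r => rw [AlgHom.commutes]; exact S.algebraMap_mem r
  | grade1 g =>
    have := h g.1 g.2.1 (g.2.2 + 1)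
    simp only [YGl.T, freeSeries, PowerSeries.coeff_map, PowerSeries.coeff_mk] at this
    exact this
  | mul a b ha hb => rw [map_mul]; exact S.mul_mem ha hb
  | add a b ha hb => rw [map_add]; exact S.add_mem ha hb

lemma XO.mem_of_coeff_mem (S : Subalgebra ℂ (XO N))
    (h : ∀ i j n, PowerSeries.coeff n (XO.t (N := N) i j) ∈ S) (x : XO N) : x ∈ S := by
  obtain ⟨x, rfl⟩ := RingQuot.mkAlgHom_surjective ℂ (ORel N) x
  induction x using FreeAlgebra.induction with
  | grade0 r => rw [AlgHom.commutes]; exact S.algebraMap_mem r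
  | grade1 g =>
    have := h g.1 g.2.1 (g.2.2 + 1)
    simp only [XO.t, freeSeries, PowerSeries.coeff_map, PowerSeries.coeff_mk] at this
    exact this
  | mul a b ha hb => rw [map_mul]; exact S.mul_mem ha hb
  | add a b ha hb => rw [map_add]; exact S.add_mem ha hb

lemma YGl.hom_ext {φ ψ : YGl N →ₐ[ℂ] A} (h : ∀ i j, PowerSeries.map φ.toRingHom (YGl.T i j) =
    PowerSeries.map ψ.toRingHom (YGl.T i j)) : φ = ψ := by
  ext x
  refine YGl.mem_of_coeff_mem (AlgHom.equalizer φ ψ) (fun i j n => ?_) x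
  have := congrArg (PowerSeries.coeff n) (h i j)
  simp only [PowerSeries.coeff_map] at this
  exact this

lemma XO.hom_ext {φ ψ : XO N →ₐ[ℂ] A} (h : ∀ i j, PowerSeries.map φ.toRingHom (XO.t i j) =
    PowerSeries.map ψ.toRingHom (XO.t i j)) : φ = ψ := by
  ext x
  refine XO.mem_of_coeff_mem (AlgHom.equalizer φ ψ) (fun i j n => ?_) x
  have := congrArg (PowerSeries.coeff n) (h i j)
  simp only [PowerSeries.coeff_map] at this
  exact this

lemma YGl.commute_of_coeffComm {φ ψ : YGl N →ₐ[ℂ] A}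
    (h : ∀ i j k l, CoeffComm (PowerSeries.map φ.toRingHom (YGl.T i j))
      (PowerSeries.map ψ.toRingHom (YGl.T k l))) (x y : YGl N) : Commute (φ x) (ψ y) := by
  have h1 : ∀ i j n, ∀ y, Commute (φ (PowerSeries.coeff n (YGl.T i j))) (ψ y) := by
    intro i j n y
    have hy := YGl.mem_of_coeff_mem ((Subalgebra.centralizer ℂ
      {φ (PowerSeries.coeff n (YGl.T i j))}).comap ψ) (fun k l m => by
        rw [Subalgebra.mem_comap, Subalgebra.mem_centralizer_iff]
        rintro _ rfl
        have := h i j k l n m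
        simp only [PowerSeries.coeff_map] at this
        exact this) y
    rw [Subalgebra.mem_comap, Subalgebra.mem_centralizer_iff] at hy
    exact hy _ rfl
  have hx := YGl.mem_of_coeff_mem ((Subalgebra.centralizer ℂ {ψ y}).comap φ) (fun k l m => by
    rw [Subalgebra.mem_comap, Subalgebra.mem_centralizer_iff]
    rintro _ rfl
    exact (h1 k l m y).symm) x
  rw [Subalgebra.mem_comap, Subalgebra.mem_centralizer_iff] at hx
  exact (hx _ rfl).symm

end Generation

/-! ### Factorization of an orthogonal matrix into two commuting factors -/

section Factors

variable {A B : Type*} [Ring A] [Algebra ℂ A] [Ring B] [Algebra ℂ B]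

/-- The rows and columns `e_a ⊗ e_1` of a matrix over `ℂ² ⊗ ℂ²`. -/
def fstBlock (t : Fin 4 → Fin 4 → A⟦X⟧) (a c : Fin 2) : A⟦X⟧ := t (idx a 0) (idx c 0)

/-- The rows and columns `e_1 ⊗ e_b` of a matrix over `ℂ² ⊗ ℂ²`. -/
def sndBlock (t : Fin 4 → Fin 4 → A⟦X⟧) (b d : Fin 2) : A⟦X⟧ := t (idx 0 b) (idx 0 d)

/-- The first factor of a matrix over `ℂ² ⊗ ℂ²`, with quantum determinant `1`. -/
def fstFactor (t : Fin 4 → Fin 4 → A⟦X⟧) (a c : Fin 2) : A⟦X⟧ := normalized (fstBlock t) a c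

/-- The second factor of a matrix over `ℂ² ⊗ ℂ²`. -/
def sndFactor (t : Fin 4 → Fin 4 → A⟦X⟧) (b d : Fin 2) : A⟦X⟧ :=
  sInv (fstFactor t 0 0) * sndBlock t b d

namespace IsO

variable {t t' : Fin 4 → Fin 4 → A⟦X⟧}

lemma map (ht : IsO t) (φ : A →ₐ[ℂ] B) : IsO fun i j => PowerSeries.map φ.toRingHom (t i j) where
  coeff_zero i j := by
    rw [PowerSeries.coeff_map, ht.coeff_zero]
    split_ifs <;> simp
  rel i j k l := by rw [← map_oLHS, ← map_oRHS, ht.rel]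

/-- This is the skew-symmetry of `o_4`: the u⁻¹ coefficient of the isotropy of row i is twice this
element. -/
lemma coeff_one_antidiagonal (ht : IsO t) (i : Fin 4) :
    PowerSeries.coeff 1 (t i i.rev) = 0 := by
  have hi : i ≠ i.rev := by revert i; decide
  have h := ht.spec i 0 i 3
  rw [if_neg hi, if_pos (by decide)] at h
  have h1 := congrArg (PowerSeries.coeff 1) h
  have e : ∀ F G : A⟦X⟧, PowerSeries.coeff 1 (F * G) =
      PowerSeries.coeff 0 F * PowerSeries.coeff 1 G +
        PowerSeries.coeff 1 F * PowerSeries.coeff 0 G := fun F G => by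
    rw [PowerSeries.coeff_mul]
    simp [Finset.Nat.antidiagonal_succ]
  simp only [map_zero, map_sum, e, coeff_zero_shiftHom, coeff_one_shiftHom, ht.coeff_zero,
    Finset.sum_add_distrib, ite_mul, mul_ite, one_mul, mul_one, zero_mul, mul_zero,
    Finset.sum_ite_eq, Finset.mem_univ, if_true] at h1
  rw [Finset.sum_eq_single i.rev (fun p _ hp => if_neg fun h => hp (by rw [h, Fin.rev_rev]))
    (by simp), if_pos (Fin.rev_rev i).symm] at h1
  exact eq_zero_of_two_mul h1.symm

lemma fstBlock_isGl (ht : IsO t) : IsGl (fstBlock t) := ht.isGl_fst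

lemma sndBlock_isGl (ht : IsO t) : IsGl (sndBlock t) := ht.isGl_snd

lemma fstFactor_isGl (ht : IsO t) : IsGl (fstFactor t) := ht.fstBlock_isGl.normalized

/-- Put g = t_01^(1). Then [t_00, g] = t_01 and [t_02, g] = -t_03 = t_01 t_00⁻¹ t_02, so g commutes
with t_00⁻¹ t_02. Moreover [t_20, g] = t_21 has zero u⁻¹ coefficient, so g commutes with t_20^(1).
These two data determine the first factor. -/
lemma commute_zero_one_fstFactor (ht : IsO t) (a c : Fin 2) :
    Commute (PowerSeries.C (PowerSeries.coeff 1 (t 0 1))) (fstFactor t a c) := by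
  have hp := ht.coeff_zero_diag 0
  refine ht.fstBlock_isGl.commute_normalized_of_row ?_ ?_ a c
  · change Commute _ (sInv (t 0 0) * t 0 2)
    have b1 := ht.bracket 0 0 0 1
    have b2 := ht.bracket 0 2 0 1
    rw [if_pos rfl, if_neg (by decide), if_neg (by decide), if_neg (by decide), sub_zero,
      sub_zero, add_zero] at b1
    rw [if_neg (by decide), if_neg (by decide), if_neg (by decide), if_pos (by decide), sub_zero,
      zero_sub, zero_add] at b2
    change _ = - t 0 3 at b2
    rw [ht.entry_zero_three] at b2
    set g : A⟦X⟧ := PowerSeries.C (PowerSeries.coeff 1 (t 0 1))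
    have h1 := mul_sInv hp
    have h2 := sInv_mul hp
    rw [Commute, SemiconjBy, eq_comm]
    have e : t 0 0 * (sInv (t 0 0) * t 0 2 * g) = t 0 0 * (g * (sInv (t 0 0) * t 0 2)) := by
      linear_combination (norm := noncomm_ring) h1 * t 0 2 * g + b2 - b1 * (sInv (t 0 0) * t 0 2)
        - g * h1 * t 0 2
    have := congrArg (sInv (t 0 0) * ·) e
    simpa only [← mul_assoc, h2, one_mul] using this
  · change Commute _ (PowerSeries.C (PowerSeries.coeff 1 (t 2 0)))
    have b := ht.bracket 2 0 0 1
    rw [if_pos rfl, if_neg (by decide), if_neg (by decide), if_neg (by decide), sub_zero,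
      sub_zero, add_zero] at b
    have b' := congrArg (PowerSeries.coeff 1) b
    rw [show PowerSeries.coeff 1 (t 2 1) = 0 from ht.coeff_one_antidiagonal 2, map_sub,
      PowerSeries.coeff_mul_C, PowerSeries.coeff_C_mul, sub_eq_zero] at b'
    exact (show Commute _ _ from b'.symm).map PowerSeries.C

lemma commute_one_zero_fstFactor (ht : IsO t) (a c : Fin 2) :
    Commute (PowerSeries.C (PowerSeries.coeff 1 (t 1 0))) (fstFactor t a c) := by
  have hp := ht.coeff_zero_diag 0
  refine ht.fstBlock_isGl.commute_normalized_of_column ?_ ?_ a c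
  · change Commute _ (t 2 0 * sInv (t 0 0))
    have b1 := ht.bracket 0 0 1 0
    have b2 := ht.bracket 2 0 1 0
    rw [if_neg (by decide), if_pos rfl, if_neg (by decide), if_neg (by decide), sub_zero,
      zero_sub, add_zero] at b1
    rw [if_neg (by decide), if_neg (by decide), if_pos (by decide), if_neg (by decide), sub_zero,
      sub_zero, zero_add] at b2
    change _ = t 3 0 at b2
    rw [ht.entry_three_zero] at b2
    set g : A⟦X⟧ := PowerSeries.C (PowerSeries.coeff 1 (t 1 0))
    have h1 := mul_sInv hp
    have h2 := sInv_mul hp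
    rw [Commute, SemiconjBy]
    have e : (g * (t 2 0 * sInv (t 0 0))) * t 0 0 = (t 2 0 * sInv (t 0 0) * g) * t 0 0 := by
      linear_combination (norm := noncomm_ring) g * t 2 0 * h2 - b2 -
        t 2 0 * h2 * g + (t 2 0 * sInv (t 0 0)) * b1
    have := congrArg (· * sInv (t 0 0)) e
    simpa only [mul_assoc, h1, mul_one] using this
  · change Commute _ (PowerSeries.C (PowerSeries.coeff 1 (t 0 2)))
    have b := ht.bracket 0 2 1 0
    rw [if_neg (by decide), if_pos rfl, if_neg (by decide), if_neg (by decide), sub_zero,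
      zero_sub, add_zero] at b
    have b' := congrArg (PowerSeries.coeff 1) b
    rw [map_neg, show PowerSeries.coeff 1 (t 1 2) = 0 from ht.coeff_one_antidiagonal 1, neg_zero,
      map_sub, PowerSeries.coeff_mul_C, PowerSeries.coeff_C_mul, sub_eq_zero] at b'
    exact (show Commute _ _ from b'.symm).map PowerSeries.C

lemma coeff_zero_fstFactor (ht : IsO t) : PowerSeries.coeff 0 (fstFactor t 0 0) = 1 :=
  ht.fstFactor_isGl.coeff_zero_diag 0

lemma fstFactor_mul_sndFactor (ht : IsO t) (b d : Fin 2) :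
    fstFactor t 0 0 * sndFactor t b d = sndBlock t b d := by
  rw [sndFactor, ← mul_assoc, mul_sInv ht.coeff_zero_fstFactor, one_mul]

lemma sndFactor_eq (ht : IsO t) {b d : Fin 2} {F : A⟦X⟧}
    (h : fstFactor t 0 0 * F = sndBlock t b d) : sndFactor t b d = F := by
  rw [sndFactor, ← h, ← mul_assoc, sInv_mul ht.coeff_zero_fstFactor, one_mul]

/-- Both blocks contain t_00 = d F_00 as their corner entry, with d central for the first block. -/
lemma sndFactor_zero_zero (ht : IsO t) : sndFactor t 0 0 = rootQdet (fstBlock t) := by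
  apply ht.sndFactor_eq
  have h : Commute (rootQdet (fstBlock t)) (fstFactor t 0 0) :=
    (((ht.fstBlock_isGl.coeffComm_rootQdet_self.sInv_right (coeff_zero_rootQdet _)).mul_right
      (ht.fstBlock_isGl.coeffComm_rootQdet 0 0))).commute
  rw [← h.eq, fstFactor, IsGl.rootQdet_mul_normalized]
  rfl

/-- The bracket formula for F_00 S_00 = t_00 holds with F_00 as a left factor, since t_01^(1)
commutes with F_00; cancelling F_00 gives the formula for S. -/
lemma sndFactor_zero_one (ht : IsO t) : sndFactor t 0 1 =
    sndFactor t 0 0 * PowerSeries.C (PowerSeries.coeff 1 (t 0 1)) -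
      PowerSeries.C (PowerSeries.coeff 1 (t 0 1)) * sndFactor t 0 0 := by
  apply ht.sndFactor_eq
  have b1 := ht.sndBlock_isGl.bracket 0 0 0 1
  rw [if_pos rfl, if_neg (by decide), sub_zero, ← ht.fstFactor_mul_sndFactor 0 0] at b1
  have hg := (ht.commute_zero_one_fstFactor 0 0).eq
  change _ * PowerSeries.C (PowerSeries.coeff 1 (t 0 1)) -
    PowerSeries.C (PowerSeries.coeff 1 (t 0 1)) * _ = _ at b1
  linear_combination (norm := noncomm_ring) b1 + hg * sndFactor t 0 0

lemma sndFactor_one_zero (ht : IsO t) : sndFactor t 1 0 =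
    PowerSeries.C (PowerSeries.coeff 1 (t 1 0)) * sndFactor t 0 0 -
      sndFactor t 0 0 * PowerSeries.C (PowerSeries.coeff 1 (t 1 0)) := by
  apply ht.sndFactor_eq
  have b1 := ht.sndBlock_isGl.bracket 0 0 1 0
  rw [if_neg (by decide), if_pos rfl, zero_sub, ← ht.fstFactor_mul_sndFactor 0 0] at b1
  have hg := (ht.commute_one_zero_fstFactor 0 0).eq
  change _ * PowerSeries.C (PowerSeries.coeff 1 (t 1 0)) -
    PowerSeries.C (PowerSeries.coeff 1 (t 1 0)) * _ = _ at b1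
  linear_combination (norm := noncomm_ring) -b1 - hg * sndFactor t 0 0

lemma sndFactor_one_one (ht : IsO t) : sndFactor t 1 1 = sndFactor t 0 0 +
    (sndFactor t 1 0 * PowerSeries.C (PowerSeries.coeff 1 (t 0 1)) -
      PowerSeries.C (PowerSeries.coeff 1 (t 0 1)) * sndFactor t 1 0) := by
  apply ht.sndFactor_eq
  have b1 := ht.sndBlock_isGl.bracket 1 0 0 1
  rw [if_pos rfl, if_pos rfl, ← ht.fstFactor_mul_sndFactor 1 0,
    ← ht.fstFactor_mul_sndFactor 0 0] at b1
  have hg := (ht.commute_zero_one_fstFactor 0 0).eq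
  change _ * PowerSeries.C (PowerSeries.coeff 1 (t 0 1)) -
    PowerSeries.C (PowerSeries.coeff 1 (t 0 1)) * _ = _ at b1
  linear_combination (norm := noncomm_ring) b1 + hg * sndFactor t 1 0

/-- S_00 = d(u) commutes with F, and the other entries of S come from S_00 by brackets with t_01^(1)
and t_10^(1), which commute with F as well. -/
lemma coeffComm_fstFactor_sndFactor (ht : IsO t) (a c b d : Fin 2) :
    CoeffComm (fstFactor t a c) (sndFactor t b d) := by
  rw [coeffComm_iff]
  intro m
  set y := PowerSeries.coeff m (fstFactor t a c) with hy
  have g1 : Commute (PowerSeries.C y) (PowerSeries.C (PowerSeries.coeff 1 (t 0 1))) :=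
    (commute_C_iff.1 (ht.commute_zero_one_fstFactor a c) m).symm.map PowerSeries.C
  have g2 : Commute (PowerSeries.C y) (PowerSeries.C (PowerSeries.coeff 1 (t 1 0))) :=
    (commute_C_iff.1 (ht.commute_one_zero_fstFactor a c) m).symm.map PowerSeries.C
  have c00 : Commute (PowerSeries.C y) (sndFactor t 0 0) := by
    rw [ht.sndFactor_zero_zero]
    exact ((ht.fstBlock_isGl.coeffComm_rootQdet_self.sInv_right (coeff_zero_rootQdet _)).mul_right
      (ht.fstBlock_isGl.coeffComm_rootQdet a c)).symm.commute_C m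
  have c01 : Commute (PowerSeries.C y) (sndFactor t 0 1) := by
    rw [ht.sndFactor_zero_one]
    exact (c00.mul_right g1).sub_right (g1.mul_right c00)
  have c10 : Commute (PowerSeries.C y) (sndFactor t 1 0) := by
    rw [ht.sndFactor_one_zero]
    exact (g2.mul_right c00).sub_right (c00.mul_right g2)
  have c11 : Commute (PowerSeries.C y) (sndFactor t 1 1) := by
    rw [ht.sndFactor_one_one]
    exact c00.add_right ((c10.mul_right g1).sub_right (g1.mul_right c10))
  fin_cases b <;> fin_cases d <;> assumption

/-- The coefficients of F_00 commute with each other and with S, hence with the second block F_00 S,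
so dividing that block by F_00 preserves the relations. -/
lemma sndFactor_isGl (ht : IsO t) : IsGl (sndFactor t) := by
  have h0 := ht.coeff_zero_fstFactor
  have h1 := ht.fstFactor_isGl.coeffComm_self 0 0
  refine ht.sndBlock_isGl.scale (coeff_zero_sInv _)
    ((h1.sInv_right h0).symm.sInv_right h0) fun b d => ?_
  rw [← ht.fstFactor_mul_sndFactor]
  exact ((h1.mul_right (ht.coeffComm_fstFactor_sndFactor 0 0 b d)).symm.sInv_right h0).symm

/-- The homomorphism from `Y(gl_2) ⊗ Y(gl_2)` given by the factors of an orthogonal matrix. -/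
def factorHom (ht : IsO t) : YGl 2 ⊗[ℂ] YGl 2 →ₐ[ℂ] A :=
  Algebra.TensorProduct.lift
    (YGl.lift (fstFactor t) ht.fstFactor_isGl.coeff_zero ht.fstFactor_isGl.rel)
    (YGl.lift (sndFactor t) ht.sndFactor_isGl.coeff_zero ht.sndFactor_isGl.rel)
    (YGl.commute_of_coeffComm fun i j k l => by
      rw [YGl.map_lift, YGl.map_lift]
      exact ht.coeffComm_fstFactor_sndFactor i j k l)

lemma map_factorHom_left (ht : IsO t) (a c : Fin 2) :
    PowerSeries.map ht.factorHom.toRingHom (PowerSeries.map (Algebra.TensorProduct.includeLeft :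
      YGl 2 →ₐ[ℂ] YGl 2 ⊗[ℂ] YGl 2).toRingHom (YGl.T a c)) = fstFactor t a c := by
  rw [← YGl.map_lift (fstFactor t) ht.fstFactor_isGl.coeff_zero ht.fstFactor_isGl.rel a c]
  ext n
  simp only [PowerSeries.coeff_map]
  exact Algebra.TensorProduct.lift_tmul _ _ _ _ _ |>.trans (by rw [map_one, mul_one]; rfl)

lemma map_factorHom_right (ht : IsO t) (b d : Fin 2) :
    PowerSeries.map ht.factorHom.toRingHom (PowerSeries.map (Algebra.TensorProduct.includeRight :
      YGl 2 →ₐ[ℂ] YGl 2 ⊗[ℂ] YGl 2).toRingHom (YGl.T b d)) = sndFactor t b d := by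
  rw [← YGl.map_lift (sndFactor t) ht.sndFactor_isGl.coeff_zero ht.sndFactor_isGl.rel b d]
  ext n
  simp only [PowerSeries.coeff_map]
  exact Algebra.TensorProduct.lift_tmul _ _ _ _ _ |>.trans (by rw [map_one, one_mul]; rfl)

lemma fstFactor_mul_sndFactor_zero (ht : IsO t) (a c : Fin 2) :
    fstFactor t a c * sndFactor t 0 0 = fstBlock t a c := by
  rw [(ht.coeffComm_fstFactor_sndFactor a c 0 0).commute.eq, ht.sndFactor_zero_zero]
  exact IsGl.rootQdet_mul_normalized a c

/-- An orthogonal matrix is determined by its blocks. -/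
lemma ext_of_blocks (ht : IsO t) (ht' : IsO t') (h1 : fstBlock t = fstBlock t')
    (h2 : sndBlock t = sndBlock t') : t = t' := by
  have key : ∀ n i j, PowerSeries.coeff n (t i j - t' i j) = 0 := by
    intro n
    induction n using Nat.strong_induction_on with
    | _ n ih =>
      -- In the first degree n where the matrices may differ, the quadratic relations at v = u - 1
      -- become linear in the difference d of the coefficients.
      set d : Fin 4 → Fin 4 → A := fun i j => PowerSeries.coeff n (t i j - t' i j) with hd
      have hs : ∀ k l, ∀ m < n, PowerSeries.coeff m (shiftHom A (t k l - t' k l)) = 0 := by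
        intro k l m hm
        rw [coeff_shiftHom_of_coeff_lt fun r hr => ih r (hr.trans hm) k l]
        exact ih m hm k l
      have hn : ∀ k l, PowerSeries.coeff n (shiftHom A (t k l - t' k l)) = d k l :=
        fun k l => coeff_shiftHom_of_coeff_lt fun m hm => ih m hm k l
      have hd' : ∀ k l, PowerSeries.coeff n (t k l - t' k l) = d k l := fun k l => rfl
      have e1 : ∀ i j k l, PowerSeries.coeff n (t i j * shiftHom A (t k l)) =
          PowerSeries.coeff n (t' i j * shiftHom A (t' k l)) +
            ((if k = l then d i j else 0) + (if i = j then d k l else 0)) := by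
        intro i j k l
        have : t i j * shiftHom A (t k l) = t' i j * shiftHom A (t' k l) +
            ((t i j - t' i j) * shiftHom A (t k l) +
              t' i j * shiftHom A (t k l - t' k l)) := by
          rw [map_sub]; noncomm_ring
        rw [this, map_add, map_add, coeff_mul_of_coeff_lt fun m hm => ih m hm i j,
          coeff_mul_of_coeff_lt' (hs k l), hn, hd', coeff_zero_shiftHom, ht.coeff_zero,
          ht'.coeff_zero]
        simp
      have e2 : ∀ i j k l, PowerSeries.coeff n (shiftHom A (t k l) * t i j) =
          PowerSeries.coeff n (shiftHom A (t' k l) * t' i j) +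
            ((if k = l then d i j else 0) + (if i = j then d k l else 0)) := by
        intro i j k l
        have : shiftHom A (t k l) * t i j = shiftHom A (t' k l) * t' i j +
            (shiftHom A (t k l) * (t i j - t' i j) +
              shiftHom A (t k l - t' k l) * t' i j) := by
          rw [map_sub]; noncomm_ring
        rw [this, map_add, map_add, coeff_mul_of_coeff_lt' fun m hm => ih m hm i j,
          coeff_mul_of_coeff_lt (hs k l), hn, hd', coeff_zero_shiftHom, ht.coeff_zero,
          ht'.coeff_zero]
        simp
      -- So d is an infinitesimal similitude of the form: skew-symmetric up to a scalar matrix.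
      have e3 : ∀ i j l, (d l.rev j + d j.rev l) =
          if l = j.rev then d i i + d i.rev i.rev else 0 := by
        intro i j l
        have s := congrArg (PowerSeries.coeff n) (ht.spec i j i.rev l)
        have s' := congrArg (PowerSeries.coeff n) (ht'.spec i j i.rev l)
        rw [if_pos rfl, map_sum] at s s'
        simp only [e1, Finset.sum_add_distrib, Fin.rev_eq_iff, Finset.sum_ite_eq',
          Finset.mem_univ, if_true] at s
        rw [s'] at s
        split_ifs at s ⊢ with hl
        · simp only [map_sum, e2, Finset.sum_add_distrib, Fin.rev_inj, Finset.sum_ite_eq,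
            Finset.mem_univ, if_true] at s
          exact add_left_cancel s
        · simpa using s
      have k00 : d 0 0 = 0 := by
        have := congrFun (congrFun h1 0) 0
        rw [hd]; exact (congrArg _ (sub_eq_zero.2 this)).trans (map_zero _)
      have k02 : d 0 2 = 0 := by
        have := congrFun (congrFun h1 0) 1
        rw [hd]; exact (congrArg _ (sub_eq_zero.2 this)).trans (map_zero _)
      have k20 : d 2 0 = 0 := by
        have := congrFun (congrFun h1 1) 0
        rw [hd]; exact (congrArg _ (sub_eq_zero.2 this)).trans (map_zero _)
      have k22 : d 2 2 = 0 := by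
        have := congrFun (congrFun h1 1) 1
        rw [hd]; exact (congrArg _ (sub_eq_zero.2 this)).trans (map_zero _)
      have k01 : d 0 1 = 0 := by
        have := congrFun (congrFun h2 0) 1
        rw [hd]; exact (congrArg _ (sub_eq_zero.2 this)).trans (map_zero _)
      have k10 : d 1 0 = 0 := by
        have := congrFun (congrFun h2 1) 0
        rw [hd]; exact (congrArg _ (sub_eq_zero.2 this)).trans (map_zero _)
      have k11 : d 1 1 = 0 := by
        have := congrFun (congrFun h2 1) 1
        rw [hd]; exact (congrArg _ (sub_eq_zero.2 this)).trans (map_zero _)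
      -- The blocks kill seven entries; skewness kills the antidiagonal and the remaining
      -- off-diagonal entries, and the common value of d_ii + d_{-i,-i} kills d_33.
      have k33 : d 0 0 + d 3 3 = d 1 1 + d 2 2 := e3 1 0 3
      have k13 : d 1 3 + d 0 2 = 0 := e3 0 3 2
      have k23 : d 2 3 + d 0 1 = 0 := e3 0 3 1
      have k31 : d 3 1 + d 2 0 = 0 := e3 0 1 0
      have k32 : d 3 2 + d 1 0 = 0 := e3 0 2 0
      have k03 : d 0 3 = 0 := eq_zero_of_two_mul (e3 0 3 3)
      have k30 : d 3 0 = 0 := eq_zero_of_two_mul (e3 0 0 0)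
      have k12 : d 1 2 = 0 := eq_zero_of_two_mul (e3 0 2 2)
      have k21 : d 2 1 = 0 := eq_zero_of_two_mul (e3 0 1 1)
      rw [k00, k11, k22, add_zero, zero_add] at k33
      rw [k02, add_zero] at k13
      rw [k01, add_zero] at k23
      rw [k20, add_zero] at k31
      rw [k10, add_zero] at k32
      intro i j
      change d i j = 0
      fin_cases i <;> fin_cases j <;> assumption
  ext i j n
  have := key n i j
  rwa [map_sub, sub_eq_zero] at this

end IsO

end Factors

/-! ### The Kronecker product of commuting `gl_2` matrices is orthogonal -/

section Kronecker

variable {A B : Type*} [Ring A] [Algebra ℂ A] [Ring B] [Algebra ℂ B]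

/-- The matrix `T₁(u) T'₂(u)` over `ℂ² ⊗ ℂ² = ℂ⁴`. -/
def kron (T T' : Fin 2 → Fin 2 → A⟦X⟧) (i j : Fin 4) : A⟦X⟧ :=
  let p := (finProdFinEquiv (m := 2) (n := 2)).symm i
  let q := (finProdFinEquiv (m := 2) (n := 2)).symm j
  (sgn p.1 p.2 * sgn q.1 q.2) • (T p.1 q.1 * T' p.2 q.2)

lemma kron_idx (T T' : Fin 2 → Fin 2 → A⟦X⟧) (a b c d : Fin 2) :
    kron T T' (idx a b) (idx c d) = (sgn a b * sgn c d) • (T a c * T' b d) := by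
  simp only [kron, idx, Equiv.symm_apply_apply]

lemma exists_eq_idx (i : Fin 4) : ∃ a b, i = idx a b := by
  revert i; decide

lemma idx_eq_rev_iff (a b a' b' : Fin 2) :
    idx a' b' = (idx a b).rev ↔ a' = 1 - a ∧ b' = 1 - b := by
  revert a b a' b'; decide

lemma sgn_zero_zero : sgn 0 0 = 1 := by simp [sgn]

lemma sgn_zero_one : sgn 0 1 = 1 := by simp [sgn]

lemma sgn_one_zero : sgn 1 0 = 1 := by simp [sgn]

lemma sgn_one_one : sgn 1 1 = -1 := by simp [sgn]

lemma inU_smul (c : ℂ) (F : A⟦X⟧) : inU (c • F) = const₂ A c * inU F := by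
  rw [const₂_eq_inU, ← inU_mul]
  congr 1
  ext n
  rw [PowerSeries.coeff_C_mul, PowerSeries.coeff_smul, Algebra.smul_def]

lemma inV_smul (c : ℂ) (F : A⟦X⟧) : inV (c • F) = const₂ A c * inV F := by
  rw [const₂, ← inV, ← inV_mul]
  congr 1
  ext n
  rw [PowerSeries.coeff_C_mul, PowerSeries.coeff_smul, Algebra.smul_def]

lemma const₂_mul (c d : ℂ) : const₂ A (c * d) = const₂ A c * const₂ A d := by
  simp [const₂]

lemma const₂_neg (c : ℂ) : const₂ A (-c) = -const₂ A c := by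
  simp [const₂]

lemma inU_smul_mul_inV_smul (c d : ℂ) (F G : A⟦X⟧) :
    inU (c • F) * inV (d • G) = const₂ A (c * d) * (inU F * inV G) := by
  rw [inU_smul, inV_smul, const₂_mul, mul_assoc, ← mul_assoc (inU F),
    ← (commute_const₂ d (inU F)).eq]
  simp only [mul_assoc]

lemma inV_smul_mul_inU_smul (c d : ℂ) (F G : A⟦X⟧) :
    inV (c • F) * inU (d • G) = const₂ A (c * d) * (inV F * inU G) := by
  rw [inU_smul, inV_smul, const₂_mul, mul_assoc, ← mul_assoc (inV F),
    ← (commute_const₂ d (inV F)).eq]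
  simp only [mul_assoc]

section RMatrix

variable {R : Type*} [Ring R] {K : Type*} [CommRing K] [Algebra K R]

/-- The product of the relations of two commuting copies of `Y(gl_2)`, in the form of the relation
of `X(o_4)`. -/
lemma orthogonal_of_gl (L y : K) (X X' PX XP Y Y' PY YP : R)
    (h1 : L • (X - X') = y • (PX - XP)) (h2 : L • (Y - Y') = y • (PY - YP)) :
    L • (L - y) • (X * Y - X' * Y') = y • (L - y) • (PX * PY - XP * YP) -
      y • L • ((X - PX) * (Y - PY) - (X' - XP) * (Y' - YP)) := by
  -- The hypotheses read LX - yPX = LX' - yXP and LY - yPY = LY' - yYP. This is their product, whose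
  -- mixed terms are absorbed by the products of differences.
  linear_combination (norm := skip) h1 * (L • Y - y • PY) + (L • X' - y • XP) * h2
  simp only [mul_sub, sub_mul, smul_mul_assoc, mul_smul_comm, smul_sub]
  module

end RMatrix

namespace IsGl

variable {T T' : Fin 2 → Fin 2 → A⟦X⟧}

lemma kron_inU_inV (h : ∀ i j k l, CoeffComm (T i j) (T' k l)) (a b c d a' b' c' d' : Fin 2) :
    inU (kron T T' (idx a b) (idx c d)) * inV (kron T T' (idx a' b') (idx c' d')) =
      const₂ A (sgn a b * sgn c d * (sgn a' b' * sgn c' d')) *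
        (inU (T a c) * inV (T a' c') * (inU (T' b d) * inV (T' b' d'))) := by
  rw [kron_idx, kron_idx, inU_smul_mul_inV_smul, inU_mul, inV_mul, mul_assoc (inU (T a c)),
    ← mul_assoc (inU (T' b d)), (h a' c' b d).symm.commute_inU_inV.eq]
  simp only [mul_assoc]

lemma kron_inV_inU (h : ∀ i j k l, CoeffComm (T i j) (T' k l)) (a b c d a' b' c' d' : Fin 2) :
    inV (kron T T' (idx a b) (idx c d)) * inU (kron T T' (idx a' b') (idx c' d')) =
      const₂ A (sgn a b * sgn c d * (sgn a' b' * sgn c' d')) *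
        (inV (T a c) * inU (T a' c') * (inV (T' b d) * inU (T' b' d'))) := by
  rw [kron_idx, kron_idx, inV_smul_mul_inU_smul, inU_mul, inV_mul, mul_assoc (inV (T a c)),
    ← mul_assoc (inV (T' b d)), ← (h a' c' b d).commute_inU_inV.eq]
  simp only [mul_assoc]

/-- The transposed permutation operator of `o_4` is the product of the antisymmetrizers 1 - P on the
two factors ℂ². The sign in v_2 = -e_2 ⊗ e_2 is what makes this hold. -/
lemma kron_rows (h : ∀ i j k l, CoeffComm (T i j) (T' k l)) (a b c d a' b' c' d' : Fin 2) :
    (if idx a' b' = (idx a b).rev then ∑ p : Fin 4, inU (kron T T' p (idx c d)) *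
      inV (kron T T' p.rev (idx c' d')) else 0) =
      const₂ A (sgn a b * sgn c d * (sgn a' b' * sgn c' d')) *
        ((inU (T a c) * inV (T a' c') - inU (T a' c) * inV (T a c')) *
          (inU (T' b d) * inV (T' b' d') - inU (T' b' d) * inV (T' b d'))) := by
  have e : ∑ p : Fin 4, inU (kron T T' p (idx c d)) * inV (kron T T' p.rev (idx c' d')) =
      const₂ A (sgn c d * sgn c' d') *
      -((inU (T 0 c) * inV (T 1 c') - inU (T 1 c) * inV (T 0 c')) *
        (inU (T' 0 d) * inV (T' 1 d') - inU (T' 1 d) * inV (T' 0 d'))) := by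
    rw [Fin.sum_univ_four]
    change inU (kron T T' (idx 0 0) _) * inV (kron T T' (idx 1 1) _) +
      inU (kron T T' (idx 0 1) _) * inV (kron T T' (idx 1 0) _) +
      inU (kron T T' (idx 1 0) _) * inV (kron T T' (idx 0 1) _) +
      inU (kron T T' (idx 1 1) _) * inV (kron T T' (idx 0 0) _) = _
    simp only [kron_inU_inV h, sgn_zero_zero, sgn_zero_one, sgn_one_zero, sgn_one_one]
    generalize sgn c d = σ
    generalize sgn c' d' = σ'
    simp only [one_mul, neg_mul, mul_neg, const₂_neg]
    noncomm_ring
  simp only [e, idx_eq_rev_iff]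
  generalize sgn c d = σ
  generalize sgn c' d' = σ'
  fin_cases a <;> fin_cases b <;> fin_cases a' <;> fin_cases b' <;>
    simp [sgn_zero_zero, sgn_zero_one, sgn_one_zero, sgn_one_one, const₂_neg] <;> noncomm_ring

lemma kron_columns (h : ∀ i j k l, CoeffComm (T i j) (T' k l)) (a b c d a' b' c' d' : Fin 2) :
    (if idx c' d' = (idx c d).rev then ∑ p : Fin 4, inV (kron T T' (idx a' b') p.rev) *
      inU (kron T T' (idx a b) p) else 0) =
      const₂ A (sgn a b * sgn c d * (sgn a' b' * sgn c' d')) *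
        ((inV (T a' c') * inU (T a c) - inV (T a' c) * inU (T a c')) *
          (inV (T' b' d') * inU (T' b d) - inV (T' b' d) * inU (T' b d'))) := by
  have e : ∑ p : Fin 4, inV (kron T T' (idx a' b') p.rev) * inU (kron T T' (idx a b) p) =
      const₂ A (sgn a b * sgn a' b') *
      -((inV (T a' 1) * inU (T a 0) - inV (T a' 0) * inU (T a 1)) *
        (inV (T' b' 1) * inU (T' b 0) - inV (T' b' 0) * inU (T' b 1))) := by
    rw [Fin.sum_univ_four]
    change inV (kron T T' _ (idx 1 1)) * inU (kron T T' _ (idx 0 0)) +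
      inV (kron T T' _ (idx 1 0)) * inU (kron T T' _ (idx 0 1)) +
      inV (kron T T' _ (idx 0 1)) * inU (kron T T' _ (idx 1 0)) +
      inV (kron T T' _ (idx 0 0)) * inU (kron T T' _ (idx 1 1)) = _
    simp only [kron_inV_inU h, sgn_zero_zero, sgn_zero_one, sgn_one_zero, sgn_one_one]
    generalize sgn a b = σ
    rw [mul_comm σ (sgn a' b')]
    generalize sgn a' b' = σ'
    simp only [mul_one, neg_mul, mul_neg, const₂_neg]
    noncomm_ring
  simp only [e, idx_eq_rev_iff]
  generalize sgn a b = σ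
  generalize sgn a' b' = σ'
  fin_cases c <;> fin_cases d <;> fin_cases c' <;> fin_cases d' <;>
    simp [sgn_zero_zero, sgn_zero_one, sgn_one_zero, sgn_one_one, const₂_neg] <;> noncomm_ring

lemma isO_kron (hT : IsGl T) (hT' : IsGl T') (h : ∀ i j k l, CoeffComm (T i j) (T' k l)) :
    IsO (kron T T') where
  coeff_zero i j := by
    obtain ⟨a, b, rfl⟩ := exists_eq_idx i
    obtain ⟨c, d, rfl⟩ := exists_eq_idx j
    rw [kron_idx, PowerSeries.coeff_smul, PowerSeries.coeff_mul]
    simp only [Finset.Nat.antidiagonal_zero, Finset.sum_singleton, hT.coeff_zero, hT'.coeff_zero]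
    fin_cases a <;> fin_cases b <;> fin_cases c <;> fin_cases d <;>
      simp [sgn_zero_zero, sgn_zero_one, sgn_one_zero, sgn_one_one, idx]
  rel i j k l := by
    obtain ⟨a, b, rfl⟩ := exists_eq_idx i
    obtain ⟨c, d, rfl⟩ := exists_eq_idx j
    obtain ⟨a', b', rfl⟩ := exists_eq_idx k
    obtain ⟨c', d', rfl⟩ := exists_eq_idx l
    let x : Subring.center A⟦X⟧⟦X⟧ :=
      ⟨linFactor A 0, Subring.mem_center_iff.2 fun G => (commute_linFactor 0 G).eq.symm⟩
    let y : Subring.center A⟦X⟧⟦X⟧ := ⟨uInv A * vInv A, Subring.mem_center_iff.2 fun G =>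
      ((commute_uInv G).mul_left (commute_vInv G)).eq.symm⟩
    have key := orthogonal_of_gl x y _ _ _ _ _ _ _ _ (hT.rel a c a' c') (hT'.rel b d b' d')
    change linFactor A 0 * ((linFactor A 0 - uInv A * vInv A) * _) = uInv A * vInv A *
      ((linFactor A 0 - uInv A * vInv A) * _) - uInv A * vInv A * (linFactor A 0 * _) at key
    rw [linFactor_zero_sub] at key
    rw [oLHS, oRHS, kron_rows h, kron_columns h]
    simp only [kron_inU_inV h, kron_inV_inU h, kappa_four]
    set S := const₂ A (sgn a b * sgn c d * (sgn a' b' * sgn c' d')) with hS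
    -- All products in the relation carry the same four signs in some order, so a single central
    -- constant factors out.
    rw [show sgn a' b' * sgn c' d' * (sgn a b * sgn c d) =
        sgn a b * sgn c d * (sgn a' b' * sgn c' d') by ring,
      show sgn a' b' * sgn c d * (sgn a b * sgn c' d') =
        sgn a b * sgn c d * (sgn a' b' * sgn c' d') by ring, ← hS]
    simp only [← mul_sub]
    have hSc : ∀ G H, G * (S * H) = S * (G * H) := fun G H => by
      rw [← mul_assoc, ← (commute_const₂ _ G).eq, mul_assoc]
    rw [hSc, hSc, hSc, ← mul_sub]
    congr 1
    linear_combination (norm := noncomm_ring) key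

end IsGl

end Kronecker

/-! ### The homomorphism ψ and its left inverse ρ -/

section Psi

/-- The series of the first copy of `Y(gl_2)`. -/
def leftT (a c : Fin 2) : (YGl 2 ⊗[ℂ] YGl 2)⟦X⟧ :=
  PowerSeries.map (Algebra.TensorProduct.includeLeft :
    YGl 2 →ₐ[ℂ] YGl 2 ⊗[ℂ] YGl 2).toRingHom (YGl.T a c)

/-- The series of the second copy of `Y(gl_2)`. -/
def rightT (b d : Fin 2) : (YGl 2 ⊗[ℂ] YGl 2)⟦X⟧ :=
  PowerSeries.map (Algebra.TensorProduct.includeRight :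
    YGl 2 →ₐ[ℂ] YGl 2 ⊗[ℂ] YGl 2).toRingHom (YGl.T b d)

lemma coeffComm_leftT_rightT (a c b d : Fin 2) : CoeffComm (leftT a c) (rightT b d) := by
  intro m n
  simp only [leftT, rightT, PowerSeries.coeff_map]
  change _ ⊗ₜ _ * _ ⊗ₜ _ = _ ⊗ₜ _ * _ ⊗ₜ _
  simp

lemma isO_kron_leftT_rightT : IsO (kron leftT rightT) :=
  (YGl.isGl_T.map _).isO_kron (YGl.isGl_T.map _) coeffComm_leftT_rightT

/-- The homomorphism `X(o_4) → Y(gl_2) ⊗ Y(gl_2)`. -/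
def psi : XO 4 →ₐ[ℂ] YGl 2 ⊗[ℂ] YGl 2 :=
  XO.lift (kron leftT rightT) isO_kron_leftT_rightT.coeff_zero isO_kron_leftT_rightT.rel

lemma map_psi (i j : Fin 4) : PowerSeries.map psi.toRingHom (XO.t i j) = kron leftT rightT i j :=
  XO.map_lift _ isO_kron_leftT_rightT.coeff_zero isO_kron_leftT_rightT.rel i j

lemma isPsi_psi : IsPsi psi := fun a b c d => by
  rw [map_psi, kron_idx]
  rfl

/-- The homomorphism `Y(gl_2) ⊗ Y(gl_2) → X(o_4)` given by the factors of `t(u)`. -/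
def rho : YGl 2 ⊗[ℂ] YGl 2 →ₐ[ℂ] XO 4 := XO.isO_t.factorHom

lemma map_rho_leftT (a c : Fin 2) :
    PowerSeries.map rho.toRingHom (leftT a c) = fstFactor XO.t a c :=
  XO.isO_t.map_factorHom_left a c

lemma map_rho_rightT (b d : Fin 2) :
    PowerSeries.map rho.toRingHom (rightT b d) = sndFactor XO.t b d :=
  XO.isO_t.map_factorHom_right b d

lemma map_comp {A B C : Type*} [Ring A] [Algebra ℂ A] [Ring B] [Algebra ℂ B] [Ring C]
    [Algebra ℂ C] (φ : B →ₐ[ℂ] C) (χ : A →ₐ[ℂ] B) (F : A⟦X⟧) :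
    PowerSeries.map (φ.comp χ).toRingHom F =
      PowerSeries.map φ.toRingHom (PowerSeries.map χ.toRingHom F) := by
  ext n
  simp only [PowerSeries.coeff_map]
  rfl

lemma map_id {A : Type*} [Ring A] [Algebra ℂ A] (F : A⟦X⟧) :
    PowerSeries.map (AlgHom.id ℂ A).toRingHom F = F := by
  ext n
  simp only [PowerSeries.coeff_map]
  rfl

/-- The image of t(u) under ρψ is orthogonal, with blocks F S_00 and F_00 S; these are the blocks of
t(u), and the blocks determine the matrix. -/
lemma rho_comp_psi : rho.comp psi = AlgHom.id ℂ (XO 4) := by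
  have hO : IsO fun i j => PowerSeries.map (rho.comp psi).toRingHom (XO.t i j) :=
    XO.isO_t.map (rho.comp psi)
  have e : ∀ i j, PowerSeries.map (rho.comp psi).toRingHom (XO.t i j) =
      PowerSeries.map rho.toRingHom (kron leftT rightT i j) := fun i j => by
    rw [map_comp, map_psi]
  have key := hO.ext_of_blocks XO.isO_t
    (by
      funext a c
      rw [fstBlock, e, kron_idx, ← XO.isO_t.fstFactor_mul_sndFactor_zero, ← map_rho_leftT,
        ← map_rho_rightT, ← map_mul]
      simp [sgn])
    (by
      funext b d
      rw [sndBlock, e, kron_idx, ← XO.isO_t.fstFactor_mul_sndFactor, ← map_rho_leftT,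
        ← map_rho_rightT, ← map_mul]
      simp [sgn])
  refine XO.hom_ext fun i j => ?_
  rw [map_id]
  exact congrFun (congrFun key i) j

end Psi

/-! ### Normalization under homomorphisms and scalings -/

section NormalizedScale

variable {A B : Type*} [Ring A] [Algebra ℂ A] [Ring B] [Algebra ℂ B]

lemma map_rootQdet {T : Fin 2 → Fin 2 → A⟦X⟧} (hT : IsGl T) (φ : A →ₐ[ℂ] B) :
    PowerSeries.map φ.toRingHom (rootQdet T) =
      rootQdet fun i j => PowerSeries.map φ.toRingHom (T i j) := by
  rw [rootQdet, map_shiftRoot φ hT.coeff_zero_qdet]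
  simp only [qdetOf, shiftHom_apply, map_sub, map_mul, map_shiftOne, rootQdet]

lemma map_normalized {T : Fin 2 → Fin 2 → A⟦X⟧} (hT : IsGl T) (φ : A →ₐ[ℂ] B) (i j : Fin 2) :
    PowerSeries.map φ.toRingHom (normalized T i j) =
      normalized (fun i j => PowerSeries.map φ.toRingHom (T i j)) i j := by
  rw [normalized, map_mul, map_sInv φ (coeff_zero_rootQdet T), map_rootQdet hT, normalized]

lemma shiftRoot_one : shiftRoot (1 : A⟦X⟧) = 1 := by
  refine (shiftRoot_unique _ _ (by simp) ?_).symm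
  rw [← shiftHom_apply, map_one, one_mul]

lemma normalized_eq_self {T : Fin 2 → Fin 2 → A⟦X⟧} (h : qdetOf T = 1) : normalized T = T := by
  funext i j
  have h1 : PowerSeries.coeff 0 (1 : A⟦X⟧) = 1 := by simp
  rw [normalized, rootQdet, h, shiftRoot_one, ← one_mul (sInv 1), mul_sInv h1, one_mul]

/-- By uniqueness of the shift root, multiplying T by z multiplies d by z, and the factor cancels.
-/
lemma normalized_scale {T : Fin 2 → Fin 2 → A⟦X⟧} (hT : IsGl T) {z : A⟦X⟧}
    (h0 : PowerSeries.coeff 0 z = 1) (h : ∀ i j, CoeffComm z (T i j)) :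
    normalized (fun i j => z * T i j) = normalized T := by
  have hd : CoeffComm z (rootQdet T) := CoeffComm.rootQdet_right h
  have h1 := coeff_zero_rootQdet T
  have e : rootQdet (fun i j => z * T i j) = z * rootQdet T := by
    refine (shiftRoot_unique _ _ ?_ ?_).symm
    · rw [coeff_zero_mul_of_eq_one h0, h1]
    · rw [← shiftHom_apply, map_mul, IsGl.qdetOf_scale h, mul_assoc, ← mul_assoc (rootQdet T),
        hd.symm.shiftHom_right.commute.eq, mul_assoc, hT.rootQdet_mul, mul_assoc]
  have e2 : sInv (z * rootQdet T) = sInv (rootQdet T) * sInv z := by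
    refine sInv_eq_of_mul_eq_one ?_ ?_
    · rw [coeff_zero_mul_of_eq_one h0, h1]
    · rw [mul_assoc, ← mul_assoc (rootQdet T), mul_sInv h1, one_mul, mul_sInv h0]
  funext i j
  rw [normalized, e, e2, mul_assoc, ← mul_assoc (sInv z), sInv_mul h0, one_mul, normalized]

lemma coeffComm_scalarSeries (f : ℂ⟦X⟧) (F : A⟦X⟧) : CoeffComm (scalarSeries A f) F := by
  intro m n
  rw [scalarSeries, PowerSeries.coeff_map]
  exact Algebra.commutes _ _

lemma coeff_zero_scalarSeries {f : ℂ⟦X⟧} (hf : PowerSeries.constantCoeff f = 1) :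
    PowerSeries.coeff 0 (scalarSeries A f) = 1 := by
  rw [scalarSeries, PowerSeries.coeff_map, PowerSeries.coeff_zero_eq_constantCoeff_apply, hf,
    map_one]

lemma map_scalarSeries (φ : A →ₐ[ℂ] B) (f : ℂ⟦X⟧) :
    PowerSeries.map φ.toRingHom (scalarSeries A f) = scalarSeries B f := by
  ext n
  simp [scalarSeries]

end NormalizedScale

/-! ### The projection π and its triviality on Y(sl_2) -/

section Projection

lemma calT_eq (i j : Fin 2) : calT i j = normalized YGl.T i j := rfl

lemma YGl.map_scale {N : ℕ} (g : ℂ⟦X⟧) (hg : PowerSeries.constantCoeff g = 1) (i j : Fin N) :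
    PowerSeries.map (YGl.scale N g hg).toRingHom (YGl.T i j) =
      scalarSeries (YGl N) g * YGl.T i j :=
  YGl.map_lift _ _ _ i j

lemma XO.map_scale {N : ℕ} (g : ℂ⟦X⟧) (hg : PowerSeries.constantCoeff g = 1) (i j : Fin N) :
    PowerSeries.map (XO.scale N g hg).toRingHom (XO.t i j) =
      scalarSeries (XO N) g * XO.t i j :=
  XO.map_lift _ _ _ i j

lemma map_scale_calT (g : ℂ⟦X⟧) (hg : PowerSeries.constantCoeff g = 1) (i j : Fin 2) :
    PowerSeries.map (YGl.scale 2 g hg).toRingHom (calT i j) = calT i j := by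
  rw [calT_eq, map_normalized YGl.isGl_T]
  simp only [YGl.map_scale]
  rw [normalized_scale YGl.isGl_T (coeff_zero_scalarSeries hg)
    fun i j => coeffComm_scalarSeries _ _]

/-- The endomorphism `T_{ij}(u) ↦ 𝒯_{ij}(u)` of `Y(gl_2)`. -/
def projGl : YGl 2 →ₐ[ℂ] YGl 2 :=
  YGl.lift calT YGl.isGl_T.normalized.coeff_zero YGl.isGl_T.normalized.rel

lemma map_projGl (i j : Fin 2) : PowerSeries.map projGl.toRingHom (YGl.T i j) = calT i j :=
  YGl.map_lift _ _ _ i j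

lemma mem_YSl_iff {N : ℕ} {x : YGl N} :
    x ∈ YSl N ↔ ∀ g hg, YGl.scale N g hg x = x := by
  simp only [YSl, Algebra.mem_iInf, AlgHom.mem_equalizer, Subtype.forall, AlgHom.coe_id, id]

lemma mem_YO_iff {N : ℕ} {x : XO N} :
    x ∈ YO N ↔ ∀ g hg, XO.scale N g hg x = x := by
  simp only [YO, Algebra.mem_iInf, AlgHom.mem_equalizer, Subtype.forall, AlgHom.coe_id, id]

lemma projGl_mem_YSl (x : YGl 2) : projGl x ∈ YSl 2 := by
  rw [mem_YSl_iff]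
  intro g hg
  have : (YGl.scale 2 g hg).comp projGl = projGl := YGl.hom_ext fun i j => by
    rw [map_comp, map_projGl, map_scale_calT]
  exact DFunLike.congr_fun this x

/-- The projection `Y(gl_2) → Y(sl_2)`. -/
def projSl : YGl 2 →ₐ[ℂ] YSl 2 := projGl.codRestrict (YSl 2) projGl_mem_YSl

lemma val_comp_projSl : (YSl 2).val.comp projSl = projGl := rfl

lemma isProjSl_projSl : IsProjSl projSl := fun i j => by
  rw [val_comp_projSl, map_projGl]

/-- The ring of polynomials in the coefficients of a series `1 + g₁ u⁻¹ + ⋯`, with coefficients in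
`Y(gl_2)`. -/
abbrev PolyYGl : Type := MvPolynomial ℕ ℂ ⊗[ℂ] YGl 2

/-- The series with constant term `1` and the given other coefficients. -/
def seriesOf {A : Type*} [Ring A] (c : ℕ → A) : A⟦X⟧ :=
  PowerSeries.mk fun r =>
    match r with
    | 0 => 1
    | s + 1 => c s

lemma coeff_zero_seriesOf {A : Type*} [Ring A] (c : ℕ → A) :
    PowerSeries.coeff 0 (seriesOf c) = 1 := by
  rw [seriesOf, PowerSeries.coeff_mk]

lemma coeffComm_seriesOf {A : Type*} [Ring A] [Algebra ℂ A] {c : ℕ → A} {F : A⟦X⟧}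
    (h : ∀ s n, Commute (c s) (PowerSeries.coeff n F)) : CoeffComm (seriesOf c) F := by
  rintro (_ | s) n
  · rw [coeff_zero_seriesOf]; exact Commute.one_left _
  · rw [seriesOf, PowerSeries.coeff_mk]; exact h s n

lemma map_seriesOf {A B : Type*} [Ring A] [Algebra ℂ A] [Ring B] [Algebra ℂ B] (φ : A →ₐ[ℂ] B)
    (c : ℕ → A) : PowerSeries.map φ.toRingHom (seriesOf c) = seriesOf fun s => φ (c s) := by
  ext n
  rw [PowerSeries.coeff_map]
  rcases n with _ | s
  · rw [coeff_zero_seriesOf, coeff_zero_seriesOf, map_one]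
  · simp only [seriesOf, PowerSeries.coeff_mk]; rfl

lemma seriesOf_coeff {A : Type*} [Ring A] {F : A⟦X⟧} (h : PowerSeries.coeff 0 F = 1) :
    seriesOf (fun s => PowerSeries.coeff (s + 1) F) = F := by
  ext n
  rcases n with _ | s
  · rw [coeff_zero_seriesOf, h]
  · simp only [seriesOf, PowerSeries.coeff_mk]

/-- The series `1 + g₁ u⁻¹ + ⋯` with indeterminate coefficients. -/
def polySeries : PolyYGl⟦X⟧ := seriesOf fun s => MvPolynomial.X s ⊗ₜ 1

/-- The series `T_{ij}(u)` over the polynomial ring. -/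
def polyT (i j : Fin 2) : PolyYGl⟦X⟧ := PowerSeries.map (Algebra.TensorProduct.includeRight :
    YGl 2 →ₐ[ℂ] PolyYGl).toRingHom (YGl.T i j)

lemma coeff_zero_polySeries : PowerSeries.coeff 0 polySeries = 1 := coeff_zero_seriesOf _

lemma isGl_polyT : IsGl polyT :=
  YGl.isGl_T.map (Algebra.TensorProduct.includeRight : YGl 2 →ₐ[ℂ] PolyYGl)

lemma isGl_polySeries_mul_polyT : IsGl fun i j => polySeries * polyT i j := by
  refine isGl_polyT.scale coeff_zero_polySeries ?_ ?_
  · refine coeffComm_seriesOf fun s n => ?_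
    rcases n with _ | r
    · rw [polySeries, coeff_zero_seriesOf]
      exact Commute.one_right _
    · rw [polySeries, seriesOf, PowerSeries.coeff_mk]
      exact (Commute.all (MvPolynomial.X (R := ℂ) s) (MvPolynomial.X r)).map
        (Algebra.TensorProduct.includeLeft : MvPolynomial ℕ ℂ →ₐ[ℂ] PolyYGl)
  · intro i j
    refine coeffComm_seriesOf fun s n => ?_
    rw [polyT, PowerSeries.coeff_map]
    change _ ⊗ₜ _ * _ ⊗ₜ _ = _ ⊗ₜ _ * _ ⊗ₜ _
    simp

/-- The homomorphism `T(u) ↦ g(u) T(u)` for the series `g(u)` with indeterminate coefficients. -/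
def polyScale : YGl 2 →ₐ[ℂ] PolyYGl :=
  YGl.lift (fun i j => polySeries * polyT i j) isGl_polySeries_mul_polyT.coeff_zero
    isGl_polySeries_mul_polyT.rel

/-- The evaluation of the indeterminates at central elements. -/
def polyEval (z : ℕ → Subalgebra.center ℂ (YGl 2)) : PolyYGl →ₐ[ℂ] YGl 2 :=
  Algebra.TensorProduct.lift ((Subalgebra.center ℂ (YGl 2)).val.comp (MvPolynomial.aeval z))
    (AlgHom.id ℂ (YGl 2)) fun x y =>
      (Subalgebra.mem_center_iff.1 (MvPolynomial.aeval z x).2 y).symm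

lemma polyEval_tmul (z : ℕ → Subalgebra.center ℂ (YGl 2)) (p : MvPolynomial ℕ ℂ) (x : YGl 2) :
    polyEval z (p ⊗ₜ x) = (MvPolynomial.aeval z p : YGl 2) * x :=
  Algebra.TensorProduct.lift_tmul _ _ _ _ _

lemma map_polyEval_polyScale (z : ℕ → Subalgebra.center ℂ (YGl 2)) (i j : Fin 2) :
    PowerSeries.map ((polyEval z).comp polyScale).toRingHom (YGl.T i j) =
      seriesOf (fun s => (z s : YGl 2)) * YGl.T i j := by
  rw [map_comp, polyScale, YGl.map_lift, map_mul, polySeries, map_seriesOf, polyT, ← map_comp]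
  have h1 : (polyEval z).comp Algebra.TensorProduct.includeRight = AlgHom.id ℂ (YGl 2) := by
    ext x
    simp [polyEval_tmul]
  rw [h1, map_id]
  congr 2
  funext s
  simp [polyEval_tmul]

lemma polyEval_algebraMap (c : ℕ → ℂ) (p : MvPolynomial ℕ ℂ) (x : YGl 2) :
    polyEval (fun s => algebraMap ℂ _ (c s)) (p ⊗ₜ x) = MvPolynomial.eval c p • x := by
  rw [polyEval_tmul, Algebra.smul_def]
  congr 1
  have : (MvPolynomial.aeval fun s => algebraMap ℂ (Subalgebra.center ℂ (YGl 2)) (c s)) =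
      (Algebra.ofId ℂ _).comp (MvPolynomial.aeval c) := by
    ext s
    simp
  rw [this]
  rfl

/-- In a vector space basis of Y(gl_2) the coordinates of w are polynomials vanishing at every
complex point, hence zero. -/
lemma eq_zero_of_polyEval (w : PolyYGl)
    (h : ∀ c : ℕ → ℂ, polyEval (fun s => algebraMap ℂ _ (c s)) w = 0) : w = 0 := by
  classical
  let b := Module.Basis.ofVectorSpace ℂ (YGl 2)
  have key : ∀ (c : ℕ → ℂ) (w : PolyYGl) k,
      MvPolynomial.eval c (TensorProduct.equivFinsuppOfBasisRight b w k) =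
        b.repr (polyEval (fun s => algebraMap ℂ _ (c s)) w) k := by
    intro c w k
    induction w using TensorProduct.induction_on with
    | zero => simp
    | tmul p x =>
      rw [polyEval_algebraMap, TensorProduct.equivFinsuppOfBasisRight_apply_tmul_apply]
      simp [mul_comm]
    | add x y hx hy => simp only [map_add, Finsupp.add_apply, hx, hy]
  apply (TensorProduct.equivFinsuppOfBasisRight b).injective
  ext1 k
  refine MvPolynomial.funext fun c => ?_
  rw [key, h]
  simp

/-- Invariance under all scalar scalings forces invariance under the scaling with indeterminate
coefficients. Evaluating the indeterminates at the central coefficients of d(u)⁻¹ turns that scaling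
into T(u) ↦ d(u)⁻¹ T(u). -/
lemma projGl_eq_self {x : YGl 2} (hx : x ∈ YSl 2) : projGl x = x := by
  have h1 : polyScale x = 1 ⊗ₜ x := by
    rw [← sub_eq_zero]
    refine eq_zero_of_polyEval _ fun c => ?_
    have hc : (polyEval (fun s => algebraMap ℂ _ (c s))).comp polyScale =
        YGl.scale 2 (seriesOf c) (by
          rw [← PowerSeries.coeff_zero_eq_constantCoeff_apply, coeff_zero_seriesOf]) := YGl.hom_ext fun i j => by
      rw [map_polyEval_polyScale, YGl.map_scale]
      congr 1
      exact (map_seriesOf (Algebra.ofId ℂ (YGl 2)) c).symm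
    have h2 := DFunLike.congr_fun hc x
    rw [mem_YSl_iff.1 hx, AlgHom.comp_apply] at h2
    rw [map_sub, h2, polyEval_tmul, map_one]
    simp
  have hcen : ∀ s, PowerSeries.coeff (s + 1) (sInv (rootQdet (YGl.T (N := 2)))) ∈
      Subalgebra.center ℂ (YGl 2) := by
    intro s
    rw [Subalgebra.mem_center_iff]
    intro y
    have := YGl.mem_of_coeff_mem (Subalgebra.centralizer ℂ
      {PowerSeries.coeff (s + 1) (sInv (rootQdet (YGl.T (N := 2))))}) (fun i j n => by
        rw [Subalgebra.mem_centralizer_iff]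
        rintro _ rfl
        exact YGl.isGl_T.coeffComm_sInv_rootQdet i j (s + 1) n) y
    rw [Subalgebra.mem_centralizer_iff] at this
    exact (this _ rfl).symm
  have h3 : (polyEval fun s => ⟨_, hcen s⟩).comp polyScale = projGl := YGl.hom_ext fun i j => by
    rw [map_polyEval_polyScale, map_projGl, seriesOf_coeff (coeff_zero_sInv _)]
    rfl
  rw [← h3, AlgHom.comp_apply, h1, polyEval_tmul, map_one]
  simp

lemma projSl_val (x : YSl 2) : projSl x = x := Subtype.ext (projGl_eq_self x.2)

lemma projSl_surjective : Function.Surjective projSl := fun x => ⟨x, projSl_val x⟩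

end Projection

/-! ### Recovering the factors of a Kronecker product -/

section FactorMaps

variable {A B : Type*} [Ring A] [Algebra ℂ A] [Ring B] [Algebra ℂ B]

lemma map_qdetOf (T : Fin 2 → Fin 2 → A⟦X⟧) (φ : A →ₐ[ℂ] B) :
    PowerSeries.map φ.toRingHom (qdetOf T) =
      qdetOf fun i j => PowerSeries.map φ.toRingHom (T i j) := by
  simp only [qdetOf, shiftHom_apply, map_sub, map_mul, map_shiftOne]

lemma IsO.map_fstFactor {t : Fin 4 → Fin 4 → A⟦X⟧} (ht : IsO t) (φ : A →ₐ[ℂ] B) (a c : Fin 2) :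
    PowerSeries.map φ.toRingHom (fstFactor t a c) =
      fstFactor (fun i j => PowerSeries.map φ.toRingHom (t i j)) a c :=
  map_normalized ht.fstBlock_isGl φ a c

lemma IsO.map_sndFactor {t : Fin 4 → Fin 4 → A⟦X⟧} (ht : IsO t) (φ : A →ₐ[ℂ] B) (b d : Fin 2) :
    PowerSeries.map φ.toRingHom (sndFactor t b d) =
      sndFactor (fun i j => PowerSeries.map φ.toRingHom (t i j)) b d := by
  rw [sndFactor, map_mul, map_sInv φ ht.coeff_zero_fstFactor, ht.map_fstFactor]
  rfl

namespace IsGl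

variable {T T' : Fin 2 → Fin 2 → A⟦X⟧}

/-- The first block is T'_00 T; normalization removes the factor T'_00 and then does nothing to T,
whose quantum determinant is 1. -/
lemma fstFactor_kron (hT : IsGl T) (hT' : IsGl T') (h : ∀ i j k l, CoeffComm (T i j) (T' k l))
    (hq : qdetOf T = 1) : fstFactor (kron T T') = T := by
  have e : fstBlock (kron T T') = fun a c => T' 0 0 * T a c := by
    funext a c
    rw [fstBlock, kron_idx, (h a c 0 0).commute.eq]
    simp [sgn]
  funext a c
  rw [fstFactor, e, normalized_scale hT (by simpa using hT'.coeff_zero 0 0)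
    fun i j => (h i j 0 0).symm, normalized_eq_self hq]

lemma sndFactor_kron (hT : IsGl T) (hT' : IsGl T') (h : ∀ i j k l, CoeffComm (T i j) (T' k l))
    (hq : qdetOf T = 1) : sndFactor (kron T T') = T' := by
  funext b d
  have e : sndBlock (kron T T') b d = T 0 0 * T' b d := by
    rw [sndBlock, kron_idx]
    simp [sgn]
  rw [sndFactor, hT.fstFactor_kron hT' h hq, e, ← mul_assoc,
    sInv_mul (by simpa using hT.coeff_zero 0 0), one_mul]

end IsGl

end FactorMaps

/-! ### Bijectivity of χ⁽¹⁾ -/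

section FirstProjection

/-- The series `𝒯_{ij}(u)` over `Y(sl_2)`. -/
def slT (i j : Fin 2) : (YSl 2)⟦X⟧ := PowerSeries.map projSl.toRingHom (YGl.T i j)

lemma qdetOf_slT : qdetOf slT = 1 := by
  have h : PowerSeries.map (YSl 2).val.toRingHom (qdetOf slT) = 1 := by
    have e : (fun i j => PowerSeries.map (YSl 2).val.toRingHom (slT i j)) =
        normalized YGl.T := by
      funext i j
      rw [slT, ← map_comp, val_comp_projSl, map_projGl, calT_eq]
    rw [map_qdetOf, e, YGl.isGl_T.qdetOf_normalized]
  ext n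
  have := congrArg (PowerSeries.coeff n) h
  rw [PowerSeries.coeff_map] at this
  refine this.trans ?_
  rw [PowerSeries.coeff_one, PowerSeries.coeff_one]
  split_ifs <;> rfl

lemma tensor_hom_ext {B : Type*} [Ring B] [Algebra ℂ B] {φ χ : YGl 2 ⊗[ℂ] YGl 2 →ₐ[ℂ] B}
    (h : ∀ i j, PowerSeries.map φ.toRingHom (leftT i j) = PowerSeries.map χ.toRingHom (leftT i j))
    (h' : ∀ i j,
      PowerSeries.map φ.toRingHom (rightT i j) = PowerSeries.map χ.toRingHom (rightT i j)) :
    φ = χ := by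
  refine Algebra.TensorProduct.ext (YGl.hom_ext fun i j => ?_) (YGl.hom_ext fun i j => ?_)
  · rw [map_comp, map_comp]
    exact h i j
  · exact h' i j

/-- The homomorphism `π ⊗ id`. -/
def projLeft : YGl 2 ⊗[ℂ] YGl 2 →ₐ[ℂ] YSl 2 ⊗[ℂ] YGl 2 :=
  Algebra.TensorProduct.map projSl (AlgHom.id ℂ (YGl 2))

lemma projLeft_surjective : Function.Surjective projLeft :=
  TensorProduct.map_surjective projSl_surjective Function.surjective_id

lemma map_projLeft_leftT (i j : Fin 2) : PowerSeries.map projLeft.toRingHom (leftT i j) =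
    PowerSeries.map (Algebra.TensorProduct.includeLeft :
      YSl 2 →ₐ[ℂ] YSl 2 ⊗[ℂ] YGl 2).toRingHom (slT i j) := by
  rw [leftT, slT, ← map_comp, ← map_comp]
  congr 2

/-- After π ⊗ id the first matrix of the Kronecker product has quantum determinant 1, so factoring
the image of t(u) returns the images of the two original matrices. -/
lemma projLeft_comp_psi_comp_rho : (projLeft.comp psi).comp rho = projLeft := by
  have hN : IsGl fun i j => PowerSeries.map projLeft.toRingHom (leftT i j) :=
    (YGl.isGl_T.map _).map projLeft
  have hR : IsGl fun i j => PowerSeries.map projLeft.toRingHom (rightT i j) :=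
    (YGl.isGl_T.map _).map projLeft
  have hc : ∀ i j k l, CoeffComm (PowerSeries.map projLeft.toRingHom (leftT i j))
      (PowerSeries.map projLeft.toRingHom (rightT k l)) := fun i j k l m n => by
    rw [PowerSeries.coeff_map, PowerSeries.coeff_map]
    exact (coeffComm_leftT_rightT i j k l m n).map projLeft
  have hq : qdetOf (fun i j => PowerSeries.map projLeft.toRingHom (leftT i j)) = 1 := by
    simp only [map_projLeft_leftT]
    rw [← map_qdetOf, qdetOf_slT, map_one]
  have e : (fun i j => PowerSeries.map (projLeft.comp psi).toRingHom (XO.t i j)) =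
      kron (fun i j => PowerSeries.map projLeft.toRingHom (leftT i j))
        fun i j => PowerSeries.map projLeft.toRingHom (rightT i j) := by
    funext i j
    obtain ⟨a, b, rfl⟩ := exists_eq_idx i
    obtain ⟨c, d, rfl⟩ := exists_eq_idx j
    rw [map_comp, map_psi, kron_idx, kron_idx, ← map_mul]
    ext n
    simp only [PowerSeries.coeff_map, PowerSeries.coeff_smul]
    exact map_smul projLeft _ _
  refine tensor_hom_ext (fun i j => ?_) fun i j => ?_
  · rw [map_comp, map_rho_leftT, XO.isO_t.map_fstFactor, e, hN.fstFactor_kron hR hc hq]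
  · rw [map_comp, map_rho_rightT, XO.isO_t.map_sndFactor, e, hN.sndFactor_kron hR hc hq]

/-- The image F of the first matrix under ρ already has quantum determinant 1, so normalizing
beforehand changes nothing. -/
lemma rho_comp_map_projGl :
    rho.comp (Algebra.TensorProduct.map projGl (AlgHom.id ℂ (YGl 2))) = rho := by
  refine tensor_hom_ext (fun i j => ?_) fun i j => ?_
  · have h1 : (rho.comp (Algebra.TensorProduct.map projGl (AlgHom.id ℂ (YGl 2)))).comp
        Algebra.TensorProduct.includeLeft =
          (rho.comp Algebra.TensorProduct.includeLeft).comp projGl := by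
      ext x
      simp
    have h2 : (fun i j => PowerSeries.map
        (rho.comp Algebra.TensorProduct.includeLeft).toRingHom (YGl.T i j)) =
          fstFactor XO.t := by
      funext i j
      rw [map_comp]
      exact map_rho_leftT i j
    rw [map_rho_leftT, leftT, ← map_comp, h1, map_comp, map_projGl, calT_eq,
      map_normalized YGl.isGl_T, h2, normalized_eq_self]
    exact XO.isO_t.fstBlock_isGl.qdetOf_normalized
  · rw [rightT, ← map_comp, ← map_comp]
    congr 2
    ext x
    simp

lemma chi₁_bijective : Function.Bijective (chi₁ projSl psi) := by
  refine ⟨?_, fun y => ?_⟩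
  · have e : ∀ w, Algebra.TensorProduct.map (YSl 2).val (AlgHom.id ℂ (YGl 2)) (projLeft w) =
        Algebra.TensorProduct.map projGl (AlgHom.id ℂ (YGl 2)) w := fun w => by
      induction w using TensorProduct.induction_on with
      | zero => simp only [map_zero]
      | tmul x y => rfl
      | add x y hx hy => simp only [map_add, hx, hy]
    have h : Function.LeftInverse
        (rho.comp (Algebra.TensorProduct.map (YSl 2).val (AlgHom.id ℂ (YGl 2))))
        (chi₁ projSl psi) := fun x =>
      (congrArg rho (e (psi x))).trans ((DFunLike.congr_fun rho_comp_map_projGl (psi x)).trans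
        (DFunLike.congr_fun rho_comp_psi x))
    exact h.injective
  · obtain ⟨x, rfl⟩ := projLeft_surjective y
    exact ⟨rho x, DFunLike.congr_fun projLeft_comp_psi_comp_rho x⟩

end FirstProjection

/-! ### Exchange of the tensor factors and bijectivity of χ⁽²⁾ -/

section Flip

variable {A : Type*} [Ring A] [Algebra ℂ A]

/-- The relations involve the indices only through equality and i ↦ -i, and the sums over p are
merely reindexed. -/
lemma IsO.permute {t : Fin 4 → Fin 4 → A⟦X⟧} (ht : IsO t) (s : Equiv.Perm (Fin 4))
    (hs : ∀ i, (s i).rev = s i.rev) : IsO fun i j => t (s i) (s j) where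
  coeff_zero i j := by simp only [ht.coeff_zero, s.injective.eq_iff]
  rel i j k l := by
    have h := ht.rel (s i) (s j) (s k) (s l)
    simp only [oLHS, oRHS, hs, s.injective.eq_iff] at h ⊢
    rw [h, ← Equiv.sum_comp s, ← Equiv.sum_comp s (fun p => inV (t (s k) p.rev) * _)]
    simp only [hs]

/-- The exchange of `e_a ⊗ e_b` with `e_b ⊗ e_a`. -/
def flipIdx : Equiv.Perm (Fin 4) := Equiv.swap 1 2

lemma flipIdx_idx (a b : Fin 2) : flipIdx (idx a b) = idx b a := by
  revert a b; decide

lemma rev_flipIdx (i : Fin 4) : (flipIdx i).rev = flipIdx i.rev := by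
  revert i; decide

lemma flipIdx_flipIdx (i : Fin 4) : flipIdx (flipIdx i) = i := by
  revert i; decide

lemma isO_flip : IsO fun i j => XO.t (flipIdx i) (flipIdx j) :=
  XO.isO_t.permute flipIdx rev_flipIdx

/-- The automorphism of `X(o_4)` induced by the exchange of the factors of `ℂ² ⊗ ℂ²`. -/
def flip : XO 4 →ₐ[ℂ] XO 4 := XO.lift _ isO_flip.coeff_zero isO_flip.rel

lemma map_flip (i j : Fin 4) :
    PowerSeries.map flip.toRingHom (XO.t i j) = XO.t (flipIdx i) (flipIdx j) :=
  XO.map_lift _ isO_flip.coeff_zero isO_flip.rel i j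

lemma flip_flip (x : XO 4) : flip (flip x) = x := by
  have h : flip.comp flip = AlgHom.id ℂ (XO 4) := XO.hom_ext fun i j => by
    rw [map_comp, map_flip, map_flip, flipIdx_flipIdx, flipIdx_flipIdx, map_id]
  exact DFunLike.congr_fun h x

lemma flip_bijective : Function.Bijective flip :=
  Function.Involutive.bijective flip_flip

lemma psi_flip (x : XO 4) :
    psi (flip x) = Algebra.TensorProduct.comm ℂ (YGl 2) (YGl 2) (psi x) := by
  have hl : ∀ i j, PowerSeries.map (Algebra.TensorProduct.comm ℂ (YGl 2) (YGl 2)).toAlgHom.toRingHom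
      (leftT i j) = rightT i j := fun i j => by
    ext n
    simp only [leftT, rightT, PowerSeries.coeff_map]
    exact Algebra.TensorProduct.comm_tmul ℂ _ _
  have hr : ∀ i j, PowerSeries.map (Algebra.TensorProduct.comm ℂ (YGl 2) (YGl 2)).toAlgHom.toRingHom
      (rightT i j) = leftT i j := fun i j => by
    ext n
    simp only [leftT, rightT, PowerSeries.coeff_map]
    exact Algebra.TensorProduct.comm_tmul ℂ _ _
  have h : psi.comp flip =
      (Algebra.TensorProduct.comm ℂ (YGl 2) (YGl 2)).toAlgHom.comp psi := by
    refine XO.hom_ext fun i j => ?_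
    obtain ⟨a, b, rfl⟩ := exists_eq_idx i
    obtain ⟨c, d, rfl⟩ := exists_eq_idx j
    rw [map_comp, map_comp, map_flip, map_psi, map_psi, flipIdx_idx, flipIdx_idx, kron_idx,
      kron_idx, (coeffComm_leftT_rightT b d a c).commute.eq, ← hl a c, ← hr b d, ← map_mul]
    ext n
    simp only [PowerSeries.coeff_map, PowerSeries.coeff_smul]
    have e : ∀ a b, sgn a b = sgn b a := fun a b => by simp only [sgn, and_comm]
    rw [e b a, e d c]
    exact (map_smul (Algebra.TensorProduct.comm ℂ (YGl 2) (YGl 2)) _ _).symm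
  exact DFunLike.congr_fun h x

lemma chi₂_eq (x : XO 4) : chi₂ projSl psi x =
    Algebra.TensorProduct.comm ℂ (YSl 2) (YGl 2) (chi₁ projSl psi (flip x)) := by
  change Algebra.TensorProduct.map _ _ (psi x) =
    Algebra.TensorProduct.comm ℂ (YSl 2) (YGl 2) (Algebra.TensorProduct.map _ _ (psi (flip x)))
  rw [psi_flip]
  generalize psi x = w
  induction w using TensorProduct.induction_on with
  | zero => simp only [map_zero]
  | tmul x y => rfl
  | add x y hx hy => simp only [map_add, hx, hy]

lemma chi₂_bijective : Function.Bijective (chi₂ projSl psi) := by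
  have h : ⇑(chi₂ projSl psi) = Algebra.TensorProduct.comm ℂ (YSl 2) (YGl 2) ∘
      chi₁ projSl psi ∘ flip := funext chi₂_eq
  rw [h]
  exact (AlgEquiv.bijective _).comp (chi₁_bijective.comp flip_bijective)

lemma incl₂_comm (z : YSl 2 ⊗[ℂ] YSl 2) :
    incl₂ (Algebra.TensorProduct.comm ℂ (YSl 2) (YSl 2) z) =
      Algebra.TensorProduct.comm ℂ (YSl 2) (YGl 2) (incl₁ z) := by
  induction z using TensorProduct.induction_on with
  | zero => simp only [map_zero]
  | tmul x y => rfl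
  | add x y hx hy => simp only [map_add, hx, hy]

lemma scale_flip (g : ℂ⟦X⟧) (hg : PowerSeries.constantCoeff g = 1) (x : XO 4) :
    XO.scale 4 g hg (flip x) = flip (XO.scale 4 g hg x) := by
  have h : (XO.scale 4 g hg).comp flip = flip.comp (XO.scale 4 g hg) := XO.hom_ext fun i j => by
    rw [map_comp, map_comp, map_flip, XO.map_scale, XO.map_scale, map_mul, map_scalarSeries,
      map_flip]
  exact DFunLike.congr_fun h x

lemma flip_mem_YO {x : XO 4} (hx : x ∈ YO 4) : flip x ∈ YO 4 := by
  rw [mem_YO_iff] at hx ⊢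
  intro g hg
  rw [scale_flip, hx]

end Flip

/-! ### Fixed points of the scalings: Y(o_4) and Y(sl_2) ⊗ Y(sl_2) -/

section FixedPoints

/-- The scalar factor of T₁(u) T'₂(u) can be put entirely on the second factor, which π ⊗ id leaves
untouched. -/
lemma chi₁_scale (g : ℂ⟦X⟧) (hg : PowerSeries.constantCoeff g = 1) (x : XO 4) :
    chi₁ projSl psi (XO.scale 4 g hg x) = Algebra.TensorProduct.map (AlgHom.id ℂ (YSl 2))
      (YGl.scale 2 g hg) (chi₁ projSl psi x) := by
  have h : psi.comp (XO.scale 4 g hg) =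
      (Algebra.TensorProduct.map (AlgHom.id ℂ (YGl 2)) (YGl.scale 2 g hg)).comp psi := by
    set Φ := Algebra.TensorProduct.map (AlgHom.id ℂ (YGl 2)) (YGl.scale 2 g hg)
    have hl : ∀ i j, PowerSeries.map Φ.toRingHom (leftT i j) = leftT i j := fun i j => by
      ext n
      simp only [leftT, PowerSeries.coeff_map]
      refine (Algebra.TensorProduct.map_tmul _ _ _ _).trans ?_
      rw [map_one]
      rfl
    have hr : ∀ i j, PowerSeries.map Φ.toRingHom (rightT i j) =
        scalarSeries _ g * rightT i j := fun i j => by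
      have e : Φ.comp Algebra.TensorProduct.includeRight =
          Algebra.TensorProduct.includeRight.comp (YGl.scale 2 g hg) := by
        ext x
        simp [Φ]
      rw [rightT, ← map_comp, e, map_comp, YGl.map_scale, map_mul, map_scalarSeries]
    refine XO.hom_ext fun i j => ?_
    obtain ⟨a, b, rfl⟩ := exists_eq_idx i
    obtain ⟨c, d, rfl⟩ := exists_eq_idx j
    rw [map_comp, map_comp, XO.map_scale, map_mul, map_scalarSeries, map_psi, kron_idx]
    have e : scalarSeries _ g * (leftT a c * rightT b d) =
        PowerSeries.map Φ.toRingHom (leftT a c * rightT b d) := by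
      rw [map_mul, hl, hr, ← mul_assoc, ← mul_assoc, (coeffComm_scalarSeries g _).commute.eq]
    rw [mul_smul_comm, e]
    ext n
    simp only [PowerSeries.coeff_map, PowerSeries.coeff_smul]
    exact (map_smul Φ _ _).symm
  have h' : psi (XO.scale 4 g hg x) = _ := DFunLike.congr_fun h x
  rw [AlgHom.comp_apply] at h'
  change Algebra.TensorProduct.map _ _ (psi _) = Algebra.TensorProduct.map _ _
    (Algebra.TensorProduct.map _ _ (psi x))
  rw [h']
  generalize psi x = w
  induction w using TensorProduct.induction_on with
  | zero => simp only [map_zero]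
  | tmul x y => rfl
  | add x y hx hy => simp only [map_add, hx, hy]

/-- The elements of `Y(sl_2) ⊗ Y(gl_2)` fixed by `id ⊗ (T(u) ↦ g(u) T(u))` for all `g(u)`. -/
lemma map_projGl_eq_self {w : YSl 2 ⊗[ℂ] YGl 2}
    (h : ∀ g hg, Algebra.TensorProduct.map (AlgHom.id ℂ (YSl 2)) (YGl.scale 2 g hg) w = w) :
    Algebra.TensorProduct.map (AlgHom.id ℂ (YSl 2)) projGl w = w := by
  classical
  -- In a basis of the first tensor factor, each coordinate is fixed by all scalings, hence lies in
  -- Y(sl_2), where the projection is the identity.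
  let b := Module.Basis.ofVectorSpace ℂ (YSl 2)
  have key : ∀ (φ : YGl 2 →ₐ[ℂ] YGl 2) (w : YSl 2 ⊗[ℂ] YGl 2) k,
      TensorProduct.equivFinsuppOfBasisLeft b
        (Algebra.TensorProduct.map (AlgHom.id ℂ (YSl 2)) φ w) k =
      φ (TensorProduct.equivFinsuppOfBasisLeft b w k) := by
    intro φ w k
    induction w using TensorProduct.induction_on with
    | zero => simp
    | tmul p x =>
      rw [Algebra.TensorProduct.map_tmul,
        TensorProduct.equivFinsuppOfBasisLeft_apply_tmul_apply,
        TensorProduct.equivFinsuppOfBasisLeft_apply_tmul_apply, map_smul, AlgHom.id_apply]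
    | add x y hx hy => simp only [map_add, Finsupp.add_apply, hx, hy]
  apply (TensorProduct.equivFinsuppOfBasisLeft b).injective
  ext1 k
  rw [key]
  refine projGl_eq_self (mem_YSl_iff.2 fun g hg => ?_)
  rw [← key, h]

lemma incl₁_map_projSl (w : YSl 2 ⊗[ℂ] YGl 2) :
    incl₁ (Algebra.TensorProduct.map (AlgHom.id ℂ (YSl 2)) projSl w) =
      Algebra.TensorProduct.map (AlgHom.id ℂ (YSl 2)) projGl w := by
  induction w using TensorProduct.induction_on with
  | zero => simp only [map_zero]
  | tmul x y => rfl
  | add x y hx hy => simp only [map_add, hx, hy]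

lemma map_projSl_incl₁ (z : YSl 2 ⊗[ℂ] YSl 2) :
    Algebra.TensorProduct.map (AlgHom.id ℂ (YSl 2)) projSl (incl₁ z) = z := by
  induction z using TensorProduct.induction_on with
  | zero => simp only [map_zero]
  | tmul x y => exact congrArg (x ⊗ₜ[ℂ] ·) (projSl_val y)
  | add x y hx hy => simp only [map_add, hx, hy]

lemma map_scale_incl₁ (g : ℂ⟦X⟧) (hg : PowerSeries.constantCoeff g = 1)
    (z : YSl 2 ⊗[ℂ] YSl 2) :
    Algebra.TensorProduct.map (AlgHom.id ℂ (YSl 2)) (YGl.scale 2 g hg) (incl₁ z) = incl₁ z := by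
  induction z using TensorProduct.induction_on with
  | zero => simp only [map_zero]
  | tmul x y => exact congrArg (x ⊗ₜ[ℂ] ·) (mem_YSl_iff.1 y.2 g hg)
  | add x y hx hy => simp only [map_add, hx, hy]

/-- The homomorphism `Y(o_4) → Y(sl_2) ⊗ Y(sl_2)`. -/
def resChi : YO 4 →ₐ[ℂ] YSl 2 ⊗[ℂ] YSl 2 :=
  (Algebra.TensorProduct.map (AlgHom.id ℂ (YSl 2)) projSl).comp
    ((chi₁ projSl psi).comp (YO 4).val)

/-- The extra id ⊗ π in `resChi` only serves to land in Y(sl_2) ⊗ Y(sl_2): χ⁽¹⁾(y) is fixed by all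
scalings of the second factor, so id ⊗ π does not move it. -/
lemma incl₁_resChi (y : YO 4) : incl₁ (resChi y) = chi₁ projSl psi y := by
  refine (incl₁_map_projSl _).trans (map_projGl_eq_self fun g hg => ?_)
  exact (chi₁_scale g hg y).symm.trans (congrArg _ (mem_YO_iff.1 y.2 g hg))

lemma resChi_bijective : Function.Bijective resChi := by
  refine ⟨fun x y h => ?_, fun z => ?_⟩
  · refine Subtype.ext (chi₁_bijective.1 ?_)
    rw [← incl₁_resChi, ← incl₁_resChi, h]
  · obtain ⟨x, hx⟩ := chi₁_bijective.2 (incl₁ z)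
    have hm : x ∈ YO 4 := mem_YO_iff.2 fun g hg => chi₁_bijective.1 <| by
      rw [chi₁_scale, hx, map_scale_incl₁]
    refine ⟨⟨x, hm⟩, ?_⟩
    rw [← map_projSl_incl₁ z, ← hx]
    rfl

/-- The automorphism of `Y(o_4)` induced by the exchange of the factors of `ℂ² ⊗ ℂ²`. -/
def flipYO : YO 4 →ₐ[ℂ] YO 4 :=
  (flip.comp (YO 4).val).codRestrict (YO 4) fun x => flip_mem_YO x.2

lemma flipYO_bijective : Function.Bijective flipYO :=
  Function.Involutive.bijective fun x => Subtype.ext (flip_flip x)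

end FixedPoints

end LowRankYangian

end

open LowRankYangian in
theorem corollary4p11 :
    ∃ (π : YGl 2 →ₐ[ℂ] YSl 2) (ψ : XO 4 →ₐ[ℂ] YGl 2 ⊗[ℂ] YGl 2),
      IsProjSl π ∧ IsPsi ψ ∧ Function.Injective ψ ∧
      Function.Bijective (chi₁ π ψ) ∧ Function.Bijective (chi₂ π ψ) ∧
      (∃ e : YO 4 ≃ₐ[ℂ] YSl 2 ⊗[ℂ] YSl 2, ∀ y : YO 4, incl₁ (e y) = chi₁ π ψ y) ∧
      (∃ e : YO 4 ≃ₐ[ℂ] YSl 2 ⊗[ℂ] YSl 2, ∀ y : YO 4, incl₂ (e y) = chi₂ π ψ y) := by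
  refine ⟨projSl, psi, isProjSl_projSl, isPsi_psi,
    Function.LeftInverse.injective (DFunLike.congr_fun rho_comp_psi), chi₁_bijective,
    chi₂_bijective, ⟨AlgEquiv.ofBijective resChi resChi_bijective, incl₁_resChi⟩,
    -- The second isomorphism is the first conjugated by the exchange of factors, on Y(o_4) and on
    -- Y(sl_2) ⊗ Y(sl_2).
    ⟨((AlgEquiv.ofBijective flipYO flipYO_bijective).trans
      (AlgEquiv.ofBijective resChi resChi_bijective)).trans
        (Algebra.TensorProduct.comm ℂ (YSl 2) (YSl 2)), fun y => ?_⟩⟩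
  refine (incl₂_comm _).trans ?_
  rw [chi₂_eq]
  exact congrArg _ (incl₁_resChi (flipYO y))
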